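/- Let $(M,g)$ be an oriented four-dimensional Riemannian spin manifold with two-dimensional spinor bundles $S_+$, $S_-$ (so that $TM\otimes\mathbb C\cong S_+\otimes S_-$ and $\Lambda^\pm\otimes\mathbb C\cong S_\pm^2$), and let $\nabla$ be the covariant derivative on spinors induced by the Levi-Civita connection. For $k,n\ge 0$ let $S_+^k\otimes S_-^n$ be the tensor product of the symmetrised tensor powers; its smooth sections are written $\psi^{A_1\ldots A_kA_1'\ldots A_n'}$, symmetric in the unprimed ($S_+$) and in the primed ($S_-$) indices. With $\nabla^{AA'}$ the covariant derivative in spinor notation, round brackets for symmetrisation (separately over unprimed and primed indices) and spinor indices lowered with the spinor metric $\epsilon_{AB}$, define $$d: S_+^k\otimes S_-^n\to S_+^{k+1}\otimes S_-^{n+1},\qquad (d\psi)^{A_1\ldots A_{k+1}A_1'\ldots A_{n+1}'}=(k+1)(n+1)\,\nabla^{(A_{k+1}(A_{n+1}'}\psi^{A_1'\ldots A_n')A_1\ldots A_k)},$$ $$\delta^*: S_+^k\otimes S_-^n\to S_+^{k-1}\otimes S_-^{n+1}\ (k\ge 1),\qquad (\delta^*\psi)^{A_1\ldots A_{k-1}A_1'\ldots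 A_{n+1}'}=(n+1)\,\nabla^{A(A_{n+1}'}\psi^{A_1'\ldots A_n')A_1\ldots A_{k-1}}{}_A,$$ and $\delta^*=0$ on $S_-^n$ (the case $k=0$), so that there $d\delta^*-\delta^*d=-\delta^*d$. Let $W^-$ be the anti-self-dual part of the Weyl tensor, and call $g$ Einstein if its Ricci tensor is proportional to the metric, i.e. $\mathrm{Ric}=\lambda g$ for some function $\lambda$ on $M$ (equivalently, the trace-free part of $\mathrm{Ric}$ vanishes). Then: 1. $d\delta^*-\delta^*d$ vanishes on all smooth sections of $S_+^k\otimes S_-^n$ for all $k,n\ge 0$ if and only if $W^-=0$ and $g$ is Einstein. Moreover, for each fixed $k\ge1$ and $n\ge 1$, $d\delta^*-\delta^*d$ vanishes on all smooth sections of $S_+^k\otimes S_-^n$ if and only if $W^-=0$ and $g$ is Einstein. 2. For each $n\ge 1$, $\delta^*d$ vanishes on all smooth sections of $S_-^n$ if and only if $W^-=0$. 3. For each $k\ge 1$, $d\delta^*-\delta^*d$ vanishes on all smooth sections of $S_+^k$ if and only if $g$ is Einstein. -/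

import Mathlib

open Bundle
open scoped Manifold ContDiff

noncomputable section

namespace SpinorDiagram

/-- The model space of four-dimensional manifolds. -/
abbrev E4 : Type := EuclideanSpace ℝ (Fin 4)

/-! ### Curvature of a four-dimensional Riemannian manifold

The Riemannian metric is the inner product `inner ℝ` on the tangent spaces provided by Mathlib's
`RiemannianBundle`. -/

section Riemannian

variable {M : Type*} [TopologicalSpace M] [ChartedSpace E4 M]

theorem finrank_tangentSpace [RiemannianBundle (fun x : M => TangentSpace 𝓘(ℝ, E4) x)] (x : M) :
    Module.finrank ℝ (TangentSpace 𝓘(ℝ, E4) x) = 4 :=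
  finrank_euclideanSpace_fin (𝕜 := ℝ) (n := 4)

instance fact_finrank_tangentSpace [RiemannianBundle (fun x : M => TangentSpace 𝓘(ℝ, E4) x)]
    (x : M) : Fact (Module.finrank ℝ (TangentSpace 𝓘(ℝ, E4) x) = 4) :=
  ⟨finrank_tangentSpace x⟩

instance finiteDimensional_tangentSpace
    [RiemannianBundle (fun x : M => TangentSpace 𝓘(ℝ, E4) x)] (x : M) :
    FiniteDimensional ℝ (TangentSpace 𝓘(ℝ, E4) x) :=
  Module.finite_of_finrank_pos (by rw [finrank_tangentSpace x]; norm_num)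

/-- Vector fields on `M` (without regularity; a field that is only relevant near a point may take
arbitrary values elsewhere). -/
abbrev VField (M : Type*) [TopologicalSpace M] [ChartedSpace E4 M] : Type _ :=
  (x : M) → TangentSpace 𝓘(ℝ, E4) x

/-- Extension of a tangent vector at `x` to a vector field that is smooth near `x`. -/
def extendVec {x : M} [IsManifold 𝓘(ℝ, E4) 1 M] (v : TangentSpace 𝓘(ℝ, E4) x) : VField M :=
  FiberBundle.extend E4 (E := fun y : M => TangentSpace 𝓘(ℝ, E4) y) v

variable [RiemannianBundle (fun x : M => TangentSpace 𝓘(ℝ, E4) x)]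

/-- The right-hand side of the Koszul formula, divided by two. -/
def koszul (X Y Z : VField M) (x : M) : ℝ :=
  (mvfderiv 𝓘(ℝ, E4) (fun y => inner ℝ (Y y) (Z y)) x (X x)
    + mvfderiv 𝓘(ℝ, E4) (fun y => inner ℝ (Z y) (X y)) x (Y x)
    - mvfderiv 𝓘(ℝ, E4) (fun y => inner ℝ (X y) (Y y)) x (Z x)
    + inner ℝ (VectorField.mlieBracket 𝓘(ℝ, E4) X Y x) (Z x)
    - inner ℝ (VectorField.mlieBracket 𝓘(ℝ, E4) Y Z x) (X x)
    + inner ℝ (VectorField.mlieBracket 𝓘(ℝ, E4) Z X x) (Y x)) / 2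

/-- An orthonormal basis of the tangent space at `x`, used for traces. -/
def onb (x : M) : OrthonormalBasis (Fin 4) ℝ (TangentSpace 𝓘(ℝ, E4) x) :=
  (stdOrthonormalBasis ℝ (TangentSpace 𝓘(ℝ, E4) x)).reindex
    (finCongr (finrank_tangentSpace x))

variable [IsManifold 𝓘(ℝ, E4) 1 M]

/-- The Levi-Civita covariant derivative `∇_X Y`: the vector whose inner product with each `Z` is
given by the Koszul formula. -/
def nabla (X Y : VField M) : VField M := fun x =>
  ∑ i, koszul X Y (extendVec (onb x i)) x • onb x i

/-- `R(X, Y) Z = ∇_X ∇_Y Z - ∇_Y ∇_X Z - ∇_[X, Y] Z`. -/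
def curvatureField (X Y Z : VField M) : VField M :=
  nabla X (nabla Y Z) - nabla Y (nabla X Z)
    - nabla (VectorField.mlieBracket 𝓘(ℝ, E4) X Y) Z

/-- The Riemann tensor `⟨R(u, v) w, z⟩` at `x`. -/
def riem (x : M) (u v w z : TangentSpace 𝓘(ℝ, E4) x) : ℝ :=
  inner ℝ (curvatureField (extendVec u) (extendVec v) (extendVec w) x) z

/-- The Ricci tensor, `Ric(u, v) = tr (w ↦ R(w, u) v)`. -/
def ric (x : M) (u v : TangentSpace 𝓘(ℝ, E4) x) : ℝ :=
  ∑ i, riem x (onb x i) u v (onb x i)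

/-- The scalar curvature. -/
def scal (x : M) : ℝ := ∑ i, ric x (onb x i) (onb x i)

/-- The Weyl tensor in dimension four, as a covariant 4-tensor. -/
def weyl (x : M) (u v w z : TangentSpace 𝓘(ℝ, E4) x) : ℝ :=
  riem x u v w z
    - (ric x v w * inner ℝ u z + inner ℝ v w * ric x u z
        - ric x u w * inner ℝ v z - inner ℝ u w * ric x v z) / 2
    + scal x / 6 * (inner ℝ v w * inner ℝ u z - inner ℝ u w * inner ℝ v z)

/-- The Hodge dual of the Weyl tensor (in the first pair of arguments) for an orientation of the
tangent space. -/
def starWeyl (x : M) (o : Orientation ℝ (TangentSpace 𝓘(ℝ, E4) x) (Fin 4))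
    (u v w z : TangentSpace 𝓘(ℝ, E4) x) : ℝ :=
  (∑ i, ∑ j, o.volumeForm ![u, v, onb x i, onb x j] * weyl x (onb x i) (onb x j) w z) / 2

/-- The anti-self-dual part `W⁻ = (W - ⋆W) / 2` of the Weyl tensor. -/
def weylMinus (x : M) (o : Orientation ℝ (TangentSpace 𝓘(ℝ, E4) x) (Fin 4))
    (u v w z : TangentSpace 𝓘(ℝ, E4) x) : ℝ :=
  (weyl x u v w z - starWeyl x o u v w z) / 2

variable (M) in
/-- The Ricci tensor is proportional to the metric. -/
def IsEinstein : Prop :=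
  ∃ lam : M → ℝ, ∀ (x : M) (u v : TangentSpace 𝓘(ℝ, E4) x), ric x u v = lam x * inner ℝ u v

/-- The anti-self-dual part of the Weyl tensor vanishes identically. -/
def WeylMinusVanishes (o : (x : M) → Orientation ℝ (TangentSpace 𝓘(ℝ, E4) x) (Fin 4)) : Prop :=
  ∀ (x : M) (u v w z : TangentSpace 𝓘(ℝ, E4) x), weylMinus x (o x) u v w z = 0

end Riemannian

/-! ### Two-component spinors in dimension four -/

/-- The matrices `σ_a`, with entries `σ_a^{AA'}`, of the four quaternion units `1, i, j, k`. -/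
def sigma : Fin 4 → Matrix (Fin 2) (Fin 2) ℂ :=
  ![!![1, 0; 0, 1], !![0, -Complex.I; -Complex.I, 0], !![0, -1; 1, 0],
    !![-Complex.I, 0; 0, Complex.I]]

/-- The identification `v ↦ v^{AA'}` of `ℝ⁴` with a real form of `S₊ ⊗ S₋`. -/
def soldering (v : Fin 4 → ℝ) : Matrix (Fin 2) (Fin 2) ℂ := ∑ a, (v a : ℂ) • sigma a

/-- The spinor metric `ε_{AB}`, with `ε_{01} = 1`. -/
def eps : Matrix (Fin 2) (Fin 2) ℂ := !![0, 1; -1, 0]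

/-- The component in `𝔰𝔲(2)₊` of a skew matrix, under `𝔰𝔬(4) = 𝔰𝔲(2)₊ ⊕ 𝔰𝔲(2)₋`. Together with
`liftMinus` it is characterised by
`liftPlus ω * soldering v + soldering v * (liftMinus ω)ᵀ = soldering (ω v)`. -/
def liftPlus (om : Fin 4 → Fin 4 → ℝ) : Matrix (Fin 2) (Fin 2) ℂ :=
  (1 / 4 : ℂ) • ∑ b, ∑ c, (om b c : ℂ) • (sigma b * (sigma c).conjTranspose)

/-- The component in `𝔰𝔲(2)₋` of a skew matrix. -/
def liftMinus (om : Fin 4 → Fin 4 → ℝ) : Matrix (Fin 2) (Fin 2) ℂ :=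
  ((-1 / 4 : ℂ) • ∑ b, ∑ c, (om b c : ℂ) • ((sigma b).conjTranspose * sigma c)).transpose

/-- Component arrays `ψ^{A₁…A_k A'₁…A'_n}` with `k` unprimed and `n` primed spinor indices. -/
abbrev Spinor (k n : ℕ) : Type := (Fin k → Fin 2) → (Fin n → Fin 2) → ℂ

/-- The action of `(p, q) ∈ SU(2) × SU(2) = Spin(4)` on spinor components. -/
def spinAct {k n : ℕ} (p q : Matrix (Fin 2) (Fin 2) ℂ) (ψ : Spinor k n) : Spinor k n :=
  fun A A' => ∑ B : Fin k → Fin 2, ∑ B' : Fin n → Fin 2,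
    (∏ s, p (A s) (B s)) * (∏ t, q (A' t) (B' t)) * ψ B B'

/-- Total symmetrisation over the unprimed and, separately, over the primed indices. -/
def symmetrize {k n : ℕ} (T : Spinor k n) : Spinor k n := fun A A' =>
  ((k.factorial : ℂ) * (n.factorial : ℂ))⁻¹ *
    ∑ τ : Equiv.Perm (Fin k), ∑ ρ : Equiv.Perm (Fin n), T (A ∘ τ) (A' ∘ ρ)

section Spin

variable {M : Type*} [TopologicalSpace M] [ChartedSpace E4 M]
  [RiemannianBundle (fun x : M => TangentSpace 𝓘(ℝ, E4) x)] [IsManifold 𝓘(ℝ, E4) 1 M]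

/-- A spin structure on the oriented Riemannian four-manifold `M`: an atlas of smooth positively
oriented orthonormal frames, together with a smooth `SU(2) × SU(2)`-valued cocycle that lifts
the `SO(4)`-valued cocycle of the changes of frame. -/
structure SpinStructure (M : Type*) [TopologicalSpace M] [ChartedSpace E4 M]
    [RiemannianBundle (fun x : M => TangentSpace 𝓘(ℝ, E4) x)] [IsManifold 𝓘(ℝ, E4) 1 M]
    (o : (x : M) → Orientation ℝ (TangentSpace 𝓘(ℝ, E4) x) (Fin 4)) (ι : Type*) where
  /-- The patches. -/
  dom : ι → Set M
  isOpen_dom : ∀ i, IsOpen (dom i)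
  cover : ∀ x, ∃ i, x ∈ dom i
  /-- The frame on each patch (its values off the patch are irrelevant). -/
  frame : ι → Fin 4 → VField M
  frame_smooth : ∀ i a, ContMDiffOn 𝓘(ℝ, E4) 𝓘(ℝ, E4).tangent ∞
    (fun x => (⟨x, frame i a x⟩ : TangentBundle 𝓘(ℝ, E4) M)) (dom i)
  frame_orthonormal : ∀ i, ∀ x ∈ dom i, Orthonormal ℝ (fun a => frame i a x)
  frame_oriented : ∀ i, ∀ x ∈ dom i, (o x).volumeForm (fun a => frame i a x) = 1
  /-- The transition functions of `S₊`. -/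
  plus : ι → ι → M → Matrix (Fin 2) (Fin 2) ℂ
  /-- The transition functions of `S₋`. -/
  minus : ι → ι → M → Matrix (Fin 2) (Fin 2) ℂ
  plus_mem : ∀ i j, ∀ x ∈ dom i ∩ dom j, plus i j x ∈ Matrix.specialUnitaryGroup (Fin 2) ℂ
  minus_mem : ∀ i j, ∀ x ∈ dom i ∩ dom j, minus i j x ∈ Matrix.specialUnitaryGroup (Fin 2) ℂ
  plus_smooth : ∀ i j A B,
    ContMDiffOn 𝓘(ℝ, E4) 𝓘(ℝ, ℂ) ∞ (fun x => plus i j x A B) (dom i ∩ dom j)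
  minus_smooth : ∀ i j A B,
    ContMDiffOn 𝓘(ℝ, E4) 𝓘(ℝ, ℂ) ∞ (fun x => minus i j x A B) (dom i ∩ dom j)
  plus_cocycle : ∀ i j k, ∀ x ∈ dom i ∩ dom j ∩ dom k, plus i j x * plus j k x = plus i k x
  minus_cocycle : ∀ i j k, ∀ x ∈ dom i ∩ dom j ∩ dom k, minus i j x * minus j k x = minus i k x
  /-- The cocycle lifts the change of frame. -/
  lifts : ∀ i j, ∀ x ∈ dom i ∩ dom j, ∀ v : TangentSpace 𝓘(ℝ, E4) x,
    soldering (fun a => inner ℝ (frame i a x) v) =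
      plus i j x * soldering (fun a => inner ℝ (frame j a x) v) * (minus i j x).transpose

namespace SpinStructure

variable {o : (x : M) → Orientation ℝ (TangentSpace 𝓘(ℝ, E4) x) (Fin 4)} {ι : Type*}
  (S : SpinStructure M o ι)

/-- Families of component arrays, one for each patch. Only the values of the `i`-th member on the
`i`-th patch are meaningful. -/
abbrev Field (_S : SpinStructure M o ι) (k n : ℕ) : Type _ := ι → M → Spinor k n

/-- The family `ψ` represents a smooth section of `S₊ᵏ ⊗ S₋ⁿ`. -/
structure IsSection {k n : ℕ} (ψ : S.Field k n) : Prop where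
  smooth : ∀ i A A', ContMDiffOn 𝓘(ℝ, E4) 𝓘(ℝ, ℂ) ∞ (fun x => ψ i x A A') (S.dom i)
  symm : ∀ i, ∀ x ∈ S.dom i, ∀ (τ : Equiv.Perm (Fin k)) (ρ : Equiv.Perm (Fin n)) A A',
    ψ i x (A ∘ τ) (A' ∘ ρ) = ψ i x A A'
  compat : ∀ i j, ∀ x ∈ S.dom i ∩ S.dom j,
    ψ i x = spinAct (S.plus i j x) (S.minus i j x) (ψ j x)

/-- The Levi-Civita connection form in the `i`-th frame: `∇_{e_a} e_c = ∑_b ω_a(b, c) e_b`. -/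
def connForm (i : ι) (x : M) (a b c : Fin 4) : ℝ :=
  inner ℝ (S.frame i b x) (nabla (S.frame i a) (S.frame i c) x)

/-- The spinor covariant derivative `∇_{e_a} ψ` induced by the Levi-Civita connection. -/
def covDeriv {k n : ℕ} (a : Fin 4) (ψ : S.Field k n) : S.Field k n := fun i x A A' =>
  mvfderiv 𝓘(ℝ, E4) (fun y => ψ i y A A') x (S.frame i a x)
    + ∑ s, ∑ B, liftPlus (S.connForm i x a) (A s) B * ψ i x (Function.update A s B) A'
    + ∑ t, ∑ B', liftMinus (S.connForm i x a) (A' t) B' * ψ i x A (Function.update A' t B')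

/-- `∇^{AA'} ψ` in spinor notation. -/
def spinorDeriv {k n : ℕ} (A A' : Fin 2) (ψ : S.Field k n) : S.Field k n := fun i x =>
  ∑ a, sigma a A A' • S.covDeriv a ψ i x

/-- The operator `d : S₊ᵏ ⊗ S₋ⁿ → S₊ᵏ⁺¹ ⊗ S₋ⁿ⁺¹`. -/
def d {k n : ℕ} (ψ : S.Field k n) : S.Field (k + 1) (n + 1) := fun i x =>
  (((k + 1) * (n + 1) : ℕ) : ℂ) •
    symmetrize (fun A A' => S.spinorDeriv (A 0) (A' 0) ψ i x (Fin.tail A) (Fin.tail A'))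

/-- The operator `δ* : S₊ᵏ⁺¹ ⊗ S₋ⁿ → S₊ᵏ ⊗ S₋ⁿ⁺¹`; one unprimed index of `ψ` is lowered by
`ψ_A = ψ^B ε_{BA}` and contracted with the derivative. -/
def deltaStar {k n : ℕ} (ψ : S.Field (k + 1) n) : S.Field k (n + 1) := fun i x =>
  ((n + 1 : ℕ) : ℂ) •
    symmetrize (fun A A' => ∑ C, ∑ B,
      eps B C * S.spinorDeriv C (A' 0) ψ i x (Fin.cons B A) (Fin.tail A'))

/-- The commutator `d δ* - δ* d : S₊ᵏ ⊗ S₋ⁿ → S₊ᵏ ⊗ S₋ⁿ⁺²`. On `S₋ⁿ`, where `δ*` is zero, the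
first term is absent. -/
def commutator : {k n : ℕ} → S.Field k n → S.Field k (n + 2)
  | 0, _, ψ => -S.deltaStar (S.d ψ)
  | _ + 1, _, ψ => S.d (S.deltaStar ψ) - S.deltaStar (S.d ψ)

/-- The commutator `d δ* - δ* d` vanishes on all smooth sections of `S₊ᵏ ⊗ S₋ⁿ`. -/
def CommutatorVanishes (k n : ℕ) : Prop :=
  ∀ ψ : S.Field k n, S.IsSection ψ → ∀ i, ∀ x ∈ S.dom i, S.commutator ψ i x = 0

/-- The composition `δ* d` vanishes on all smooth sections of `S₋ⁿ`. -/
def DeltaStarDVanishes (n : ℕ) : Prop :=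
  ∀ ψ : S.Field 0 n, S.IsSection ψ → ∀ i, ∀ x ∈ S.dom i, S.deltaStar (S.d ψ) i x = 0

end SpinStructure

end Spin

end SpinorDiagram

end

/-! A symmetric spinor with k unprimed and n primed indices is a polynomial of bidegree (k, n) in
variables ξ (unprimed) and η (primed), and contraction with ξ and η makes every symmetrisation
invisible. Up to numerical factors, d becomes D = ∑ s_a ∇_a, with s_a the multiplication by
σ_a^{AA'} ξ_A η_A', and δ* becomes E = ∑ c_b ∇_b, with c_b the derivation ε_{BC} σ_b^{CA'} η_A'
∂/∂ξ_B. The normalisations of d and δ* turn dδ* - δ*d into (n+1)(n+2)[D, E]. The symbols are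
parallel and θ_ab = c_b(s_a) is skew in a, b, so no derivative of ψ survives: 2[D, E] = ∑ θ_ab (N +
1) F_ab, where F is the curvature and N the degree in ξ (`operator_commutator`,
`toPoly_algCommutator`).

The bivector θ is the anti-self-dual one built from η ⊗ η. The operator `curvOp` = ∑ θ_ab F_ab is a
derivation over ℂ. On ξ it is given by the block Λ⁻ → Λ⁺ of the curvature, which is the trace-free
Ricci tensor (`mixedBlock_eq_zero_iff`). On η it is given by the block Λ⁻ → Λ⁻; the scalar part of
that block drops out because η is contracted with itself, and W⁻ remains (`isScalarBlock_iff`). If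
the relevant parts vanish, the derivation kills the variables that occur, hence every section.

Conversely, bump functions provide sections with an arbitrary value α^k β^n at a given point, and
curvOp(α^k β^n) = α^{k-1} β^{n-1} (k β curvOp α + n α curvOp β). Setting the bracket to zero where α
vanishes isolates the Ricci part, and the Weyl part follows (`blocks_of_curvOp_pow_mul_pow`).

The differential calculus takes place over the ring of smooth complex functions on a patch, where a
frame and its connection become an algebraic object (`FrameConnection`). Koszul's formula identifies
it with the Levi-Civita connection, and the Jacobi identity of vector fields yields the algebraic
Bianchi identity. -/

noncomputable section

namespace SpinorDiagram

open MvPolynomial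

/-! ### Derivations of polynomial rings -/

section Derivations

variable {R A : Type*} [CommRing R] [CommRing A] [Algebra R A]

theorem derivation_prod {ι : Type*} [DecidableEq ι] (D : Derivation R A A) (s : Finset ι)
    (f : ι → A) : D (∏ i ∈ s, f i) = ∑ i ∈ s, (∏ j ∈ s.erase i, f j) * D (f i) := by
  induction s using Finset.induction_on with
  | empty => simp
  | insert a s ha ih =>
    rw [Finset.prod_insert ha, D.leibniz, ih, Finset.sum_insert ha, Finset.erase_insert ha,
      smul_eq_mul, smul_eq_mul, Finset.mul_sum, add_comm]
    congr 1
    refine Finset.sum_congr rfl fun i hi => ?_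
    have hne : a ≠ i := fun h => ha (h ▸ hi)
    rw [Finset.erase_insert_of_ne hne, Finset.prod_insert (fun h => ha (Finset.mem_of_mem_erase h)),
      mul_assoc]

theorem derivation_sum_apply {ι : Type*} (s : Finset ι) (D : ι → Derivation R A A) (f : A) :
    (∑ i ∈ s, D i) f = ∑ i ∈ s, D i f := by
  classical
  induction s using Finset.induction_on with
  | empty => simp
  | insert a s ha ih => rw [Finset.sum_insert ha, Finset.sum_insert ha, Derivation.add_apply, ih]

variable {σ : Type*}

/-- A derivation of the coefficients, extended to polynomials. -/
def coeffDerivation (D : Derivation R A A) :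
    Derivation R (MvPolynomial σ A) (MvPolynomial σ A) :=
  Derivation.mk' (M := MvPolynomial σ A)
    { toFun := fun p => .ofCoeff (Finsupp.mapRange D D.map_zero (AddMonoidAlgebra.coeff p))
      map_add' := fun p q => by ext m; exact D.map_add (coeff m p) (coeff m q)
      map_smul' := fun r p => by ext m; exact D.map_smul r (coeff m p) } (by
    intro p q
    classical
    ext m
    change D (coeff m (p * q)) = coeff m (p * _ + q * _)
    rw [coeff_add, coeff_mul, coeff_mul, mul_comm q, coeff_mul, map_sum, ← Finset.sum_add_distrib]
    refine Finset.sum_congr rfl fun x _ => ?_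
    rw [D.leibniz, smul_eq_mul, smul_eq_mul, mul_comm (coeff x.2 q)]
    rfl)

@[simp] theorem coeffDerivation_coeff (D : Derivation R A A) (p : MvPolynomial σ A) (m : σ →₀ ℕ) :
    coeff m (coeffDerivation D p) = D (coeff m p) := rfl

@[simp] theorem coeffDerivation_C (D : Derivation R A A) (a : A) :
    coeffDerivation D (C a : MvPolynomial σ A) = C (D a) := by
  classical
  ext m
  rw [coeffDerivation_coeff, coeff_C, coeff_C]
  split_ifs <;> simp

@[simp] theorem coeffDerivation_X (D : Derivation R A A) (i : σ) :
    coeffDerivation D (X i : MvPolynomial σ A) = 0 := by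
  classical
  ext m
  rw [coeffDerivation_coeff, coeff_X]
  split_ifs <;> simp

/-- Covariant derivatives also differentiate the coefficients and are linear only over `R`, so the
constants have to be tested along with the variables. Identities between first-order operators are
reduced to generators in this way. -/
theorem derivation_mvPolynomial_ext {D D' : Derivation R (MvPolynomial σ A) (MvPolynomial σ A)}
    (hC : ∀ a, D (C a) = D' (C a)) (hX : ∀ i, D (X i) = D' (X i)) : D = D' := by
  ext p
  congr 1
  induction p using MvPolynomial.induction_on with
  | C a => exact hC a
  | add p q hp hq => rw [map_add, map_add, hp, hq]
  | mul_X p i hp => rw [D.leibniz, D'.leibniz, hp, hX]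

end Derivations

/-! ### Spinors as polynomials -/

section SpinorPolynomials

/-- Arrays with `k` unprimed and `n` primed spinor indices and entries in `K`. -/
abbrev SpinorArray (K : Type*) (k n : ℕ) : Type _ := (Fin k → Fin 2) → (Fin n → Fin 2) → K

/-- Polynomials in two unprimed and two primed variables. -/
abbrev SpinorPoly (K : Type*) [CommRing K] : Type _ := MvPolynomial (Fin 2 ⊕ Fin 2) K

variable {K : Type*} [CommRing K]

/-- The unprimed variables. -/
def xi (A : Fin 2) : SpinorPoly K := X (Sum.inl A)

/-- The primed variables. -/
def eta (A : Fin 2) : SpinorPoly K := X (Sum.inr A)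

@[simp] theorem pderiv_xi (A B : Fin 2) :
    pderiv (Sum.inl A) (xi B : SpinorPoly K) = if B = A then 1 else 0 := by
  simp [xi, pderiv_X, Pi.single_apply, eq_comm]

@[simp] theorem pderiv_eta (A B : Fin 2) :
    pderiv (Sum.inl A) (eta B : SpinorPoly K) = 0 := by
  simp [eta, pderiv_X]

/-- The polynomial obtained by contracting an array with `ξ` and `η` in every index. -/
def toPoly {k n : ℕ} (T : SpinorArray K k n) : SpinorPoly K :=
  ∑ A, ∑ A', C (T A A') * ((∏ s, xi (A s)) * ∏ t, eta (A' t))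

/-- Symmetry in the unprimed and, separately, in the primed indices. -/
def IsSymmArray {k n : ℕ} (T : SpinorArray K k n) : Prop :=
  ∀ (τ : Equiv.Perm (Fin k)) (ρ : Equiv.Perm (Fin n)) A A', T (A ∘ τ) (A' ∘ ρ) = T A A'

theorem toPoly_add {k n : ℕ} (T T' : SpinorArray K k n) :
    toPoly (T + T') = toPoly T + toPoly T' := by
  simp [toPoly, add_mul, Finset.sum_add_distrib]

theorem toPoly_sub {k n : ℕ} (T T' : SpinorArray K k n) :
    toPoly (T - T') = toPoly T - toPoly T' := by
  simp [toPoly, sub_mul, Finset.sum_sub_distrib]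

theorem toPoly_neg {k n : ℕ} (T : SpinorArray K k n) : toPoly (-T) = -toPoly T := by
  simp [toPoly]

theorem toPoly_zero {k n : ℕ} : toPoly (0 : SpinorArray K k n) = 0 := by
  simp [toPoly]

theorem toPoly_mul_left {k n : ℕ} (c : K) (T : SpinorArray K k n) :
    toPoly (fun A A' => c * T A A') = C c * toPoly T := by
  simp [toPoly, Finset.mul_sum, mul_assoc]

theorem toPoly_sum {ι : Type*} {k n : ℕ} (s : Finset ι) (T : ι → SpinorArray K k n) :
    toPoly (fun A A' => ∑ i ∈ s, T i A A') = ∑ i ∈ s, toPoly (T i) := by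
  simp only [toPoly, map_sum, Finset.sum_mul]
  rw [Finset.sum_comm]
  conv_rhs => rw [Finset.sum_comm]
  rw [Finset.sum_comm]
  refine Finset.sum_congr rfl fun A _ => ?_
  rw [Finset.sum_comm]

/-- A monomial does not remember the order of its factors. Consequently symmetrising an array leaves
its polynomial unchanged. -/
theorem toPoly_comp_perm {k n : ℕ} (T : SpinorArray K k n) (τ : Equiv.Perm (Fin k))
    (ρ : Equiv.Perm (Fin n)) : toPoly (fun A A' => T (A ∘ τ) (A' ∘ ρ)) = toPoly T := by
  unfold toPoly
  refine Fintype.sum_equiv (τ.symm.arrowCongr (Equiv.refl _)) _ _ fun A => ?_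
  refine Fintype.sum_equiv (ρ.symm.arrowCongr (Equiv.refl _)) _ _ fun A' => ?_
  have h1 : (∏ s, xi (K := K) (A (τ s))) = ∏ s, xi (A s) :=
    Equiv.prod_comp τ fun s => xi (A s)
  have h2 : (∏ s, eta (K := K) (A' (ρ s))) = ∏ s, eta (A' s) :=
    Equiv.prod_comp ρ fun s => eta (A' s)
  simp only [Equiv.arrowCongr, Equiv.coe_fn_mk, Equiv.symm_symm, Equiv.coe_refl, Function.comp_apply,
    Function.id_comp, h1, h2]

/-- Index arrays with the same monomial are rearrangements of each other, so a symmetric `T` is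
constant on them. The coefficient of a monomial is therefore an entry of `T` times the number of
rearrangements, and that number is invertible enough in a domain of characteristic zero to be
cancelled. -/
theorem IsSymmArray.eq_zero_of_toPoly_eq_zero {k n : ℕ} [CharZero K] [IsDomain K]
    {T : SpinorArray K k n} (hT : IsSymmArray T) (h : toPoly T = 0) : T = 0 := by
  classical
  funext A₀ A₀'
  let mon : (Fin k → Fin 2) → (Fin n → Fin 2) → (Fin 2 ⊕ Fin 2 →₀ ℕ) := fun A A' =>
    (∑ s, Finsupp.single (Sum.inl (A s)) 1) + ∑ t, Finsupp.single (Sum.inr (A' t)) 1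
  have hmon : ∀ A A', (C (T A A') * ((∏ s, xi (A s)) * ∏ t, eta (A' t)) : SpinorPoly K)
      = monomial (mon A A') (T A A') := by
    intro A A'
    have h1 : (∏ s, xi (K := K) (A s)) = monomial (∑ s, Finsupp.single (Sum.inl (A s)) 1) 1 := by
      rw [monomial_sum_one]; rfl
    have h2 : (∏ s, eta (K := K) (A' s)) = monomial (∑ s, Finsupp.single (Sum.inr (A' s)) 1) 1 := by
      rw [monomial_sum_one]; rfl
    rw [h1, h2, monomial_mul, C_mul_monomial, mul_one, mul_one]
  -- The permutation is glued from bijections between the fibres of `b` and those of `a`.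
  have hperm : ∀ {m : ℕ} (a b : Fin m → Fin 2), (∀ c, (Finset.univ.filter fun s => a s = c).card
      = (Finset.univ.filter fun s => b s = c).card) → ∃ τ : Equiv.Perm (Fin m), a ∘ τ = b := by
    intro m a b hc
    have e : ∀ c, {s // b s = c} ≃ {s // a s = c} := fun c => by
      refine Fintype.equivOfCardEq ?_
      rw [Fintype.card_subtype, Fintype.card_subtype, hc c]
    refine ⟨((Equiv.sigmaFiberEquiv b).symm.trans (Equiv.sigmaCongrRight e)).trans
      (Equiv.sigmaFiberEquiv a), ?_⟩
    funext s
    exact (e (b s) ⟨s, rfl⟩).2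
  have hval : ∀ A A', mon A A' = mon A₀ A₀' → T A A' = T A₀ A₀' := by
    intro A A' hm
    have hcl : ∀ (A : Fin k → Fin 2) (A' : Fin n → Fin 2) c,
        mon A A' (Sum.inl c) = (Finset.univ.filter fun s => A s = c).card := by
      intro A A' c
      rw [Finset.card_filter]; simp [mon, Finsupp.single_apply, -Finset.sum_boole]
    have hcr : ∀ (A : Fin k → Fin 2) (A' : Fin n → Fin 2) c,
        mon A A' (Sum.inr c) = (Finset.univ.filter fun s => A' s = c).card := by
      intro A A' c
      rw [Finset.card_filter]; simp [mon, Finsupp.single_apply, -Finset.sum_boole]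
    obtain ⟨τ, hτ⟩ := hperm A A₀ fun c => by rw [← hcl A A', ← hcl A₀ A₀', hm]
    obtain ⟨ρ, hρ⟩ := hperm A' A₀' fun c => by rw [← hcr A A', ← hcr A₀ A₀', hm]
    rw [← hT τ ρ A A', hτ, hρ]
  have hcoeff := congrArg (coeff (mon A₀ A₀')) h
  simp only [toPoly, hmon, coeff_sum, coeff_monomial, coeff_zero] at hcoeff
  have hsum : (∑ A, ∑ A', if mon A A' = mon A₀ A₀' then T A A' else 0)
      = ∑ A, ∑ A', if mon A A' = mon A₀ A₀' then T A₀ A₀' else 0 := by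
    refine Finset.sum_congr rfl fun A _ => Finset.sum_congr rfl fun A' _ => ?_
    split_ifs with hm
    · exact hval A A' hm
    · rfl
  rw [hsum, ← Fintype.sum_prod_type', ← Finset.sum_filter, Finset.sum_const, nsmul_eq_mul,
    mul_eq_zero] at hcoeff
  refine hcoeff.resolve_left ?_
  rw [Nat.cast_eq_zero, Finset.card_eq_zero, ← ne_eq, ← Finset.nonempty_iff_ne_empty]
  exact ⟨(A₀, A₀'), by simp⟩

/-- Contraction with `ξ` and `η` turns the product with one further index of each kind into
multiplication. -/
theorem toPoly_cons {k n : ℕ} (c : Fin 2 → Fin 2 → K) (T : SpinorArray K k n) :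
    toPoly (k := k + 1) (n := n + 1) (fun A A' => c (A 0) (A' 0) * T (Fin.tail A) (Fin.tail A'))
      = (∑ A, ∑ A', C (c A A') * (xi A * eta A')) * toPoly T := by
  unfold toPoly
  rw [← (Fin.consEquiv fun _ => Fin 2).sum_comp, Fintype.sum_prod_type, Finset.sum_mul]
  refine Finset.sum_congr rfl fun B _ => ?_
  rw [Finset.sum_mul, Finset.sum_comm, ← (Fin.consEquiv fun _ => Fin 2).sum_comp,
    Fintype.sum_prod_type]
  refine Finset.sum_congr rfl fun B' _ => ?_
  rw [Finset.mul_sum, Finset.sum_comm]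
  refine Finset.sum_congr rfl fun A _ => ?_
  rw [Finset.mul_sum]
  refine Finset.sum_congr rfl fun A' _ => ?_
  simp only [Fin.consEquiv_apply, Fin.cons_zero, Fin.prod_univ_succ, Fin.cons_succ,
    map_mul]
  rw [show Fin.tail ((Fin.consEquiv fun _ => Fin 2) (B, A)) = A from Fin.tail_cons _ _,
    show Fin.tail ((Fin.consEquiv fun _ => Fin 2) (B', A')) = A' from Fin.tail_cons _ _]
  ring

/-- The primed analogue of `toPoly_cons`. -/
theorem toPoly_cons_right {k n : ℕ} (c : Fin 2 → K) (T : SpinorArray K k n) :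
    toPoly (n := n + 1) (fun A A' => c (A' 0) * T A (Fin.tail A'))
      = (∑ A', C (c A') * eta A') * toPoly T := by
  unfold toPoly
  rw [Finset.mul_sum]
  refine Finset.sum_congr rfl fun A _ => ?_
  rw [← (Fin.consEquiv fun _ => Fin 2).sum_comp, Fintype.sum_prod_type, Finset.sum_mul]
  refine Finset.sum_congr rfl fun B' _ => ?_
  rw [Finset.mul_sum]
  refine Finset.sum_congr rfl fun A' _ => ?_
  simp only [Fin.consEquiv_apply, Fin.cons_zero, Fin.prod_univ_succ, Fin.cons_succ,
    map_mul]
  rw [show Fin.tail ((Fin.consEquiv fun _ => Fin 2) (B', A')) = A' from Fin.tail_cons _ _]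
  ring

/-- Differentiation fixes one slot at the value `B` and drops its variable. Each of the `k + 1`
slots contributes equally, by symmetry, which accounts for the factor. -/
theorem toPoly_pderiv {k n : ℕ} {T : SpinorArray K (k + 1) n} (hT : IsSymmArray T) (B : Fin 2) :
    pderiv (Sum.inl B) (toPoly T) = ((k + 1 : ℕ) : SpinorPoly K) *
      toPoly (fun A A' => T (Fin.cons B A) A') := by
  classical
  have hη : ∀ A' : Fin n → Fin 2, pderiv (Sum.inl B) (∏ t, eta (K := K) (A' t)) = 0 := by
    intro A'
    rw [derivation_prod]
    refine Finset.sum_eq_zero fun t _ => ?_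
    simp [eta, pderiv_X]
  have hterm : pderiv (Sum.inl B) (toPoly T) = ∑ s : Fin (k + 1), ∑ A : Fin (k + 1) → Fin 2,
      ∑ A', C (T A A') * ((∏ r, xi (A (s.succAbove r))) * (if A s = B then 1 else 0)
        * ∏ t, eta (A' t)) := by
    simp only [toPoly, map_sum]
    conv_rhs => rw [Finset.sum_comm]
    refine Finset.sum_congr rfl fun A _ => ?_
    conv_rhs => rw [Finset.sum_comm]
    refine Finset.sum_congr rfl fun A' _ => ?_
    rw [pderiv_C_mul, Derivation.leibniz, hη, derivation_prod, smul_zero, zero_add, smul_eq_mul,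
      mul_comm (∏ t, eta (A' t)), ← Finset.mul_sum, ← Finset.sum_mul]
    refine congrArg (fun z => C (T A A') * (z * _)) (Finset.sum_congr rfl fun s _ => ?_)
    refine congrArg₂ (· * ·) ?_ ?_
    · have h := Fin.univ_succAbove k s
      rw [h, Finset.cons_eq_insert, Finset.erase_insert (by simp), Finset.prod_map]
      rfl
    · simp [xi, pderiv_X, Pi.single_apply, eq_comm]
  rw [hterm]
  have hs : ∀ s : Fin (k + 1), (∑ A : Fin (k + 1) → Fin 2,
      ∑ A', C (T A A') * ((∏ r, xi (A (s.succAbove r))) * (if A s = B then 1 else 0)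
        * ∏ t, eta (A' t))) = toPoly (fun A A' => T (Fin.cons B A) A') := by
    intro s
    rw [← (Fin.insertNthEquiv (fun _ => Fin 2) s).sum_comp, Fintype.sum_prod_type]
    simp only [Fin.insertNthEquiv_apply, Fin.insertNth_apply_succAbove, Fin.insertNth_apply_same,
      mul_ite, mul_one, mul_zero, ite_mul, zero_mul, toPoly]
    rw [Finset.sum_eq_single B]
    · simp only [if_true]
      refine Finset.sum_congr rfl fun A _ => Finset.sum_congr rfl fun A' _ => ?_
      -- This cyclic permutation brings slot `s` to the front and keeps the order of the others.
      have := hT (s.cycleRange).symm 1 (Fin.insertNth s B A) A'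
      have h2 : (Fin.insertNth s B A : Fin (k + 1) → Fin 2) ∘ (s.cycleRange).symm = Fin.cons B A := by
        funext j
        refine Fin.cases ?_ (fun j => ?_) j
        · simp
        · simp
      rw [h2] at this
      rw [show T ((Fin.insertNthEquiv (fun _ => Fin 2) s) (B, A)) A' = _ from this.symm]
      rfl
    · intro b _ hb
      simp [hb]
    · simp
  rw [Finset.sum_congr rfl fun s _ => hs s]
  simp

theorem pderiv_toPoly_of_no_unprimed {n : ℕ} (T : SpinorArray K 0 n) (B : Fin 2) :
    pderiv (Sum.inl B) (toPoly T) = 0 := by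
  classical
  simp only [toPoly, map_sum]
  refine Finset.sum_eq_zero fun A _ => Finset.sum_eq_zero fun A' _ => ?_
  rw [pderiv_C_mul, Fintype.prod_empty, one_mul, derivation_prod, Finset.sum_eq_zero, mul_zero]
  intro t _
  simp [eta, pderiv_X]

end SpinorPolynomials

end SpinorDiagram

end

noncomputable section

namespace SpinorDiagram

open MvPolynomial

/-! ### Lifts of skew matrices with entries in a `ℂ`-algebra -/

section Lifts

variable {K : Type*} [CommRing K] [Algebra ℂ K]

/-- `liftPlus` for matrices with entries in a `ℂ`-algebra. -/
def algLiftPlus (om : Fin 4 → Fin 4 → K) (A B : Fin 2) : K :=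
  ∑ b, ∑ c, algebraMap ℂ K (1 / 4 * (sigma b * (sigma c).conjTranspose) A B) * om b c

/-- `liftMinus` for matrices with entries in a `ℂ`-algebra. -/
def algLiftMinus (om : Fin 4 → Fin 4 → K) (A B : Fin 2) : K :=
  ∑ b, ∑ c, algebraMap ℂ K (-1 / 4 * ((sigma b).conjTranspose * sigma c) B A) * om b c

theorem algLiftPlus_ofReal (om : Fin 4 → Fin 4 → ℝ) (A B : Fin 2) :
    algLiftPlus (fun b c => (om b c : ℂ)) A B = liftPlus om A B := by
  simp only [algLiftPlus, liftPlus, Matrix.smul_apply, Matrix.sum_apply, smul_eq_mul,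
    Finset.mul_sum, Algebra.algebraMap_self, RingHom.id_apply]
  refine Finset.sum_congr rfl fun b _ => Finset.sum_congr rfl fun c _ => ?_
  ring

theorem algLiftMinus_ofReal (om : Fin 4 → Fin 4 → ℝ) (A B : Fin 2) :
    algLiftMinus (fun b c => (om b c : ℂ)) A B = liftMinus om A B := by
  simp only [algLiftMinus, liftMinus, Matrix.smul_apply, Matrix.sum_apply, smul_eq_mul,
    Finset.mul_sum, Algebra.algebraMap_self, RingHom.id_apply, Matrix.transpose_apply]
  refine Finset.sum_congr rfl fun b _ => Finset.sum_congr rfl fun c _ => ?_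
  ring

theorem map_algLiftPlus {L : Type*} [CommRing L] [Algebra ℂ L] (φ : K →ₐ[ℂ] L)
    (om : Fin 4 → Fin 4 → K) (A B : Fin 2) :
    φ (algLiftPlus om A B) = algLiftPlus (fun b c => φ (om b c)) A B := by
  simp [algLiftPlus]

theorem map_algLiftMinus {L : Type*} [CommRing L] [Algebra ℂ L] (φ : K →ₐ[ℂ] L)
    (om : Fin 4 → Fin 4 → K) (A B : Fin 2) :
    φ (algLiftMinus om A B) = algLiftMinus (fun b c => φ (om b c)) A B := by
  simp [algLiftMinus]

theorem derivation_algLiftPlus (D : Derivation ℂ K K) (om : Fin 4 → Fin 4 → K) (A B : Fin 2) :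
    D (algLiftPlus om A B) = algLiftPlus (fun b c => D (om b c)) A B := by
  simp [algLiftPlus, Derivation.leibniz]

theorem derivation_algLiftMinus (D : Derivation ℂ K K) (om : Fin 4 → Fin 4 → K) (A B : Fin 2) :
    D (algLiftMinus om A B) = algLiftMinus (fun b c => D (om b c)) A B := by
  simp [algLiftMinus, Derivation.leibniz]

theorem algLiftPlus_sum {ι : Type*} (s : Finset ι) (r : ι → K) (om : ι → Fin 4 → Fin 4 → K)
    (A B : Fin 2) : algLiftPlus (fun b c => ∑ f ∈ s, r f * om f b c) A B
      = ∑ f ∈ s, r f * algLiftPlus (om f) A B := by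
  simp only [algLiftPlus, Finset.mul_sum]
  rw [Finset.sum_comm]
  conv_rhs => rw [Finset.sum_comm]
  rw [Finset.sum_comm]
  refine Finset.sum_congr rfl fun b _ => ?_
  rw [Finset.sum_comm]
  refine Finset.sum_congr rfl fun f _ => Finset.sum_congr rfl fun c _ => ?_
  ring

theorem algLiftMinus_sum {ι : Type*} (s : Finset ι) (r : ι → K) (om : ι → Fin 4 → Fin 4 → K)
    (A B : Fin 2) : algLiftMinus (fun b c => ∑ f ∈ s, r f * om f b c) A B
      = ∑ f ∈ s, r f * algLiftMinus (om f) A B := by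
  simp only [algLiftMinus, Finset.mul_sum]
  rw [Finset.sum_comm]
  conv_rhs => rw [Finset.sum_comm]
  rw [Finset.sum_comm]
  refine Finset.sum_congr rfl fun b _ => ?_
  rw [Finset.sum_comm]
  refine Finset.sum_congr rfl fun f _ => Finset.sum_congr rfl fun c _ => ?_
  ring

theorem algebraMap_I_mul_self : algebraMap ℂ K Complex.I * algebraMap ℂ K Complex.I = -1 := by
  rw [← map_mul, Complex.I_mul_I, map_neg, map_one]

theorem two_mul_algebraMap_half : 2 * algebraMap ℂ K (1 / 2) = 1 := by
  rw [← map_ofNat (algebraMap ℂ K) 2, ← map_mul]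
  norm_num

theorem diag_eq_zero_of_skew {om : Fin 4 → Fin 4 → K} (h : ∀ b c, om b c = -om c b) (b : Fin 4) :
    om b b = 0 := by
  linear_combination algebraMap ℂ K (1 / 2) * h b b
    - om b b * two_mul_algebraMap_half (K := K)

/-- The matrix of `algLiftPlus` in terms of the self-dual part. -/
theorem algLiftPlus_eq {om : Fin 4 → Fin 4 → K} (h : ∀ b c, om b c = -om c b) (A B : Fin 2) :
    algLiftPlus om A B = algebraMap ℂ K (1 / 2) *
      (!![algebraMap ℂ K Complex.I * (om 0 3 + om 1 2),
          algebraMap ℂ K Complex.I * (om 0 1 + om 2 3) + (om 0 2 - om 1 3);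
          algebraMap ℂ K Complex.I * (om 0 1 + om 2 3) - (om 0 2 - om 1 3),
          -(algebraMap ℂ K Complex.I * (om 0 3 + om 1 2))] : Matrix (Fin 2) (Fin 2) K) A B := by
  have hJ := algebraMap_I_mul_self (K := K)
  have h2 : algebraMap ℂ K (1 / 2) = 2 * algebraMap ℂ K 4⁻¹ := by
    rw [← map_ofNat (algebraMap ℂ K) 2, ← map_mul]; norm_num
  rw [h2]
  fin_cases A <;> fin_cases B <;>
    simp [algLiftPlus, Fin.sum_univ_four, sigma, Matrix.mul_apply, Fin.sum_univ_two,
      h 1 0, h 2 0, h 3 0, h 2 1, h 3 1, h 3 2, diag_eq_zero_of_skew h, hJ] <;> ring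

/-- The matrix of `algLiftMinus` in terms of the anti-self-dual part. -/
theorem algLiftMinus_eq {om : Fin 4 → Fin 4 → K} (h : ∀ b c, om b c = -om c b) (A B : Fin 2) :
    algLiftMinus om A B = algebraMap ℂ K (1 / 2) *
      (!![algebraMap ℂ K Complex.I * (om 0 3 - om 1 2),
          algebraMap ℂ K Complex.I * (om 0 1 - om 2 3) - (om 0 2 + om 1 3);
          algebraMap ℂ K Complex.I * (om 0 1 - om 2 3) + (om 0 2 + om 1 3),
          -(algebraMap ℂ K Complex.I * (om 0 3 - om 1 2))] : Matrix (Fin 2) (Fin 2) K) A B := by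
  have hJ := algebraMap_I_mul_self (K := K)
  have h2 : algebraMap ℂ K (1 / 2) = 2 * algebraMap ℂ K 4⁻¹ := by
    rw [← map_ofNat (algebraMap ℂ K) 2, ← map_mul]; norm_num
  have h4 : algebraMap ℂ K (-1 / 4) = -algebraMap ℂ K 4⁻¹ := by
    rw [← map_neg]; norm_num
  rw [h2]
  fin_cases A <;> fin_cases B <;>
    simp [algLiftMinus, Fin.sum_univ_four, sigma, Matrix.mul_apply, Fin.sum_univ_two, h4,
      h 1 0, h 2 0, h 3 0, h 2 1, h 3 1, h 3 2, diag_eq_zero_of_skew h, hJ] <;> ring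

/-- The lifts of a skew matrix act on the soldering forms as the matrix itself. -/
theorem algLift_sigma {om : Fin 4 → Fin 4 → K} (h : ∀ b c, om b c = -om c b) (b : Fin 4)
    (A A' : Fin 2) :
    ∑ B, algLiftPlus om A B * algebraMap ℂ K (sigma b B A')
      + ∑ B', algLiftMinus om A' B' * algebraMap ℂ K (sigma b A B')
      = ∑ c, om c b * algebraMap ℂ K (sigma c A A') := by
  have hJ := algebraMap_I_mul_self (K := K)
  have h2 := two_mul_algebraMap_half (K := K)
  have hd := diag_eq_zero_of_skew h
  simp only [algLiftPlus_eq h, algLiftMinus_eq h, Fin.sum_univ_two, Fin.sum_univ_four]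
  generalize algebraMap ℂ K (1 / 2) = r at *
  fin_cases b <;> fin_cases A <;> fin_cases A' <;>
    simp [sigma, h 1 0, h 2 0, h 3 0, h 2 1, h 3 1, h 3 2, hd] <;>
    generalize algebraMap ℂ K Complex.I = J at * <;> grind only

/-- Tracelessness is the infinitesimal invariance of `eps`; the parallelism of the contraction in
`covPoly_contractPoly` rests on it. -/
theorem algLiftPlus_trace {om : Fin 4 → Fin 4 → K} (h : ∀ b c, om b c = -om c b) :
    algLiftPlus om 0 0 + algLiftPlus om 1 1 = 0 := by
  simp only [algLiftPlus_eq h]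
  simp

/-- The projection of 𝔰𝔬(4) to one of its two factors is a homomorphism of Lie algebras. In the
explicit matrices only I² = -1 and 2 · (1/2) = 1 are needed. -/
theorem algLiftPlus_commutator {u v : Fin 4 → Fin 4 → K} (hu : ∀ b c, u b c = -u c b)
    (hv : ∀ b c, v b c = -v c b) (A B : Fin 2) :
    ∑ E, (algLiftPlus u A E * algLiftPlus v E B - algLiftPlus v A E * algLiftPlus u E B)
      = algLiftPlus (fun b c => ∑ f, (u b f * v f c - v b f * u f c)) A B := by
  have hJ := algebraMap_I_mul_self (K := K)
  have h2 := two_mul_algebraMap_half (K := K)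
  have huv : ∀ b c, (∑ f, (u b f * v f c - v b f * u f c))
      = -∑ f, (u c f * v f b - v c f * u f b) := fun b c => by
    rw [← Finset.sum_neg_distrib]
    refine Finset.sum_congr rfl fun f _ => ?_
    rw [hu b f, hv f c, hv b f, hu f c]; ring
  rw [algLiftPlus_eq (om := fun b c => ∑ f, (u b f * v f c - v b f * u f c)) huv]
  simp only [algLiftPlus_eq hu, algLiftPlus_eq hv,
    Fin.sum_univ_two, Fin.sum_univ_four]
  generalize algebraMap ℂ K (1 / 2) = r at *
  fin_cases A <;> fin_cases B <;>
    simp [hu 1 0, hu 2 0, hu 2 1, hu 3 1, hu 3 2, hv 1 0, hv 2 0, hv 2 1, hv 3 1,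
      hv 3 2, diag_eq_zero_of_skew hu, diag_eq_zero_of_skew hv] <;>
    generalize algebraMap ℂ K Complex.I = J at * <;> grind only

theorem algLiftMinus_commutator {u v : Fin 4 → Fin 4 → K} (hu : ∀ b c, u b c = -u c b)
    (hv : ∀ b c, v b c = -v c b) (A B : Fin 2) :
    ∑ E, (algLiftMinus u A E * algLiftMinus v E B - algLiftMinus v A E * algLiftMinus u E B)
      = algLiftMinus (fun b c => ∑ f, (u b f * v f c - v b f * u f c)) A B := by
  have hJ := algebraMap_I_mul_self (K := K)
  have h2 := two_mul_algebraMap_half (K := K)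
  have huv : ∀ b c, (∑ f, (u b f * v f c - v b f * u f c))
      = -∑ f, (u c f * v f b - v c f * u f b) := fun b c => by
    rw [← Finset.sum_neg_distrib]
    refine Finset.sum_congr rfl fun f _ => ?_
    rw [hu b f, hv f c, hv b f, hu f c]; ring
  rw [algLiftMinus_eq (om := fun b c => ∑ f, (u b f * v f c - v b f * u f c)) huv]
  simp only [algLiftMinus_eq hu, algLiftMinus_eq hv,
    Fin.sum_univ_two, Fin.sum_univ_four]
  generalize algebraMap ℂ K (1 / 2) = r at *
  fin_cases A <;> fin_cases B <;>
    simp [hu 1 0, hu 2 0, hu 2 1, hu 3 1, hu 3 2, hv 1 0, hv 2 0, hv 2 1, hv 3 1,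
      hv 3 2, diag_eq_zero_of_skew hu, diag_eq_zero_of_skew hv] <;>
    generalize algebraMap ℂ K Complex.I = J at * <;> grind only

end Lifts

end SpinorDiagram

end

noncomputable section

namespace SpinorDiagram

open MvPolynomial

/-! ### The two first-order operators on polynomials -/

section FrameOperators

variable {K : Type*} [CommRing K] [Algebra ℂ K]

/-- The polynomial `σ_a^{AA'} ξ_A η_A'`. -/
def solderPoly (a : Fin 4) : SpinorPoly K :=
  ∑ A, ∑ A', C (algebraMap ℂ K (sigma a A A')) * (xi A * eta A')

/-- The components `σ_a^{AA'} η_A'`. -/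
def solderEta (a : Fin 4) (A : Fin 2) : SpinorPoly K :=
  ∑ A', C (algebraMap ℂ K (sigma a A A')) * eta A'

/-- The derivation `ε_{BC} σ_a^{CA'} η_A' ∂/∂ξ_B`. -/
def contractPoly (a : Fin 4) : Derivation ℂ (SpinorPoly K) (SpinorPoly K) :=
  (∑ B, (∑ E, C (algebraMap ℂ K (eps B E)) * solderEta a E) •
    pderiv (Sum.inl B)).restrictScalars ℂ

/-- The anti-self-dual bivector determined by `η`. -/
def asdPoly (a b : Fin 4) : SpinorPoly K :=
  solderEta a 0 * solderEta b 1 - solderEta a 1 * solderEta b 0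

/-- The Euler derivation of the unprimed variables. -/
def eulerXi : Derivation ℂ (SpinorPoly K) (SpinorPoly K) :=
  (∑ B, (xi B : SpinorPoly K) • pderiv (Sum.inl B)).restrictScalars ℂ

theorem contractPoly_apply (a : Fin 4) (p : SpinorPoly K) :
    contractPoly a p = solderEta a 1 * pderiv (Sum.inl 0) p
      - solderEta a 0 * pderiv (Sum.inl 1) p := by
  simp [contractPoly, Fin.sum_univ_two, eps, sub_eq_add_neg]

theorem eulerXi_apply (p : SpinorPoly K) :
    eulerXi p = xi 0 * pderiv (Sum.inl 0) p + xi 1 * pderiv (Sum.inl 1) p := by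
  simp [eulerXi, Fin.sum_univ_two]

theorem solderPoly_eq (a : Fin 4) :
    (solderPoly a : SpinorPoly K) = xi 0 * solderEta a 0 + xi 1 * solderEta a 1 := by
  simp only [solderPoly, solderEta, Fin.sum_univ_two]
  ring

@[simp] theorem pderiv_solderEta (A : Fin 2) (a : Fin 4) (B : Fin 2) :
    pderiv (Sum.inl A) (solderEta a B : SpinorPoly K) = 0 := by
  simp [solderEta]

theorem contractPoly_solderPoly (a b : Fin 4) :
    contractPoly b (solderPoly a : SpinorPoly K) = asdPoly a b := by
  rw [contractPoly_apply, solderPoly_eq, asdPoly]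
  simp [Derivation.leibniz]
  ring

theorem asdPoly_skew (a b : Fin 4) : (asdPoly a b : SpinorPoly K) = -asdPoly b a := by
  simp only [asdPoly]
  ring

/-- Unprimed spinor space has dimension two, so a combination skew in the two vectors σ_a η and σ_b
η is a multiple of their determinant `asdPoly a b`. The remaining factor pairs ξ with ∂/∂ξ. -/
theorem solderPoly_mul_contractPoly_sub (a b : Fin 4) (p : SpinorPoly K) :
    solderPoly a * contractPoly b p - solderPoly b * contractPoly a p
      = asdPoly a b * eulerXi p := by
  rw [contractPoly_apply, contractPoly_apply, solderPoly_eq, solderPoly_eq, eulerXi_apply, asdPoly]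
  ring

end FrameOperators

variable (K : Type*) [CommRing K] [Algebra ℂ K] in
/-- A metric torsion-free connection in an orthonormal frame, given by the frame derivations of
the functions and the connection coefficients `∇_{e_a} e_c = ∑_b Γ a b c e_b`. -/
structure FrameConnection where
  /-- The frame, acting on functions. -/
  deriv : Fin 4 → Derivation ℂ K K
  /-- The connection coefficients. -/
  coef : Fin 4 → Fin 4 → Fin 4 → K
  coef_skew : ∀ a b c, coef a b c = -coef a c b
  torsion_free : ∀ a b f, deriv a (deriv b f) - deriv b (deriv a f)
    = ∑ c, (coef a c b - coef b c a) * deriv c f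

namespace FrameConnection

variable {K : Type*} [CommRing K] [Algebra ℂ K] (G : FrameConnection K)

/-- The curvature `⟨R(e_a, e_b) e_c, e_d⟩`, as the skew matrix with indices `d` and `c`. -/
def curv (a b d c : Fin 4) : K :=
  G.deriv a (G.coef b d c) - G.deriv b (G.coef a d c)
    + ∑ f, (G.coef a d f * G.coef b f c - G.coef b d f * G.coef a f c)
    - ∑ f, (G.coef a f b - G.coef b f a) * G.coef f d c

theorem curv_skew (a b d c : Fin 4) : G.curv a b d c = -G.curv a b c d := by
  simp only [curv]
  rw [G.coef_skew b d c, G.coef_skew a d c, map_neg, map_neg]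
  have h1 : (∑ f, (G.coef a d f * G.coef b f c - G.coef b d f * G.coef a f c))
      = -∑ f, (G.coef a c f * G.coef b f d - G.coef b c f * G.coef a f d) := by
    rw [← Finset.sum_neg_distrib]
    refine Finset.sum_congr rfl fun f _ => ?_
    rw [G.coef_skew a d f, G.coef_skew b d f, G.coef_skew b f c, G.coef_skew a f c]
    ring
  have h2 : (∑ f, (G.coef a f b - G.coef b f a) * G.coef f d c)
      = -∑ f, (G.coef a f b - G.coef b f a) * G.coef f c d := by
    rw [← Finset.sum_neg_distrib]
    refine Finset.sum_congr rfl fun f _ => ?_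
    rw [G.coef_skew f d c]
    ring
  rw [h1, h2]
  ring

theorem curv_swap (a b d c : Fin 4) : G.curv a b d c = -G.curv b a d c := by
  simp only [curv, Finset.sum_sub_distrib, sub_mul]
  ring

/-- The covariant derivative along `e_a` on polynomials. -/
def covPoly (a : Fin 4) : Derivation ℂ (SpinorPoly K) (SpinorPoly K) :=
  coeffDerivation (G.deriv a) + (mkDerivation K (Sum.elim
    (fun B => ∑ A, C (algLiftPlus (G.coef a) A B) * xi A)
    (fun B => ∑ A, C (algLiftMinus (G.coef a) A B) * eta A))).restrictScalars ℂ

@[simp] theorem covPoly_C (a : Fin 4) (f : K) : G.covPoly a (C f) = C (G.deriv a f) := by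
  simp [covPoly]

@[simp] theorem covPoly_xi (a : Fin 4) (B : Fin 2) :
    G.covPoly a (xi B) = ∑ A, C (algLiftPlus (G.coef a) A B) * xi A := by
  simp [covPoly, xi, mkDerivation_X]

@[simp] theorem covPoly_eta (a : Fin 4) (B : Fin 2) :
    G.covPoly a (eta B) = ∑ A, C (algLiftMinus (G.coef a) A B) * eta A := by
  simp [covPoly, eta, mkDerivation_X]

/-- The curvature derivation. -/
def curvPoly (a b : Fin 4) : Derivation K (SpinorPoly K) (SpinorPoly K) :=
  mkDerivation K (Sum.elim
    (fun B => ∑ A, C (algLiftPlus (G.curv a b) A B) * xi A)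
    (fun B => ∑ A, C (algLiftMinus (G.curv a b) A B) * eta A))

@[simp] theorem curvPoly_xi (a b : Fin 4) (B : Fin 2) :
    G.curvPoly a b (xi B) = ∑ A, C (algLiftPlus (G.curv a b) A B) * xi A := by
  simp [curvPoly, xi, mkDerivation_X]

@[simp] theorem curvPoly_eta (a b : Fin 4) (B : Fin 2) :
    G.curvPoly a b (eta B) = ∑ A, C (algLiftMinus (G.curv a b) A B) * eta A := by
  simp [curvPoly, eta, mkDerivation_X]

/-- The lift is linear, commutes with derivations over ℂ and respects commutators, so it carries the
structure equation of the frame to that of the spin connection. -/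
theorem algLiftPlus_curv (a b : Fin 4) (A B : Fin 2) :
    algLiftPlus (G.curv a b) A B
      = G.deriv a (algLiftPlus (G.coef b) A B) - G.deriv b (algLiftPlus (G.coef a) A B)
        + ∑ E, (algLiftPlus (G.coef a) A E * algLiftPlus (G.coef b) E B
            - algLiftPlus (G.coef b) A E * algLiftPlus (G.coef a) E B)
        - ∑ f, (G.coef a f b - G.coef b f a) * algLiftPlus (G.coef f) A B := by
  rw [algLiftPlus_commutator (G.coef_skew a) (G.coef_skew b), derivation_algLiftPlus,
    derivation_algLiftPlus, ← algLiftPlus_sum]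
  simp only [algLiftPlus, curv, mul_sub, mul_add, Finset.sum_sub_distrib, Finset.sum_add_distrib]

theorem algLiftMinus_curv (a b : Fin 4) (A B : Fin 2) :
    algLiftMinus (G.curv a b) A B
      = G.deriv a (algLiftMinus (G.coef b) A B) - G.deriv b (algLiftMinus (G.coef a) A B)
        + ∑ E, (algLiftMinus (G.coef a) A E * algLiftMinus (G.coef b) E B
            - algLiftMinus (G.coef b) A E * algLiftMinus (G.coef a) E B)
        - ∑ f, (G.coef a f b - G.coef b f a) * algLiftMinus (G.coef f) A B := by
  rw [algLiftMinus_commutator (G.coef_skew a) (G.coef_skew b), derivation_algLiftMinus,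
    derivation_algLiftMinus, ← algLiftMinus_sum]
  simp only [algLiftMinus, curv, mul_sub, mul_add, Finset.sum_sub_distrib, Finset.sum_add_distrib]

theorem curvPoly_swap (a b : Fin 4) (p : SpinorPoly K) :
    G.curvPoly a b p = -G.curvPoly b a p := by
  have h : G.curvPoly a b = -G.curvPoly b a := by
    refine derivation_ext fun i => ?_
    have hP : ∀ A B, algLiftPlus (G.curv a b) A B = -algLiftPlus (G.curv b a) A B := fun A B => by
      simp [algLiftPlus, G.curv_swap a b]
    have hM : ∀ A B, algLiftMinus (G.curv a b) A B = -algLiftMinus (G.curv b a) A B :=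
      fun A B => by simp [algLiftMinus, G.curv_swap a b]
    rcases i with B | B <;> simp [curvPoly, mkDerivation_X, hP, hM]
  rw [h, Derivation.neg_apply]

/-- The Ricci identity. -/
theorem covPoly_commutator (a b : Fin 4) (p : SpinorPoly K) :
    G.covPoly a (G.covPoly b p) - G.covPoly b (G.covPoly a p)
      = G.curvPoly a b p + ∑ c, C (G.coef a c b - G.coef b c a) * G.covPoly c p := by
  have h : ⁅G.covPoly a, G.covPoly b⁆ = (G.curvPoly a b).restrictScalars ℂ
      + ∑ c, (C (G.coef a c b - G.coef b c a) : SpinorPoly K) • G.covPoly c := by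
    -- Both sides are derivations. On constants the identity is torsion-freeness; on variables it is
    -- the structure equation of the spin connection.
    refine derivation_mvPolynomial_ext (fun f => ?_) (fun i => ?_)
    · rw [Derivation.commutator_apply]
      simp only [covPoly_C, ← C_sub, G.torsion_free, Derivation.add_apply,
        Derivation.restrictScalars_apply, derivation_C, zero_add, derivation_sum_apply,
        Derivation.smul_apply, smul_eq_mul, map_sum, map_mul]
    · rw [Derivation.commutator_apply]
      rcases i with B | B
      · rw [show (X (Sum.inl B) : SpinorPoly K) = xi B from rfl]
        simp only [covPoly_xi, Derivation.add_apply, Derivation.restrictScalars_apply,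
          Derivation.smul_apply, smul_eq_mul, curvPoly_xi, map_add,
          Derivation.leibniz, covPoly_C, algLiftPlus_curv, Fin.sum_univ_two, Fin.sum_univ_four,
          C_add, C_sub, C_mul]
        ring
      · rw [show (X (Sum.inr B) : SpinorPoly K) = eta B from rfl]
        simp only [covPoly_eta, Derivation.add_apply, Derivation.restrictScalars_apply,
          Derivation.smul_apply, smul_eq_mul, curvPoly_eta, map_add,
          Derivation.leibniz, covPoly_C, algLiftMinus_curv, Fin.sum_univ_two, Fin.sum_univ_four,
          C_add, C_sub, C_mul]
        ring
  have := congrArg (fun D => D p) h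
  simpa [Derivation.commutator_apply, derivation_sum_apply] using this

theorem covPoly_algebraMap (a : Fin 4) (z : ℂ) :
    G.covPoly a (C (algebraMap ℂ K z)) = 0 := by
  rw [covPoly_C, Derivation.map_algebraMap, C_0]

/-- This is the parallelism of the soldering form, from `algLift_sigma`. The unprimed index is left
free, hence the term with `algLiftPlus`; it cancels against the derivative of ξ once the index is
contracted. -/
theorem covPoly_solderEta (a b : Fin 4) (A : Fin 2) :
    G.covPoly a (solderEta b A) = ∑ c, C (G.coef a c b) * solderEta c A
      - ∑ B, C (algLiftPlus (G.coef a) A B) * solderEta b B := by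
  have h := fun A' => congrArg (C : K → SpinorPoly K) (algLift_sigma (G.coef_skew a) b A A')
  have h0 := h 0
  have h1 := h 1
  simp only [Fin.sum_univ_two, Fin.sum_univ_four, C_add, C_mul] at h0 h1
  simp only [solderEta, Fin.sum_univ_two, Fin.sum_univ_four, map_add, Derivation.leibniz,
    covPoly_algebraMap, covPoly_eta, smul_eq_mul, mul_zero, add_zero]
  linear_combination eta 0 * h0 + eta 1 * h1

theorem covPoly_solderPoly (a b : Fin 4) :
    G.covPoly a (solderPoly b) = ∑ c, C (G.coef a c b) * solderPoly c := by
  simp only [solderPoly_eq, map_add, Derivation.leibniz, covPoly_solderEta, covPoly_xi,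
    smul_eq_mul, Fin.sum_univ_two, Fin.sum_univ_four]
  ring

/-- The contraction is built from the parallel tensors σ and ε, so only the rotation of the frame
index `b` contributes. A commutator of derivations is a derivation, which reduces the claim to
generators. -/
theorem covPoly_contractPoly (a b : Fin 4) (p : SpinorPoly K) :
    G.covPoly a (contractPoly b p) = contractPoly b (G.covPoly a p)
      + ∑ c, C (G.coef a c b) * contractPoly c p := by
  have hC : ∀ (b : Fin 4) (f : K), contractPoly b (C f : SpinorPoly K) = 0 := fun b f => by
    rw [contractPoly_apply]; simp
  have hη : ∀ (b : Fin 4) (B : Fin 2), contractPoly b (eta B : SpinorPoly K) = 0 := fun b B => by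
    rw [contractPoly_apply]; simp
  have h0 : ∀ b : Fin 4, contractPoly b (xi 0 : SpinorPoly K) = solderEta b 1 := fun b => by
    rw [contractPoly_apply]; simp
  have h1 : ∀ b : Fin 4, contractPoly b (xi 1 : SpinorPoly K) = -solderEta b 0 := fun b => by
    rw [contractPoly_apply]; simp
  have htr : (C (algLiftPlus (G.coef a) 0 0) : SpinorPoly K) = -C (algLiftPlus (G.coef a) 1 1) := by
    rw [← C_neg, eq_neg_of_add_eq_zero_left (algLiftPlus_trace (G.coef_skew a))]
  have h : ⁅G.covPoly a, (contractPoly b : Derivation ℂ (SpinorPoly K) (SpinorPoly K))⁆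
      = ∑ c, (C (G.coef a c b) : SpinorPoly K) • contractPoly c := by
    refine derivation_mvPolynomial_ext (fun f => ?_) (fun i => ?_)
    · rw [Derivation.commutator_apply]
      simp [hC, derivation_sum_apply]
    · rw [Derivation.commutator_apply]
      rcases i with B | B
      · rw [show (X (Sum.inl B) : SpinorPoly K) = xi B from rfl, covPoly_xi]
        fin_cases B <;>
          simp only [Fin.zero_eta, Fin.mk_one, Fin.sum_univ_two, Fin.sum_univ_four, map_add,
            Derivation.leibniz, hC, h0, h1, map_neg, covPoly_solderEta, Derivation.add_apply,
            Derivation.smul_apply, smul_eq_mul, htr] <;> ring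
      · rw [show (X (Sum.inr B) : SpinorPoly K) = eta B from rfl]
        simp [hη, hC, Derivation.leibniz, derivation_sum_apply]
  have := congrArg (fun D => D p) h
  simp only [Derivation.commutator_apply, derivation_sum_apply, Derivation.smul_apply,
    smul_eq_mul] at this
  rw [← this]
  ring

/-- The curvature is linear in ξ and so preserves the degree in ξ. -/
theorem eulerXi_curvPoly (a b : Fin 4) (p : SpinorPoly K) :
    eulerXi (G.curvPoly a b p) = G.curvPoly a b (eulerXi p) := by
  have h : ⁅(eulerXi : Derivation ℂ (SpinorPoly K) (SpinorPoly K)),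
      (G.curvPoly a b).restrictScalars ℂ⁆ = 0 := by
    refine derivation_mvPolynomial_ext (fun f => ?_) (fun i => ?_)
    · rw [Derivation.commutator_apply]
      simp [eulerXi_apply]
    · rw [Derivation.commutator_apply]
      rcases i with B | B
      · change eulerXi (G.curvPoly a b (xi B)) - G.curvPoly a b (eulerXi (xi B)) = _
        fin_cases B <;> simp [eulerXi_apply, Fin.sum_univ_two] <;> ring
      · change eulerXi (G.curvPoly a b (eta B)) - G.curvPoly a b (eulerXi (eta B)) = _
        simp [eulerXi_apply, Fin.sum_univ_two]
  have := congrArg (fun D => D p) h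
  simpa [Derivation.commutator_apply, sub_eq_zero] using this

/-- The commutator of the two first-order operators is of order zero. -/
theorem operator_commutator (p : SpinorPoly K) :
    2 * (∑ a, solderPoly a * G.covPoly a (∑ b, contractPoly b (G.covPoly b p))
        - ∑ b, contractPoly b (G.covPoly b (∑ a, solderPoly a * G.covPoly a p)))
      = ∑ a, ∑ b, asdPoly a b * (eulerXi (G.curvPoly a b p) + G.curvPoly a b p) := by
  have hC : ∀ (b : Fin 4) (f : K), contractPoly b (C f : SpinorPoly K) = 0 := fun b f => by
    rw [contractPoly_apply]; simp
  set q : Fin 4 → SpinorPoly K := fun b => G.covPoly b p with hq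
  have h1 : ∑ a, solderPoly a * G.covPoly a (∑ b, contractPoly b (q b))
      = ∑ a, ∑ b, (solderPoly a * contractPoly b (G.covPoly a (q b))
          + ∑ c, C (G.coef a b c) * (solderPoly a * contractPoly b (q c))) := by
    refine Finset.sum_congr rfl fun a _ => ?_
    rw [map_sum, Finset.mul_sum]
    simp only [covPoly_contractPoly, mul_add, Finset.sum_add_distrib, Finset.mul_sum]
    refine congrArg (_ + ·) ?_
    rw [Finset.sum_comm]
    refine Finset.sum_congr rfl fun b _ => Finset.sum_congr rfl fun c _ => ?_
    ring
  -- In this order the contraction also hits the factor `solderPoly a`; this is the source of the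
  -- `asdPoly` terms.
  have h2 : ∑ b, contractPoly b (G.covPoly b (∑ a, solderPoly a * q a))
      = ∑ a, ∑ b, (solderPoly a * contractPoly b (G.covPoly b (q a)) + asdPoly a b * G.covPoly b (q a)
          + ∑ c, C (G.coef b a c) *
            (solderPoly a * contractPoly b (q c) + asdPoly a b * q c)) := by
    rw [Finset.sum_comm]
    refine Finset.sum_congr rfl fun b _ => ?_
    simp only [map_sum, Derivation.leibniz, covPoly_solderPoly, smul_eq_mul, map_add, hC,
      contractPoly_solderPoly, Finset.sum_add_distrib, Finset.mul_sum, mul_zero, add_zero, mul_add]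
    rw [Finset.sum_comm (f := fun x i => q x * (C (G.coef b i x) * asdPoly i b)),
      Finset.sum_comm (f := fun x i => C (G.coef b i x) * solderPoly i * contractPoly b (q x))]
    have e1 : ∀ i x, q x * (C (G.coef b i x) * asdPoly i b)
        = C (G.coef b i x) * (asdPoly i b * q x) := fun i x => by ring
    have e2 : ∀ i x, C (G.coef b i x) * solderPoly i * contractPoly b (q x)
        = C (G.coef b i x) * (solderPoly i * contractPoly b (q x)) := fun i x => by ring
    have e3 : ∀ i, G.covPoly b (q i) * asdPoly i b = asdPoly i b * G.covPoly b (q i) :=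
      fun i => by ring
    simp only [e1, e2, e3]
    ring
  have hR : ∀ a b, G.covPoly a (q b) - G.covPoly b (q a)
      = G.curvPoly a b p + ∑ c, C (G.coef b a c - G.coef a b c) * q c := fun a b => by
    rw [covPoly_commutator]
    refine congrArg (_ + ·) (Finset.sum_congr rfl fun c _ => ?_)
    rw [G.coef_skew a c b, G.coef_skew b c a, neg_sub_neg]
  have htR : ∀ a b, contractPoly b (G.covPoly a (q b)) - contractPoly b (G.covPoly b (q a))
      = contractPoly b (G.curvPoly a b p)
        + ∑ c, C (G.coef b a c - G.coef a b c) * contractPoly b (q c) := fun a b => by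
    rw [← map_sub, hR, map_add, map_sum]
    simp only [Derivation.leibniz, hC, smul_eq_mul, mul_zero, add_zero]
  have hF := fun a b => G.curvPoly_swap a b p
  -- The Ricci identity replaces the antisymmetrised second derivatives under the contraction by
  -- curvature and absorbs the matching connection terms; `g` collects what is left.
  set g : Fin 4 → Fin 4 → SpinorPoly K := fun a b =>
    solderPoly a * contractPoly b (G.curvPoly a b p) - asdPoly a b * G.covPoly b (q a)
      - ∑ c, C (G.coef b a c) * (asdPoly a b * q c) with hg
  have h3 : ∑ a, solderPoly a * G.covPoly a (∑ b, contractPoly b (q b))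
      - ∑ b, contractPoly b (G.covPoly b (∑ a, solderPoly a * q a)) = ∑ a, ∑ b, g a b := by
    rw [h1, h2, ← Finset.sum_sub_distrib]
    refine Finset.sum_congr rfl fun a _ => ?_
    rw [← Finset.sum_sub_distrib]
    refine Finset.sum_congr rfl fun b _ => ?_
    have := htR a b
    simp only [hg, mul_add, Finset.sum_add_distrib]
    simp only [C_sub, sub_mul, Finset.sum_sub_distrib] at this
    have e1 : ∀ a' b', ∑ c, C (G.coef a' b' c) * (solderPoly a * contractPoly b (q c))
        = solderPoly a * ∑ c, C (G.coef a' b' c) * contractPoly b (q c) := fun a' b' => by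
      rw [Finset.mul_sum]
      exact Finset.sum_congr rfl fun c _ => by ring
    rw [e1, e1]
    linear_combination solderPoly a * this
  rw [h3, two_mul]
  -- Adding the double sum to its transpose keeps only skew parts. The first term of `g` then yields
  -- the Euler derivation of the curvature, and the `asdPoly` terms yield the curvature once more by
  -- the Ricci identity.
  conv_lhs => arg 2; rw [Finset.sum_comm]
  rw [← Finset.sum_add_distrib]
  refine Finset.sum_congr rfl fun a _ => ?_
  rw [← Finset.sum_add_distrib]
  refine Finset.sum_congr rfl fun b _ => ?_
  have hs := solderPoly_mul_contractPoly_sub a b (G.curvPoly a b p)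
  have hr := hR a b
  simp only [C_sub, sub_mul, Finset.sum_sub_distrib] at hr
  have e1 : ∀ a' b', ∑ c, C (G.coef a' b' c) * (asdPoly a b * q c)
      = asdPoly a b * ∑ c, C (G.coef a' b' c) * q c := fun a' b' => by
    rw [Finset.mul_sum]
    exact Finset.sum_congr rfl fun c _ => by ring
  simp only [hg]
  rw [asdPoly_skew b a, hF b a]
  simp only [neg_mul, mul_neg, Finset.sum_neg_distrib, map_neg, e1]
  linear_combination hs + asdPoly a b * hr

end FrameConnection

end SpinorDiagram

end

noncomputable section

namespace SpinorDiagram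

open MvPolynomial

/-- Exchanging the extra index with the entry in slot `s` is an involution. It transfers a matrix
acting on a slot of an array to the corresponding variable of the monomial. -/
theorem sum_update_swap {k : ℕ} {M : Type*} [AddCommMonoid M] (s : Fin k)
    (f : (Fin k → Fin 2) → Fin 2 → M) :
    ∑ A : Fin k → Fin 2, ∑ B, f A B = ∑ A : Fin k → Fin 2, ∑ B, f (Function.update A s B) (A s) := by
  have hinv : Function.Involutive fun p : (Fin k → Fin 2) × Fin 2 =>
      (Function.update p.1 s p.2, p.1 s) := fun p => by simp
  rw [← Fintype.sum_prod_type', ← Fintype.sum_prod_type']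
  exact (Equiv.sum_comp (hinv.toPerm _) fun p : (Fin k → Fin 2) × Fin 2 => f p.1 p.2).symm

theorem prod_erase_mul_update {k : ℕ} {M : Type*} [CommMonoid M] (g : Fin 2 → M)
    (A : Fin k → Fin 2) (s : Fin k) (B : Fin 2) :
    (∏ r ∈ Finset.univ.erase s, g (A r)) * g B = ∏ r, g (Function.update A s B r) := by
  rw [← Finset.mul_prod_erase _ _ (Finset.mem_univ s), Function.update_self, mul_comm]
  refine congrArg (g B * ·) (Finset.prod_congr rfl fun r hr => ?_)
  rw [Function.update_of_ne (Finset.ne_of_mem_erase hr)]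

/-! ### Symmetrised arrays and the degree of their polynomials -/

section Symmetrization

variable {K : Type*} [CommRing K] [Algebra ℂ K]

/-- `symmetrize` for arrays with entries in a `ℂ`-algebra. -/
def algSymmetrize {k n : ℕ} (T : SpinorArray K k n) : SpinorArray K k n := fun A A' =>
  algebraMap ℂ K ((k.factorial : ℂ) * (n.factorial : ℂ))⁻¹ *
    ∑ τ : Equiv.Perm (Fin k), ∑ ρ : Equiv.Perm (Fin n), T (A ∘ τ) (A' ∘ ρ)

theorem isSymmArray_algSymmetrize {k n : ℕ} (T : SpinorArray K k n) :
    IsSymmArray (algSymmetrize T) := by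
  intro τ₀ ρ₀ A A'
  simp only [algSymmetrize]
  refine congrArg (_ * ·) ?_
  refine Fintype.sum_equiv (Equiv.mulLeft τ₀) _ _ fun τ => ?_
  refine Fintype.sum_equiv (Equiv.mulLeft ρ₀) _ _ fun ρ => ?_
  rfl

theorem toPoly_algSymmetrize {k n : ℕ} (T : SpinorArray K k n) :
    toPoly (algSymmetrize T) = toPoly T := by
  unfold algSymmetrize
  rw [toPoly_mul_left, toPoly_sum]
  simp_rw [toPoly_sum, toPoly_comp_perm]
  rw [Finset.sum_const, Finset.sum_const, Finset.card_univ, Finset.card_univ, Fintype.card_perm,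
    Fintype.card_perm, Fintype.card_fin, Fintype.card_fin, smul_smul, nsmul_eq_mul, ← mul_assoc,
    ← map_natCast (C : K →+* SpinorPoly K), ← C_mul, ← map_natCast (algebraMap ℂ K), ← map_mul,
    Nat.cast_mul, inv_mul_cancel₀, map_one, C_1, one_mul]
  exact mul_ne_zero (Nat.cast_ne_zero.2 k.factorial_ne_zero) (Nat.cast_ne_zero.2 n.factorial_ne_zero)

theorem IsSymmArray.mul_left {k n : ℕ} {T : SpinorArray K k n} (hT : IsSymmArray T) (c : K) :
    IsSymmArray fun A A' => c * T A A' :=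
  fun τ ρ A A' => congrArg (c * ·) (hT τ ρ A A')

theorem eulerXi_toPoly {k n : ℕ} (T : SpinorArray K k n) :
    eulerXi (toPoly T) = (k : SpinorPoly K) * toPoly T := by
  have hC : ∀ f : K, eulerXi (C f : SpinorPoly K) = 0 := fun f => by simp [eulerXi_apply]
  have hη : ∀ B, eulerXi (eta B : SpinorPoly K) = 0 := fun B => by simp [eulerXi_apply]
  have hξ : ∀ B, eulerXi (xi B : SpinorPoly K) = xi B := fun B => by
    fin_cases B <;> simp [eulerXi_apply]
  simp only [toPoly, map_sum, Finset.mul_sum]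
  refine Finset.sum_congr rfl fun A _ => Finset.sum_congr rfl fun A' _ => ?_
  simp only [Derivation.leibniz, hC, derivation_prod, hη, hξ, smul_eq_mul, mul_zero, add_zero,
    Finset.sum_const_zero, zero_add]
  rw [Finset.sum_congr rfl fun s hs => Finset.prod_erase_mul Finset.univ (fun r => xi (A r)) hs]
  simp
  ring

end Symmetrization

/-! ### The operators d and δ* on arrays and on polynomials -/

namespace FrameConnection

variable {K : Type*} [CommRing K] [Algebra ℂ K] (G : FrameConnection K)

/-- The covariant derivative along `e_a` on arrays. -/
def algCov {k n : ℕ} (a : Fin 4) (ψ : SpinorArray K k n) : SpinorArray K k n := fun A A' =>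
  G.deriv a (ψ A A')
    + ∑ s, ∑ B, algLiftPlus (G.coef a) (A s) B * ψ (Function.update A s B) A'
    + ∑ t, ∑ B', algLiftMinus (G.coef a) (A' t) B' * ψ A (Function.update A' t B')

theorem isSymmArray_algCov {k n : ℕ} (a : Fin 4) {ψ : SpinorArray K k n} (hψ : IsSymmArray ψ) :
    IsSymmArray (G.algCov a ψ) := by
  intro τ ρ A A'
  have hup : ∀ {m : ℕ} (A : Fin m → Fin 2) (τ : Equiv.Perm (Fin m)) (s : Fin m) (B : Fin 2),
      Function.update (A ∘ τ) s B = Function.update A (τ s) B ∘ τ := fun A τ s B => by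
    rw [Function.update_comp_equiv, Equiv.symm_apply_apply]
  simp only [algCov, hψ τ ρ]
  refine congrArg₂ (· + ·) (congrArg (G.deriv a (ψ A A') + ·) ?_) ?_
  · refine Fintype.sum_equiv τ _ _ fun s => Finset.sum_congr rfl fun B _ => ?_
    rw [hup, hψ]
    rfl
  · refine Fintype.sum_equiv ρ _ _ fun s => Finset.sum_congr rfl fun B _ => ?_
    rw [hup, hψ]
    rfl

theorem covPoly_prod_xi {k : ℕ} (a : Fin 4) (A : Fin k → Fin 2) :
    G.covPoly a (∏ s, xi (A s)) = ∑ s, ∑ B, C (algLiftPlus (G.coef a) B (A s)) *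
      ∏ r, xi (Function.update A s B r) := by
  rw [derivation_prod]
  refine Finset.sum_congr rfl fun s _ => ?_
  rw [covPoly_xi, Finset.mul_sum]
  refine Finset.sum_congr rfl fun B _ => ?_
  rw [← prod_erase_mul_update xi A s B]
  ring

theorem covPoly_prod_eta {n : ℕ} (a : Fin 4) (A : Fin n → Fin 2) :
    G.covPoly a (∏ s, eta (A s)) = ∑ s, ∑ B, C (algLiftMinus (G.coef a) B (A s)) *
      ∏ r, eta (Function.update A s B r) := by
  rw [derivation_prod]
  refine Finset.sum_congr rfl fun s _ => ?_
  rw [covPoly_eta, Finset.mul_sum]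
  refine Finset.sum_congr rfl fun B _ => ?_
  rw [← prod_erase_mul_update eta A s B]
  ring

/-- Passing from slots to variables transposes the connection matrix, which is why `covPoly` sends a
variable to a combination along a column. -/
theorem toPoly_algCov {k n : ℕ} (a : Fin 4) (ψ : SpinorArray K k n) :
    toPoly (G.algCov a ψ) = G.covPoly a (toPoly ψ) := by
  have h1 : toPoly (fun A A' => ∑ s, ∑ B,
      algLiftPlus (G.coef a) (A s) B * ψ (Function.update A s B) A')
      = ∑ A, ∑ A', C (ψ A A') * (G.covPoly a (∏ s, xi (A s)) * ∏ t, eta (A' t)) := by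
    rw [toPoly_sum]
    simp only [covPoly_prod_xi, Finset.sum_mul, Finset.mul_sum]
    rw [Finset.sum_congr rfl fun A _ => Finset.sum_comm, Finset.sum_comm]
    refine Finset.sum_congr rfl fun s _ => ?_
    unfold toPoly
    rw [Finset.sum_comm]
    conv_rhs => rw [Finset.sum_comm]
    refine Finset.sum_congr rfl fun A' _ => ?_
    simp only [map_sum, Finset.sum_mul]
    rw [sum_update_swap s]
    refine Finset.sum_congr rfl fun A _ => Finset.sum_congr rfl fun B _ => ?_
    rw [Function.update_self, Function.update_idem, Function.update_eq_self, C_mul]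
    ring
  have h2 : toPoly (fun A A' => ∑ s, ∑ B,
      algLiftMinus (G.coef a) (A' s) B * ψ A (Function.update A' s B))
      = ∑ A, ∑ A', C (ψ A A') * ((∏ s, xi (A s)) * G.covPoly a (∏ t, eta (A' t))) := by
    rw [toPoly_sum]
    unfold toPoly
    rw [Finset.sum_comm]
    refine Finset.sum_congr rfl fun A _ => ?_
    simp only [covPoly_prod_eta, Finset.mul_sum]
    conv_rhs => rw [Finset.sum_comm]
    refine Finset.sum_congr rfl fun s _ => ?_
    simp only [map_sum, Finset.sum_mul]
    rw [sum_update_swap s]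
    refine Finset.sum_congr rfl fun A' _ => Finset.sum_congr rfl fun B _ => ?_
    rw [Function.update_self, Function.update_idem, Function.update_eq_self, C_mul]
    ring
  have h3 : G.algCov a ψ = (fun A A' => G.deriv a (ψ A A'))
      + (fun A A' => ∑ s, ∑ B, algLiftPlus (G.coef a) (A s) B * ψ (Function.update A s B) A')
      + (fun A A' => ∑ s, ∑ B, algLiftMinus (G.coef a) (A' s) B * ψ A (Function.update A' s B)) :=
    rfl
  rw [h3, toPoly_add, toPoly_add, h1, h2]
  simp only [toPoly, map_sum, ← Finset.sum_add_distrib]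
  refine Finset.sum_congr rfl fun A _ => Finset.sum_congr rfl fun A' _ => ?_
  simp only [Derivation.leibniz, covPoly_C, smul_eq_mul]
  ring

/-- The operator `d` on arrays. -/
def algD {k n : ℕ} (ψ : SpinorArray K k n) : SpinorArray K (k + 1) (n + 1) := fun A A' =>
  (((k + 1) * (n + 1) : ℕ) : K) * algSymmetrize (fun A A' =>
    ∑ a, algebraMap ℂ K (sigma a (A 0) (A' 0)) * G.algCov a ψ (Fin.tail A) (Fin.tail A')) A A'

/-- The operator `δ*` on arrays. -/
def algDeltaStar {k n : ℕ} (ψ : SpinorArray K (k + 1) n) : SpinorArray K k (n + 1) := fun A A' =>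
  ((n + 1 : ℕ) : K) * algSymmetrize (fun A A' => ∑ E, ∑ B, algebraMap ℂ K (eps B E) *
    ∑ a, algebraMap ℂ K (sigma a E (A' 0)) * G.algCov a ψ (Fin.cons B A) (Fin.tail A')) A A'

theorem isSymmArray_algD {k n : ℕ} (ψ : SpinorArray K k n) : IsSymmArray (G.algD ψ) :=
  (isSymmArray_algSymmetrize _).mul_left _

theorem isSymmArray_algDeltaStar {k n : ℕ} (ψ : SpinorArray K (k + 1) n) :
    IsSymmArray (G.algDeltaStar ψ) :=
  (isSymmArray_algSymmetrize _).mul_left _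

theorem toPoly_algD {k n : ℕ} (ψ : SpinorArray K k n) :
    toPoly (G.algD ψ) = (((k + 1) * (n + 1) : ℕ) : SpinorPoly K) *
      ∑ a, solderPoly a * G.covPoly a (toPoly ψ) := by
  unfold algD
  rw [toPoly_mul_left, toPoly_algSymmetrize, toPoly_sum, map_natCast]
  refine congrArg (_ * ·) (Finset.sum_congr rfl fun a _ => ?_)
  rw [← toPoly_algCov]
  exact toPoly_cons (fun A A' => algebraMap ℂ K (sigma a A A')) (G.algCov a ψ)

/-- ∂/∂ξ counts all `k + 1` slots whereas δ* contracts one of them; the left-hand factor compensates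
without a division. -/
theorem toPoly_algDeltaStar {k n : ℕ} {ψ : SpinorArray K (k + 1) n} (hψ : IsSymmArray ψ) :
    ((k + 1 : ℕ) : SpinorPoly K) * toPoly (G.algDeltaStar ψ) = ((n + 1 : ℕ) : SpinorPoly K) *
      ∑ a, contractPoly a (G.covPoly a (toPoly ψ)) := by
  unfold algDeltaStar
  rw [toPoly_mul_left, toPoly_algSymmetrize, map_natCast, mul_left_comm]
  refine congrArg (_ * ·) ?_
  have h : ∀ A : Fin k → Fin 2, ∀ A' : Fin (n + 1) → Fin 2,
      (∑ E, ∑ B, algebraMap ℂ K (eps B E) *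
        ∑ a, algebraMap ℂ K (sigma a E (A' 0)) * G.algCov a ψ (Fin.cons B A) (Fin.tail A'))
      = ∑ a, (algebraMap ℂ K (sigma a 1 (A' 0)) * G.algCov a ψ (Fin.cons 0 A) (Fin.tail A')
        - algebraMap ℂ K (sigma a 0 (A' 0)) * G.algCov a ψ (Fin.cons 1 A) (Fin.tail A')) :=
    fun A A' => by
      simp only [Fin.sum_univ_two, eps, Finset.sum_sub_distrib]
      simp
      ring
  simp only [h]
  rw [toPoly_sum, Finset.mul_sum]
  refine Finset.sum_congr rfl fun a _ => ?_
  have h4 := toPoly_sub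
    (fun A A' => algebraMap ℂ K (sigma a 1 (A' 0)) * G.algCov a ψ (Fin.cons 0 A) (Fin.tail A'))
    (fun A A' => algebraMap ℂ K (sigma a 0 (A' 0)) * G.algCov a ψ (Fin.cons 1 A) (Fin.tail A'))
  refine (congrArg (_ * ·) h4).trans ?_
  rw [toPoly_cons_right (fun E => algebraMap ℂ K (sigma a 1 E))
      (fun A A' => G.algCov a ψ (Fin.cons 0 A) A'),
    toPoly_cons_right (fun E => algebraMap ℂ K (sigma a 0 E))
      (fun A A' => G.algCov a ψ (Fin.cons 1 A) A'),
    contractPoly_apply, ← toPoly_algCov, toPoly_pderiv (G.isSymmArray_algCov a hψ),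
    toPoly_pderiv (G.isSymmArray_algCov a hψ)]
  simp only [solderEta]
  ring

/-- The commutator `d δ* - δ* d` on arrays. -/
def algCommutator : {k n : ℕ} → SpinorArray K k n → SpinorArray K k (n + 2)
  | 0, _, ψ => -G.algDeltaStar (G.algD ψ)
  | _ + 1, _, ψ => G.algD (G.algDeltaStar ψ) - G.algDeltaStar (G.algD ψ)

theorem isSymmArray_algCommutator {k n : ℕ} (ψ : SpinorArray K k n) :
    IsSymmArray (G.algCommutator ψ) := by
  intro τ ρ A A'
  cases k with
  | zero => exact congrArg (- ·) (G.isSymmArray_algDeltaStar (G.algD ψ) τ ρ A A')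
  | succ k =>
    exact congrArg₂ (· - ·) (G.isSymmArray_algD (G.algDeltaStar ψ) τ ρ A A')
      (G.isSymmArray_algDeltaStar (G.algD ψ) τ ρ A A')

/-- Rings of smooth functions have zero divisors, but a positive integer is a unit in any ℂ-algebra.
-/
theorem natCast_succ_mul_cancel (k : ℕ) {p q : SpinorPoly K}
    (h : ((k + 1 : ℕ) : SpinorPoly K) * p = ((k + 1 : ℕ) : SpinorPoly K) * q) : p = q := by
  have hu : C (algebraMap ℂ K ((k + 1 : ℕ) : ℂ)⁻¹) * ((k + 1 : ℕ) : SpinorPoly K) = 1 := by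
    rw [← map_natCast (C : K →+* SpinorPoly K), ← C_mul, ← map_natCast (algebraMap ℂ K), ← map_mul,
      inv_mul_cancel₀ (Nat.cast_ne_zero.2 k.succ_ne_zero), map_one, C_1]
  calc p = C (algebraMap ℂ K ((k + 1 : ℕ) : ℂ)⁻¹) * (((k + 1 : ℕ) : SpinorPoly K) * p) := by
        rw [← mul_assoc, hu, one_mul]
    _ = q := by rw [h, ← mul_assoc, hu, one_mul]

/-- In δ*d the numerical factors are (k+1)(n+1) from d and (n+2)/(k+1) from δ*; in dδ*, for k ≥ 1,
they are (n+1)/k from δ* and k(n+2) from d. Both products equal (n+1)(n+2), so the plain commutator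
of the polynomial operators appears. The further factor k+1 is the Euler derivation plus one on
degree k. -/
theorem toPoly_algCommutator {k n : ℕ} {ψ : SpinorArray K k n} (hψ : IsSymmArray ψ) :
    2 * toPoly (G.algCommutator ψ) = (((n + 1) * (n + 2) * (k + 1) : ℕ) : SpinorPoly K) *
      ∑ a, ∑ b, asdPoly a b * G.curvPoly a b (toPoly ψ) := by
  have hE : ∀ a b, eulerXi (G.curvPoly a b (toPoly ψ)) + G.curvPoly a b (toPoly ψ)
      = ((k + 1 : ℕ) : SpinorPoly K) * G.curvPoly a b (toPoly ψ) := fun a b => by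
    rw [eulerXi_curvPoly, eulerXi_toPoly, Derivation.leibniz, Derivation.map_natCast]
    simp
    ring
  have hop := G.operator_commutator (toPoly ψ)
  simp only [hE, mul_left_comm _ (((k + 1 : ℕ) : SpinorPoly K)), ← Finset.mul_sum] at hop
  have hdd : toPoly (G.algDeltaStar (G.algD ψ)) = (((n + 1) * (n + 2) : ℕ) : SpinorPoly K) *
      ∑ b, contractPoly b (G.covPoly b (∑ a, solderPoly a * G.covPoly a (toPoly ψ))) := by
    apply natCast_succ_mul_cancel k
    rw [G.toPoly_algDeltaStar (G.isSymmArray_algD ψ), toPoly_algD]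
    simp only [Derivation.leibniz, Derivation.map_natCast, smul_eq_mul, mul_zero, add_zero,
      ← Finset.mul_sum]
    push_cast
    ring
  have hcast : (((n + 1) * (n + 2) * (k + 1) : ℕ) : SpinorPoly K)
      = (((n + 1) * (n + 2) : ℕ) : SpinorPoly K) * ((k + 1 : ℕ) : SpinorPoly K) := by push_cast; ring
  rw [hcast, mul_assoc, ← hop]
  cases k with
  | zero =>
    -- Without ξ the contraction vanishes, so the absent term dδ* is accounted for and the general
    -- formula holds for k = 0.
    have h0 : ∀ b, contractPoly b (G.covPoly b (toPoly ψ)) = 0 := fun b => by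
      rw [← toPoly_algCov, contractPoly_apply, pderiv_toPoly_of_no_unprimed,
        pderiv_toPoly_of_no_unprimed, mul_zero, mul_zero, sub_zero]
    change 2 * toPoly (-G.algDeltaStar (G.algD ψ)) = _
    rw [toPoly_neg, hdd]
    simp only [h0, Finset.sum_const_zero, map_zero, mul_zero]
    ring
  | succ k =>
    have hd : toPoly (G.algD (G.algDeltaStar ψ)) = (((n + 1) * (n + 2) : ℕ) : SpinorPoly K) *
        ∑ a, solderPoly a * G.covPoly a (∑ b, contractPoly b (G.covPoly b (toPoly ψ))) := by
      have h1 := G.toPoly_algDeltaStar hψ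
      have h2 := fun a => congrArg (fun p => solderPoly a * G.covPoly a p) h1
      simp only [Derivation.leibniz, Derivation.map_natCast, smul_eq_mul, mul_zero, add_zero] at h2
      have h3 := Finset.sum_congr (s₁ := Finset.univ) rfl fun a _ => h2 a
      simp only [mul_left_comm (solderPoly _), ← Finset.mul_sum] at h3
      rw [toPoly_algD]
      push_cast at h3 ⊢
      linear_combination ((n : SpinorPoly K) + 2) * h3
    change 2 * toPoly (G.algD (G.algDeltaStar ψ) - G.algDeltaStar (G.algD ψ)) = _
    rw [toPoly_sub, hd, hdd]
    ring

end FrameConnection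

end SpinorDiagram

end

noncomputable section

namespace SpinorDiagram

/-! ### Smooth functions on an open set -/

section SmoothFunctions

variable {M : Type*} [TopologicalSpace M] [ChartedSpace E4 M] {U : Set M}

/-- Smoothness of a vector field on a set. -/
def SmoothFieldOn [IsManifold 𝓘(ℝ, E4) 1 M] (X : VField M) (U : Set M) : Prop :=
  ContMDiffOn 𝓘(ℝ, E4) 𝓘(ℝ, E4).tangent ∞ (fun x => (⟨x, X x⟩ : TangentBundle 𝓘(ℝ, E4) M)) U

theorem contMDiffOn_mvfderiv [IsManifold 𝓘(ℝ, E4) ∞ M] {F : Type*} [NormedAddCommGroup F]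
    [NormedSpace ℝ F] (hU : IsOpen U) {X : VField M} (hX : SmoothFieldOn X U) {f : M → F}
    (hf : ContMDiffOn 𝓘(ℝ, E4) 𝓘(ℝ, F) ∞ f U) :
    ContMDiffOn 𝓘(ℝ, E4) 𝓘(ℝ, F) ∞ (fun x => mvfderiv 𝓘(ℝ, E4) f x (X x)) U := by
  have h1 := hf.contMDiffOn_tangentMapWithin (m := ∞) (by simp) hU.uniqueMDiffOn
  have h2 := h1.comp hX (fun x hx => hx)
  intro x hx
  have h3 := (contMDiffWithinAt_totalSpace.1 (h2 x hx)).2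
  refine h3.congr (fun y hy => ?_) ?_
  · simp [tangentMapWithin, mvfderiv, mfderivWithin_of_isOpen hU hy]
    rfl
  · simp [tangentMapWithin, mvfderiv, mfderivWithin_of_isOpen hU hx]
    rfl

variable {𝕜 : Type*} [NormedField 𝕜] [NormedAlgebra ℝ 𝕜]

theorem contMDiffOn_mul {f g : M → 𝕜} (hf : ContMDiffOn 𝓘(ℝ, E4) 𝓘(ℝ, 𝕜) ∞ f U)
    (hg : ContMDiffOn 𝓘(ℝ, E4) 𝓘(ℝ, 𝕜) ∞ g U) :
    ContMDiffOn 𝓘(ℝ, E4) 𝓘(ℝ, 𝕜) ∞ (fun x => f x * g x) U := fun x hx =>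
  (contDiff_mul (𝕜 := ℝ) (𝔸 := 𝕜)).comp_contMDiffWithinAt ((hf x hx).prodMk_space (hg x hx))

theorem mdifferentiableAt_of_smoothOn {F : Type*} [NormedAddCommGroup F] [NormedSpace ℝ F]
    (hU : IsOpen U) {f : M → F} (hf : ContMDiffOn 𝓘(ℝ, E4) 𝓘(ℝ, F) ∞ f U) {x : M} (hx : x ∈ U) :
    MDifferentiableAt 𝓘(ℝ, E4) 𝓘(ℝ, F) f x :=
  (hf.contMDiffAt (hU.mem_nhds hx)).mdifferentiableAt (by simp)

theorem mvfderiv_congr {F : Type*} [NormedAddCommGroup F] [NormedSpace ℝ F] (hU : IsOpen U)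
    {f g : M → F} (h : Set.EqOn f g U) {x : M} (hx : x ∈ U) (v : TangentSpace 𝓘(ℝ, E4) x) :
    mvfderiv 𝓘(ℝ, E4) f x v = mvfderiv 𝓘(ℝ, E4) g x v := by
  have hfg : f =ᶠ[nhds x] g := Filter.eventuallyEq_of_mem (hU.mem_nhds hx) h
  simp only [mvfderiv, hfg.mfderiv_eq, ContinuousLinearMap.comp_apply]
  rfl

theorem mvfderiv_mul_apply {f g : M → 𝕜} {x : M} (hf : MDifferentiableAt 𝓘(ℝ, E4) 𝓘(ℝ, 𝕜) f x)
    (hg : MDifferentiableAt 𝓘(ℝ, E4) 𝓘(ℝ, 𝕜) g x) (v : TangentSpace 𝓘(ℝ, E4) x) :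
    mvfderiv 𝓘(ℝ, E4) (fun y => f y * g y) x v
      = f x * mvfderiv 𝓘(ℝ, E4) g x v + g x * mvfderiv 𝓘(ℝ, E4) f x v := by
  have h := (HasMFDerivAt.mul (p := f) (q := g) (p' := mvfderiv 𝓘(ℝ, E4) f x)
    (q' := mvfderiv 𝓘(ℝ, E4) g x) hf.hasMFDerivAt hg.hasMFDerivAt).mfderiv
  exact congrArg (fun L => L v) h

theorem mvfderiv_add_apply {F : Type*} [NormedAddCommGroup F] [NormedSpace ℝ F] {f g : M → F}
    {x : M} (hf : MDifferentiableAt 𝓘(ℝ, E4) 𝓘(ℝ, F) f x)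
    (hg : MDifferentiableAt 𝓘(ℝ, E4) 𝓘(ℝ, F) g x) (v : TangentSpace 𝓘(ℝ, E4) x) :
    mvfderiv 𝓘(ℝ, E4) (fun y => f y + g y) x v
      = mvfderiv 𝓘(ℝ, E4) f x v + mvfderiv 𝓘(ℝ, E4) g x v := by
  have h := mvfderiv_fun_add hf hg
  rw [h]
  rfl

theorem mvfderiv_clm_apply {F F' : Type*} [NormedAddCommGroup F] [NormedSpace ℝ F]
    [NormedAddCommGroup F'] [NormedSpace ℝ F'] (L : F →L[ℝ] F') {f : M → F} {x : M}
    (hf : MDifferentiableAt 𝓘(ℝ, E4) 𝓘(ℝ, F) f x) (v : TangentSpace 𝓘(ℝ, E4) x) :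
    mvfderiv 𝓘(ℝ, E4) (fun y => L (f y)) x v = L (mvfderiv 𝓘(ℝ, E4) f x v) := by
  have h : HasMFDerivAt 𝓘(ℝ, E4) 𝓘(ℝ, F') (L ∘ f) x _ :=
    HasMFDerivAt.comp x (L.hasMFDerivAt (x := f x)) hf.hasMFDerivAt
  exact congrArg (fun L => L v) h.mfderiv

variable (𝕜) in
/-- A function on a set, extended by zero. -/
def extendZero (f : U → 𝕜) : M → 𝕜 :=
  open Classical in fun x => if h : x ∈ U then f ⟨x, h⟩ else 0

theorem extendZero_apply (f : U → 𝕜) (x : U) : extendZero 𝕜 f x = f x := by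
  simp [extendZero]

theorem extendZero_eqOn {f : U → 𝕜} {g : M → 𝕜} (h : ∀ x : U, f x = g x) :
    Set.EqOn (extendZero 𝕜 f) g U := fun x hx => by
  rw [← h ⟨x, hx⟩, ← extendZero_apply f ⟨x, hx⟩]

variable (U 𝕜) in
/-- The algebra of smooth functions on a set. -/
def smoothRing : Subalgebra 𝕜 (U → 𝕜) where
  carrier := {f | ContMDiffOn 𝓘(ℝ, E4) 𝓘(ℝ, 𝕜) ∞ (extendZero 𝕜 f) U}
  mul_mem' {f g} hf hg := (contMDiffOn_mul hf hg).congr (extendZero_eqOn fun x => by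
    simp [extendZero_apply])
  add_mem' {f g} hf hg := (hf.add hg).congr (extendZero_eqOn fun x => by
    simp [extendZero_apply])
  algebraMap_mem' c := (contMDiffOn_const (c := c)).congr (extendZero_eqOn fun x => rfl)

/-- The restriction of a function that is smooth on a set. -/
def toSmooth (g : M → 𝕜) (hg : ContMDiffOn 𝓘(ℝ, E4) 𝓘(ℝ, 𝕜) ∞ g U) : smoothRing U 𝕜 :=
  ⟨fun x => g x, hg.congr (extendZero_eqOn fun _ => rfl)⟩

@[simp] theorem toSmooth_apply (g : M → 𝕜) (hg : ContMDiffOn 𝓘(ℝ, E4) 𝓘(ℝ, 𝕜) ∞ g U) (x : U) :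
    (toSmooth g hg).1 x = g x := rfl

theorem smoothRing_ext {f g : smoothRing U 𝕜} (h : ∀ x : U, f.1 x = g.1 x) : f = g :=
  Subtype.ext (funext h)

/-- Evaluation at a point. -/
def evalAt (x : U) : smoothRing U 𝕜 →ₐ[𝕜] 𝕜 := (Pi.evalAlgHom 𝕜 (fun _ : U => 𝕜) x).comp
  (smoothRing U 𝕜).val

@[simp] theorem evalAt_apply (x : U) (f : smoothRing U 𝕜) : evalAt x f = f.1 x := rfl

variable (𝕜) in
/-- The derivation of the smooth functions given by a smooth vector field. -/
def fieldDerivation [IsManifold 𝓘(ℝ, E4) ∞ M] (hU : IsOpen U) (X : VField M)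
    (hX : SmoothFieldOn X U) : Derivation 𝕜 (smoothRing U 𝕜) (smoothRing U 𝕜) :=
  Derivation.mk' (M := smoothRing U 𝕜)
    { toFun := fun f => toSmooth _ (contMDiffOn_mvfderiv hU hX f.2)
      map_add' := fun f g => smoothRing_ext fun x => by
        refine (mvfderiv_congr hU (extendZero_eqOn (f := (f + g).1)
          (g := fun y => extendZero 𝕜 f.1 y + extendZero 𝕜 g.1 y) fun y => ?_) x.2 _).trans ?_
        · simp [extendZero_apply]
        · exact mvfderiv_add_apply (mdifferentiableAt_of_smoothOn hU f.2 x.2)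
            (mdifferentiableAt_of_smoothOn hU g.2 x.2) _
      map_smul' := fun c f => smoothRing_ext fun x => by
        refine (mvfderiv_congr hU (extendZero_eqOn (f := (c • f).1)
          (g := fun y => c * extendZero 𝕜 f.1 y) fun y => ?_) x.2 _).trans ?_
        · simp [extendZero_apply]
        · refine (mvfderiv_mul_apply (f := fun _ => c) mdifferentiableAt_const
            (mdifferentiableAt_of_smoothOn hU f.2 x.2) _).trans ?_
          rw [mvfderiv_const]
          simp }
    (fun f g => smoothRing_ext fun x => by
      refine (mvfderiv_congr hU (extendZero_eqOn (f := (f * g).1)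
        (g := fun y => extendZero 𝕜 f.1 y * extendZero 𝕜 g.1 y) fun y => ?_) x.2 _).trans ?_
      · simp [extendZero_apply]
      · refine (mvfderiv_mul_apply (mdifferentiableAt_of_smoothOn hU f.2 x.2)
          (mdifferentiableAt_of_smoothOn hU g.2 x.2) _).trans ?_
        simp [extendZero_apply])

/-- Differentiation is local on the open set, so any function agreeing with `f` there may replace
its extension by zero. -/
theorem fieldDerivation_apply [IsManifold 𝓘(ℝ, E4) ∞ M] (hU : IsOpen U) {X : VField M}
    (hX : SmoothFieldOn X U) (f : smoothRing U 𝕜) {g : M → 𝕜} (hfg : ∀ y : U, f.1 y = g y) (x : U) :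
    (fieldDerivation 𝕜 hU X hX f).1 x = mvfderiv 𝓘(ℝ, E4) g x (X x) :=
  mvfderiv_congr hU (extendZero_eqOn hfg) x.2 _

theorem fieldDerivation_apply' [IsManifold 𝓘(ℝ, E4) ∞ M] (hU : IsOpen U) {X : VField M}
    (hX : SmoothFieldOn X U) (f : smoothRing U 𝕜) (x : U) :
    (fieldDerivation 𝕜 hU X hX f).1 x = mvfderiv 𝓘(ℝ, E4) (extendZero 𝕜 f.1) x (X x) := rfl

end SmoothFunctions

end SpinorDiagram

end

noncomputable section

namespace SpinorDiagram

/-! ### Vector fields in a frame -/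

namespace FrameConnection

variable {K : Type*} [CommRing K] [Algebra ℂ K] (G : FrameConnection K)

/-- The derivative of functions along the field with components `X`. -/
def dir (X : Fin 4 → K) : Derivation ℂ K K := ∑ a, X a • G.deriv a

theorem dir_apply (X : Fin 4 → K) (f : K) : G.dir X f = ∑ a, X a * G.deriv a f := by
  simp [dir, derivation_sum_apply]

/-- The connection matrix along the field with components `X`. -/
def form (X : Fin 4 → K) (d c : Fin 4) : K := ∑ a, X a * G.coef a d c

theorem form_skew (X : Fin 4 → K) (d c : Fin 4) : G.form X d c = -G.form X c d := by
  simp only [form, ← Finset.sum_neg_distrib]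
  exact Finset.sum_congr rfl fun a _ => by rw [G.coef_skew a d c]; ring

/-- The components of `∇_X Y`. -/
def nab (X Y : Fin 4 → K) (c : Fin 4) : K := G.dir X (Y c) + ∑ b, G.form X c b * Y b

/-- The components of `[X, Y]`. -/
def bracket (X Y : Fin 4 → K) (c : Fin 4) : K := G.nab X Y c - G.nab Y X c

/-- Metric compatibility: the connection terms cancel in pairs because the matrix is skew. -/
theorem dir_inner (X Y Z : Fin 4 → K) :
    G.dir X (∑ c, Y c * Z c) = ∑ c, G.nab X Y c * Z c + ∑ c, Y c * G.nab X Z c := by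
  have h : ∑ c, ∑ b, G.form X c b * Y b * Z c + ∑ c, ∑ b, Y c * (G.form X c b * Z b) = 0 := by
    rw [Finset.sum_comm (f := fun c b => Y c * (G.form X c b * Z b)), ← Finset.sum_add_distrib]
    refine Finset.sum_eq_zero fun c _ => ?_
    rw [← Finset.sum_add_distrib]
    refine Finset.sum_eq_zero fun b _ => ?_
    rw [G.form_skew X c b]
    ring
  simp only [nab, add_mul, mul_add, Finset.sum_add_distrib, Finset.mul_sum, Finset.sum_mul, map_sum,
    Derivation.leibniz, smul_eq_mul]
  rw [Finset.sum_congr rfl fun c _ => mul_comm (Z c) (G.dir X (Y c))]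
  linear_combination -h

/-- Leibniz produces derivatives of the components and second frame derivatives of `f`; the skew
part of the latter is given by torsion-freeness. -/
theorem dir_bracket (X Y : Fin 4 → K) (f : K) :
    G.dir (G.bracket X Y) f = G.dir X (G.dir Y f) - G.dir Y (G.dir X f) := by
  have key : ∀ X Y : Fin 4 → K, G.dir X (G.dir Y f)
      = ∑ b, G.dir X (Y b) * G.deriv b f + ∑ a, ∑ b, X a * Y b * G.deriv a (G.deriv b f) := by
    intro X Y
    rw [Finset.sum_comm, G.dir_apply Y f, map_sum, ← Finset.sum_add_distrib]
    refine Finset.sum_congr rfl fun b _ => ?_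
    rw [Derivation.leibniz, smul_eq_mul, smul_eq_mul, G.dir_apply X (G.deriv b f), Finset.mul_sum,
      add_comm, mul_comm (G.deriv b f)]
    exact congrArg (_ + ·) (Finset.sum_congr rfl fun a _ => by ring)
  have h2 : ∑ a, ∑ b, X a * Y b * G.deriv a (G.deriv b f)
      - ∑ a, ∑ b, Y a * X b * G.deriv a (G.deriv b f)
      = ∑ c, (∑ b, G.form X c b * Y b - ∑ b, G.form Y c b * X b) * G.deriv c f := by
    rw [Finset.sum_comm (f := fun a b => Y a * X b * G.deriv a (G.deriv b f)),
      ← Finset.sum_sub_distrib]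
    have : ∀ a, ∑ b, X a * Y b * G.deriv a (G.deriv b f)
        - ∑ b, Y b * X a * G.deriv b (G.deriv a f)
        = ∑ b, ∑ c, X a * Y b * ((G.coef a c b - G.coef b c a) * G.deriv c f) := by
      intro a
      rw [← Finset.sum_sub_distrib]
      refine Finset.sum_congr rfl fun b _ => ?_
      rw [← Finset.mul_sum, ← G.torsion_free a b f]
      ring
    rw [Finset.sum_congr rfl fun a _ => this a]
    simp only [form, sub_mul, Finset.sum_sub_distrib, Finset.sum_mul, mul_sub]
    refine congrArg₂ (· - ·) ?_ ?_
    · rw [Finset.sum_congr rfl fun a _ => Finset.sum_comm, Finset.sum_comm]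
      refine Finset.sum_congr rfl fun c _ => ?_
      rw [Finset.sum_comm]
      exact Finset.sum_congr rfl fun b _ => Finset.sum_congr rfl fun a _ => by ring
    · rw [Finset.sum_congr rfl fun a _ => Finset.sum_comm, Finset.sum_comm]
      refine Finset.sum_congr rfl fun c _ => ?_
      exact Finset.sum_congr rfl fun b _ => Finset.sum_congr rfl fun a _ => by ring
  rw [key X Y, key Y X, G.dir_apply]
  simp only [bracket, nab]
  have h3 : ∀ c, (G.dir X (Y c) + ∑ b, G.form X c b * Y b
      - (G.dir Y (X c) + ∑ b, G.form Y c b * X b)) * G.deriv c f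
      = G.dir X (Y c) * G.deriv c f - G.dir Y (X c) * G.deriv c f
        + (∑ b, G.form X c b * Y b - ∑ b, G.form Y c b * X b) * G.deriv c f := fun c => by ring
  rw [Finset.sum_congr rfl fun c _ => h3 c, Finset.sum_add_distrib, Finset.sum_sub_distrib, ← h2]
  ring

/-- The curvature matrix of two fields. -/
def curvForm (X Y : Fin 4 → K) (d c : Fin 4) : K :=
  G.dir X (G.form Y d c) - G.dir Y (G.form X d c)
    + ∑ f, (G.form X d f * G.form Y f c - G.form Y d f * G.form X f c)
    - G.form (G.bracket X Y) d c

/-- Second derivatives of `Z` cancel by `dir_bracket`, and the mixed first-order terms are symmetric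
in `X` and `Y`, so only multiples of `Z` remain. -/
theorem nab_commutator (X Y Z : Fin 4 → K) (d : Fin 4) :
    G.nab X (G.nab Y Z) d - G.nab Y (G.nab X Z) d - G.nab (G.bracket X Y) Z d
      = ∑ c, G.curvForm X Y d c * Z c := by
  have key : ∀ X Y : Fin 4 → K, G.nab X (G.nab Y Z) d = G.dir X (G.dir Y (Z d))
      + ∑ c, (G.form Y d c * G.dir X (Z c) + G.form X d c * G.dir Y (Z c))
      + ∑ c, (G.dir X (G.form Y d c) + ∑ f, G.form X d f * G.form Y f c) * Z c := by
    intro X Y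
    have h1 : ∑ c, G.form X d c * ∑ f, G.form Y c f * Z f
        = ∑ c, (∑ f, G.form X d f * G.form Y f c) * Z c := by
      simp only [Finset.mul_sum, Finset.sum_mul]
      rw [Finset.sum_comm]
      exact Finset.sum_congr rfl fun b _ => Finset.sum_congr rfl fun a _ => by ring
    simp only [nab, map_add, map_sum, mul_add, add_mul, Finset.sum_add_distrib, h1,
      Derivation.leibniz, smul_eq_mul]
    rw [Finset.sum_congr rfl fun c _ => mul_comm (Z c) (G.dir X (G.form Y d c))]
    ring
  rw [key X Y, key Y X]
  simp only [nab, dir_bracket, curvForm, sub_mul, add_mul, Finset.sum_add_distrib,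
    Finset.sum_sub_distrib]
  ring

/-- Tensoriality: the derivatives of the components of `X` and `Y` are cancelled by those in the
bracket. -/
theorem curvForm_eq (X Y : Fin 4 → K) (d c : Fin 4) :
    G.curvForm X Y d c = ∑ a, ∑ b, X a * Y b * G.curv a b d c := by
  have key : ∀ X Y : Fin 4 → K, G.dir X (G.form Y d c) = ∑ b, G.dir X (Y b) * G.coef b d c
      + ∑ a, ∑ b, X a * Y b * G.deriv a (G.coef b d c) := by
    intro X Y
    rw [Finset.sum_comm]
    simp only [form, map_sum, Derivation.leibniz, smul_eq_mul, Finset.sum_add_distrib]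
    rw [add_comm]
    refine congrArg₂ (· + ·) (Finset.sum_congr rfl fun b _ => mul_comm _ _) ?_
    refine Finset.sum_congr rfl fun b _ => ?_
    rw [G.dir_apply, Finset.mul_sum]
    exact Finset.sum_congr rfl fun a _ => by ring
  have hff : ∀ X Y : Fin 4 → K, ∑ f, G.form X d f * G.form Y f c
      = ∑ a, ∑ b, X a * Y b * ∑ f, G.coef a d f * G.coef b f c := by
    intro X Y
    simp only [form]
    rw [Finset.sum_congr rfl fun f _ => Finset.sum_mul_sum _ _ _ _, Finset.sum_comm]
    refine Finset.sum_congr rfl fun a _ => ?_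
    rw [Finset.sum_comm]
    simp only [Finset.mul_sum]
    exact Finset.sum_congr rfl fun b _ => Finset.sum_congr rfl fun f _ => by ring
  have hcf : ∀ X Y : Fin 4 → K, ∑ f, (∑ b, G.form X f b * Y b) * G.coef f d c
      = ∑ a, ∑ b, X a * Y b * ∑ f, G.coef a f b * G.coef f d c := by
    intro X Y
    simp only [form, Finset.sum_mul, Finset.mul_sum]
    rw [Finset.sum_congr rfl fun a _ => Finset.sum_comm, Finset.sum_comm]
    refine Finset.sum_congr rfl fun a _ => ?_
    rw [Finset.sum_comm]
    exact Finset.sum_congr rfl fun b _ => Finset.sum_congr rfl fun f _ => by ring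
  have hbr : G.form (G.bracket X Y) d c = ∑ b, G.dir X (Y b) * G.coef b d c
      - ∑ b, G.dir Y (X b) * G.coef b d c
      + ∑ a, ∑ b, X a * Y b * ∑ f, G.coef a f b * G.coef f d c
      - ∑ a, ∑ b, Y a * X b * ∑ f, G.coef a f b * G.coef f d c := by
    rw [← hcf, ← hcf]
    simp only [form.eq_1 G (G.bracket X Y), bracket, nab, sub_mul, add_mul,
      Finset.sum_sub_distrib, Finset.sum_add_distrib]
    ring
  have hsw : ∀ T : Fin 4 → Fin 4 → K, ∑ a, ∑ b, Y a * X b * T a b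
      = ∑ a, ∑ b, X a * Y b * T b a := by
    intro T
    rw [Finset.sum_comm]
    exact Finset.sum_congr rfl fun a _ => Finset.sum_congr rfl fun b _ => by ring
  simp only [curvForm, Finset.sum_sub_distrib]
  rw [key X Y, key Y X, hff X Y, hff Y X, hbr, hsw, hsw, hsw]
  simp only [curv, sub_mul, mul_sub, mul_add, Finset.sum_sub_distrib, Finset.sum_add_distrib]
  ring

theorem nab_sub_right (X Y Z : Fin 4 → K) (c : Fin 4) :
    G.nab X (fun c => Y c - Z c) c = G.nab X Y c - G.nab X Z c := by
  simp only [nab, map_sub, mul_sub, Finset.sum_sub_distrib]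
  ring

/-- For `bracket` defined as ∇_X Y - ∇_Y X, the Jacobi sum is the cyclic sum of curvatures. Jacobi
is a hypothesis because the axioms of `FrameConnection` constrain the bracket only through its
action on functions. -/
theorem curvForm_cyclic {X Y Z : Fin 4 → K} (d : Fin 4)
    (h : G.bracket X (G.bracket Y Z) d + G.bracket Y (G.bracket Z X) d
      + G.bracket Z (G.bracket X Y) d = 0) :
    ∑ c, G.curvForm X Y d c * Z c + ∑ c, G.curvForm Y Z d c * X c
      + ∑ c, G.curvForm Z X d c * Y c = 0 := by
  simp only [← nab_commutator]
  have e : ∀ X Y Z : Fin 4 → K, G.bracket X (G.bracket Y Z) d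
      = G.nab X (G.nab Y Z) d - G.nab X (G.nab Z Y) d - G.nab (G.bracket Y Z) X d := by
    intro X Y Z
    rw [← G.nab_sub_right]
    rfl
  rw [e, e, e] at h
  linear_combination h

theorem curvForm_single (a b d c : Fin 4) :
    G.curvForm (Pi.single a 1) (Pi.single b 1) d c = G.curv a b d c := by
  rw [curvForm_eq, Finset.sum_eq_single a, Finset.sum_eq_single b] <;>
    simp +contextual [Pi.single_apply]

theorem curv_cyclic {a b c : Fin 4} (d : Fin 4)
    (h : G.bracket (Pi.single a 1) (G.bracket (Pi.single b 1) (Pi.single c 1)) d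
      + G.bracket (Pi.single b 1) (G.bracket (Pi.single c 1) (Pi.single a 1)) d
      + G.bracket (Pi.single c 1) (G.bracket (Pi.single a 1) (Pi.single b 1)) d = 0) :
    G.curv a b d c + G.curv b c d a + G.curv c a d b = 0 := by
  have := G.curvForm_cyclic d h
  simpa [curvForm_single, Pi.single_apply] using this

end FrameConnection

end SpinorDiagram

end

noncomputable section

namespace SpinorDiagram

/-! ### Smooth vector fields and their brackets -/

section SmoothFields

variable {M : Type*} [TopologicalSpace M] [ChartedSpace E4 M] [IsManifold 𝓘(ℝ, E4) ∞ M]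
  {U : Set M} {X Y Z : VField M}

theorem SmoothFieldOn.mono (hX : SmoothFieldOn X U) {V : Set M} (h : V ⊆ U) : SmoothFieldOn X V :=
  ContMDiffOn.mono hX h

theorem SmoothFieldOn.contMDiffAt (hX : SmoothFieldOn X U) (hU : IsOpen U) {x : M} (hx : x ∈ U) :
    ContMDiffAt 𝓘(ℝ, E4) 𝓘(ℝ, E4).tangent ∞
      (fun x => (⟨x, X x⟩ : TangentBundle 𝓘(ℝ, E4) M)) x :=
  ContMDiffOn.contMDiffAt hX (hU.mem_nhds hx)

theorem SmoothFieldOn.mdifferentiableAt (hX : SmoothFieldOn X U) (hU : IsOpen U) {x : M}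
    (hx : x ∈ U) : MDifferentiableAt 𝓘(ℝ, E4) 𝓘(ℝ, E4).tangent
      (fun x => (⟨x, X x⟩ : TangentBundle 𝓘(ℝ, E4) M)) x :=
  (hX.contMDiffAt hU hx).mdifferentiableAt (by simp)

theorem SmoothFieldOn.smul (hX : SmoothFieldOn X U) {f : M → ℝ}
    (hf : ContMDiffOn 𝓘(ℝ, E4) 𝓘(ℝ, ℝ) ∞ f U) : SmoothFieldOn (f • X) U :=
  ContMDiffOn.smul_section hf hX

theorem SmoothFieldOn.congr (hX : SmoothFieldOn X U) (h : ∀ x ∈ U, Y x = X x) :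
    SmoothFieldOn Y U :=
  ContMDiffOn.congr hX fun x hx => by rw [h x hx]

theorem SmoothFieldOn.sum {ι : Type*} {s : Finset ι} {X : ι → VField M}
    (hX : ∀ i, SmoothFieldOn (X i) U) : SmoothFieldOn (∑ i ∈ s, X i) U := by
  have h : SmoothFieldOn (fun x => ∑ i ∈ s, X i x) U :=
    ContMDiffOn.sum_section (V := fun x : M => TangentSpace 𝓘(ℝ, E4) x) fun i _ => hX i
  exact h.congr fun x _ => Finset.sum_apply x s X

theorem minSmoothness_le_infty (n : ℕ) : minSmoothness ℝ (n : WithTop ℕ∞) ≤ ∞ := by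
  simp only [minSmoothness_of_isRCLikeNormedField]
  exact_mod_cast (le_top : (n : ℕ∞) ≤ ⊤)

theorem SmoothFieldOn.mlieBracket (hU : IsOpen U) (hX : SmoothFieldOn X U)
    (hY : SmoothFieldOn Y U) : SmoothFieldOn (VectorField.mlieBracket 𝓘(ℝ, E4) X Y) U := by
  haveI : IsManifold 𝓘(ℝ, E4) (((⊤ : ℕ∞) : WithTop ℕ∞) + 1) M :=
    IsManifold.of_le (n := ∞) (by simp)
  haveI : IsManifold 𝓘(ℝ, E4) (minSmoothness ℝ 2) M :=
    IsManifold.of_le (minSmoothness_le_infty 2)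
  exact fun x hx => (ContMDiffAt.mlieBracket_vectorField (m := ⊤) (n := ⊤)
    (hX.contMDiffAt hU hx) (hY.contMDiffAt hU hx) (by simp)).contMDiffWithinAt

theorem mlieBracket_jacobi (hU : IsOpen U) (hX : SmoothFieldOn X U)
    (hY : SmoothFieldOn Y U) (hZ : SmoothFieldOn Z U) {x : M} (hx : x ∈ U) :
    VectorField.mlieBracket 𝓘(ℝ, E4) X (VectorField.mlieBracket 𝓘(ℝ, E4) Y Z) x
      = VectorField.mlieBracket 𝓘(ℝ, E4) (VectorField.mlieBracket 𝓘(ℝ, E4) X Y) Z x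
        + VectorField.mlieBracket 𝓘(ℝ, E4) Y (VectorField.mlieBracket 𝓘(ℝ, E4) X Z) x := by
  haveI : IsManifold 𝓘(ℝ, E4) (minSmoothness ℝ 3) M :=
    IsManifold.of_le (minSmoothness_le_infty 3)
  have h : (minSmoothness ℝ 2 : WithTop ℕ∞) ≤ ∞ := minSmoothness_le_infty 2
  exact VectorField.leibniz_identity_mlieBracket_apply ((hX.contMDiffAt hU hx).of_le h)
    ((hY.contMDiffAt hU hx).of_le h) ((hZ.contMDiffAt hU hx).of_le h)

theorem mlieBracket_smul (hU : IsOpen U) {f : M → ℝ} (hf : ContMDiffOn 𝓘(ℝ, E4) 𝓘(ℝ, ℝ) ∞ f U)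
    (hY : SmoothFieldOn Y U) {x : M} (hx : x ∈ U) :
    VectorField.mlieBracket 𝓘(ℝ, E4) X (f • Y) x
      = mvfderiv 𝓘(ℝ, E4) f x (X x) • Y x + f x • VectorField.mlieBracket 𝓘(ℝ, E4) X Y x :=
  VectorField.mlieBracket_smul_right (mdifferentiableAt_of_smoothOn hU hf hx)
    (hY.mdifferentiableAt hU hx)

theorem mlieBracket_congr_right (hU : IsOpen U) (h : ∀ x ∈ U, Y x = Z x) {x : M} (hx : x ∈ U) :
    VectorField.mlieBracket 𝓘(ℝ, E4) X Y x = VectorField.mlieBracket 𝓘(ℝ, E4) X Z x :=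
  Filter.EventuallyEq.mlieBracket_vectorField_eq (Filter.EventuallyEq.refl _ _)
    (Filter.eventuallyEq_of_mem (hU.mem_nhds hx) h)

theorem mlieBracket_sum_right (hU : IsOpen U) {ι : Type*} {s : Finset ι} {Y : ι → VField M}
    (hY : ∀ i, SmoothFieldOn (Y i) U) {x : M} (hx : x ∈ U) :
    VectorField.mlieBracket 𝓘(ℝ, E4) X (∑ i ∈ s, Y i) x
      = ∑ i ∈ s, VectorField.mlieBracket 𝓘(ℝ, E4) X (Y i) x := by
  classical
  induction s using Finset.induction_on with
  | empty => simp
  | insert i s hi ih =>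
    rw [Finset.sum_insert hi, Finset.sum_insert hi, VectorField.mlieBracket_add_right, ih]
    · exact (hY i).mdifferentiableAt hU hx
    · exact (SmoothFieldOn.sum hY).mdifferentiableAt hU hx

theorem mlieBracket_smul_bracket (hU : IsOpen U) (hX : SmoothFieldOn X U)
    (hY : SmoothFieldOn Y U) (hZ : SmoothFieldOn Z U) {f : M → ℝ}
    (hf : ContMDiffOn 𝓘(ℝ, E4) 𝓘(ℝ, ℝ) ∞ f U) {x : M} (hx : x ∈ U) :
    VectorField.mlieBracket 𝓘(ℝ, E4) X (VectorField.mlieBracket 𝓘(ℝ, E4) Y (f • Z)) x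
      = mvfderiv 𝓘(ℝ, E4) (fun y => mvfderiv 𝓘(ℝ, E4) f y (Y y)) x (X x) • Z x
        + mvfderiv 𝓘(ℝ, E4) f x (Y x) • VectorField.mlieBracket 𝓘(ℝ, E4) X Z x
        + (mvfderiv 𝓘(ℝ, E4) f x (X x) • VectorField.mlieBracket 𝓘(ℝ, E4) Y Z x
        + f x • VectorField.mlieBracket 𝓘(ℝ, E4) X (VectorField.mlieBracket 𝓘(ℝ, E4) Y Z) x) := by
  have hYf := contMDiffOn_mvfderiv hU hY hf
  have hYZ := SmoothFieldOn.mlieBracket hU hY hZ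
  rw [mlieBracket_congr_right hU (Z := (fun y => mvfderiv 𝓘(ℝ, E4) f y (Y y)) • Z
    + f • VectorField.mlieBracket 𝓘(ℝ, E4) Y Z) (fun y hy => mlieBracket_smul hU hf hZ hy) hx,
    VectorField.mlieBracket_add_right ((hZ.smul hYf).mdifferentiableAt hU hx)
      ((hYZ.smul hf).mdifferentiableAt hU hx), mlieBracket_smul hU hYf hZ hx,
    mlieBracket_smul hU hf hYZ hx]

/-- The bracket of two fields acts on functions as the commutator. -/
theorem mvfderiv_mlieBracket (hU : IsOpen U) (hX : SmoothFieldOn X U)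
    (hY : SmoothFieldOn Y U) (hZ : SmoothFieldOn Z U) {f : M → ℝ}
    (hf : ContMDiffOn 𝓘(ℝ, E4) 𝓘(ℝ, ℝ) ∞ f U) {x : M} (hx : x ∈ U) (hZx : Z x ≠ 0) :
    mvfderiv 𝓘(ℝ, E4) f x (VectorField.mlieBracket 𝓘(ℝ, E4) X Y x)
      = mvfderiv 𝓘(ℝ, E4) (fun y => mvfderiv 𝓘(ℝ, E4) f y (Y y)) x (X x)
        - mvfderiv 𝓘(ℝ, E4) (fun y => mvfderiv 𝓘(ℝ, E4) f y (X y)) x (Y x) := by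
  -- The Jacobi identity for `X`, `Y` and `f • Z` is expanded by Leibniz; after Jacobi for `Z`
  -- itself only a multiple of `Z x` remains, whose coefficient is the claimed identity.
  have h := mlieBracket_jacobi hU hX hY (hZ.smul hf) hx
  rw [mlieBracket_smul_bracket hU hX hY hZ hf hx, mlieBracket_smul_bracket hU hY hX hZ hf hx,
    mlieBracket_smul hU hf hZ hx, mlieBracket_jacobi hU hX hY hZ hx] at h
  refine sub_eq_zero.1 (((smul_eq_zero (R := ℝ) (M := TangentSpace 𝓘(ℝ, E4) x)).1 ?_).resolve_right hZx)
  rw [sub_smul, sub_smul]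
  linear_combination (norm := module) (-1 : ℝ) • h

theorem mvfderiv_mlieBracket_complex (hU : IsOpen U) (hX : SmoothFieldOn X U)
    (hY : SmoothFieldOn Y U) (hZ : SmoothFieldOn Z U) {f : M → ℂ}
    (hf : ContMDiffOn 𝓘(ℝ, E4) 𝓘(ℝ, ℂ) ∞ f U) {x : M} (hx : x ∈ U) (hZx : Z x ≠ 0) :
    mvfderiv 𝓘(ℝ, E4) f x (VectorField.mlieBracket 𝓘(ℝ, E4) X Y x)
      = mvfderiv 𝓘(ℝ, E4) (fun y => mvfderiv 𝓘(ℝ, E4) f y (Y y)) x (X x)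
        - mvfderiv 𝓘(ℝ, E4) (fun y => mvfderiv 𝓘(ℝ, E4) f y (X y)) x (Y x) := by
  have key : ∀ L : ℂ →L[ℝ] ℝ, L (mvfderiv 𝓘(ℝ, E4) f x (VectorField.mlieBracket 𝓘(ℝ, E4) X Y x))
      = L (mvfderiv 𝓘(ℝ, E4) (fun y => mvfderiv 𝓘(ℝ, E4) f y (Y y)) x (X x))
        - L (mvfderiv 𝓘(ℝ, E4) (fun y => mvfderiv 𝓘(ℝ, E4) f y (X y)) x (Y x)) := by
    intro L
    have hLf : ContMDiffOn 𝓘(ℝ, E4) 𝓘(ℝ, ℝ) ∞ (fun y => L (f y)) U :=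
      L.contMDiff.comp_contMDiffOn hf
    have h2 : ∀ {X Y : VField M}, SmoothFieldOn Y U →
        L (mvfderiv 𝓘(ℝ, E4) (fun y => mvfderiv 𝓘(ℝ, E4) f y (Y y)) x (X x))
        = mvfderiv 𝓘(ℝ, E4) (fun y => mvfderiv 𝓘(ℝ, E4) (fun z => L (f z)) y (Y y)) x (X x) := by
      intro X Y hY
      rw [← mvfderiv_clm_apply L
        (mdifferentiableAt_of_smoothOn hU (contMDiffOn_mvfderiv hU hY hf) hx)]
      exact mvfderiv_congr hU (fun y hy =>
        (mvfderiv_clm_apply L (mdifferentiableAt_of_smoothOn hU hf hy) _).symm) hx _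
    rw [← mvfderiv_clm_apply L (mdifferentiableAt_of_smoothOn hU hf hx), h2 hX, h2 hY]
    exact mvfderiv_mlieBracket hU hX hY hZ hLf hx hZx
  refine Complex.ext ?_ ?_
  · exact (key Complex.reCLM).trans (Complex.sub_re _ _).symm
  · exact (key Complex.imCLM).trans (Complex.sub_im _ _).symm

theorem exists_smoothFieldOn_extendVec {x : M} (v : TangentSpace 𝓘(ℝ, E4) x) :
    ∃ V, IsOpen V ∧ x ∈ V ∧ SmoothFieldOn (extendVec v) V := by
  obtain ⟨s, hs, h⟩ := FiberBundle.exists_contMDiffOn_extend (k := ∞) 𝓘(ℝ, E4) E4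
    (V := fun y : M => TangentSpace 𝓘(ℝ, E4) y) v
  obtain ⟨V, hVs, hV, hx⟩ := mem_nhds_iff.1 hs
  exact ⟨V, hV, hx, ContMDiffOn.mono h hVs⟩

theorem extendVec_self {x : M} (v : TangentSpace 𝓘(ℝ, E4) x) : extendVec v x = v := by
  simp [extendVec]

end SmoothFields

end SpinorDiagram

end

noncomputable section

namespace SpinorDiagram

/-! ### The Levi-Civita connection in an orthonormal frame -/

section Frames

variable {M : Type*} [TopologicalSpace M] [ChartedSpace E4 M] [IsManifold 𝓘(ℝ, E4) ∞ M]
  [RiemannianBundle (fun x : M => TangentSpace 𝓘(ℝ, E4) x)]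

/-- A smooth orthonormal frame on an open set. -/
structure OrthonormalFrameOn (e : Fin 4 → VField M) (U : Set M) : Prop where
  isOpen : IsOpen U
  smooth : ∀ a, SmoothFieldOn (e a) U
  orthonormal : ∀ x ∈ U, Orthonormal ℝ (fun a => e a x)

/-- The structure functions of a frame. -/
def frameBracket (e : Fin 4 → VField M) (a b c : Fin 4) (x : M) : ℝ :=
  inner ℝ (e c x) (VectorField.mlieBracket 𝓘(ℝ, E4) (e a) (e b) x)

/-- The connection coefficients of a frame. -/
def frameCoef (e : Fin 4 → VField M) (a c b : Fin 4) (x : M) : ℝ :=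
  (frameBracket e a b c x - frameBracket e b c a x + frameBracket e c a b x) / 2

theorem frameBracket_swap (e : Fin 4 → VField M) (a b c : Fin 4) (x : M) :
    frameBracket e a b c x = -frameBracket e b a c x := by
  rw [frameBracket, VectorField.mlieBracket_swap_apply, inner_neg_right]
  rfl

theorem frameCoef_skew (e : Fin 4 → VField M) (a c b : Fin 4) (x : M) :
    frameCoef e a c b x = -frameCoef e a b c x := by
  simp only [frameCoef]
  rw [frameBracket_swap e a c b, frameBracket_swap e c b a, frameBracket_swap e b a c]
  ring

/-- Torsion-freeness of the Koszul coefficients; their skewness `frameCoef_skew` is the metric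
property. -/
theorem frameCoef_sub (e : Fin 4 → VField M) (a b c : Fin 4) (x : M) :
    frameCoef e a c b x - frameCoef e b c a x = frameBracket e a b c x := by
  simp only [frameCoef]
  rw [frameBracket_swap e b a c, frameBracket_swap e a c b, frameBracket_swap e c b a]
  ring

/-- The curvature `⟨R(e_a, e_b) e_c, e_d⟩` in terms of the connection coefficients. -/
def frameRiem (e : Fin 4 → VField M) (a b d c : Fin 4) (x : M) : ℝ :=
  mvfderiv 𝓘(ℝ, E4) (frameCoef e b d c) x (e a x) - mvfderiv 𝓘(ℝ, E4) (frameCoef e a d c) x (e b x)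
    + ∑ f, (frameCoef e a d f x * frameCoef e b f c x - frameCoef e b d f x * frameCoef e a f c x)
    - ∑ f, (frameCoef e a f b x - frameCoef e b f a x) * frameCoef e f d c x

/-- The curvature in the frame at a point. -/
def riemAt (e : Fin 4 → VField M) (x : M) : Fin 4 → Fin 4 → Fin 4 → Fin 4 → ℝ :=
  fun a b d c => frameRiem e a b d c x

theorem contMDiffOn_ofReal {U : Set M} {f : M → ℝ} (hf : ContMDiffOn 𝓘(ℝ, E4) 𝓘(ℝ, ℝ) ∞ f U) :
    ContMDiffOn 𝓘(ℝ, E4) 𝓘(ℝ, ℂ) ∞ (fun x => (f x : ℂ)) U :=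
  Complex.ofRealCLM.contMDiff.comp_contMDiffOn hf

/-- A smooth real function, as an element of the ring of smooth complex functions. -/
def realSmooth {U : Set M} (f : M → ℝ) (hf : ContMDiffOn 𝓘(ℝ, E4) 𝓘(ℝ, ℝ) ∞ f U) :
    smoothRing U ℂ := toSmooth (fun x => (f x : ℂ)) (contMDiffOn_ofReal hf)

theorem realSmooth_apply {U : Set M} (f : M → ℝ) (hf : ContMDiffOn 𝓘(ℝ, E4) 𝓘(ℝ, ℝ) ∞ f U)
    (x : U) : (realSmooth f hf).1 x = (f x : ℂ) := rfl

theorem fieldDerivation_realSmooth {U : Set M} (hU : IsOpen U) {X : VField M}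
    (hX : SmoothFieldOn X U) {f : M → ℝ} (hf : ContMDiffOn 𝓘(ℝ, E4) 𝓘(ℝ, ℝ) ∞ f U) (x : U) :
    (fieldDerivation ℂ hU X hX (realSmooth f hf)).1 x
      = (mvfderiv 𝓘(ℝ, E4) f x (X x) : ℝ) := by
  rw [fieldDerivation_apply hU hX _ (g := fun y => (f y : ℂ)) (fun y => rfl)]
  exact mvfderiv_clm_apply Complex.ofRealCLM (mdifferentiableAt_of_smoothOn hU hf x.2) _

namespace OrthonormalFrameOn

variable {e : Fin 4 → VField M} {U : Set M} {X Y Z : VField M}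

theorem mono (F : OrthonormalFrameOn e U) {V : Set M} (hV : IsOpen V) (h : V ⊆ U) :
    OrthonormalFrameOn e V :=
  ⟨hV, fun a => (F.smooth a).mono h, fun x hx => F.orthonormal x (h hx)⟩

/-- The frame at a point, as an orthonormal basis. -/
def basis (F : OrthonormalFrameOn e U) {x : M} (hx : x ∈ U) :
    OrthonormalBasis (Fin 4) ℝ (TangentSpace 𝓘(ℝ, E4) x) :=
  (basisOfOrthonormalOfCardEqFinrank (F.orthonormal x hx)
    (by rw [finrank_tangentSpace, Fintype.card_fin])).toOrthonormalBasis (by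
      rw [coe_basisOfOrthonormalOfCardEqFinrank]; exact F.orthonormal x hx)

theorem basis_apply (F : OrthonormalFrameOn e U) {x : M} (hx : x ∈ U) (a : Fin 4) :
    F.basis hx a = e a x := by
  simp [basis]

theorem expand (F : OrthonormalFrameOn e U) {x : M} (hx : x ∈ U) (v : TangentSpace 𝓘(ℝ, E4) x) :
    v = ∑ a, inner ℝ (e a x) v • e a x := by
  have h := (F.basis hx).sum_repr' v
  simp only [basis_apply] at h
  exact h.symm

theorem inner_eq (F : OrthonormalFrameOn e U) {x : M} (hx : x ∈ U)
    (v w : TangentSpace 𝓘(ℝ, E4) x) :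
    inner ℝ v w = ∑ a, inner ℝ (e a x) v * inner ℝ (e a x) w := by
  have h := (F.basis hx).sum_inner_mul_inner v w
  simp only [basis_apply] at h
  rw [← h]
  exact Finset.sum_congr rfl fun a _ => by rw [real_inner_comm]

theorem inner_frame (F : OrthonormalFrameOn e U) {x : M} (hx : x ∈ U) (a b : Fin 4) :
    inner ℝ (e a x) (e b x) = if a = b then (1 : ℝ) else 0 :=
  orthonormal_iff_ite.1 (F.orthonormal x hx) a b

theorem mvfderiv_expand (F : OrthonormalFrameOn e U) {x : M} (hx : x ∈ U)
    {W : Type*} [NormedAddCommGroup W] [NormedSpace ℝ W]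
    (f : M → W) (v : TangentSpace 𝓘(ℝ, E4) x) :
    mvfderiv 𝓘(ℝ, E4) f x v = ∑ a, inner ℝ (e a x) v • mvfderiv 𝓘(ℝ, E4) f x (e a x) := by
  conv_lhs => rw [F.expand hx v]
  rw [map_sum]
  exact Finset.sum_congr rfl fun a _ => map_smul _ _ _

end OrthonormalFrameOn

variable [IsContMDiffRiemannianBundle 𝓘(ℝ, E4) ∞ E4 (fun x : M => TangentSpace 𝓘(ℝ, E4) x)]

theorem SmoothFieldOn.inner {U : Set M} {X Y : VField M} (hX : SmoothFieldOn X U)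
    (hY : SmoothFieldOn Y U) :
    ContMDiffOn 𝓘(ℝ, E4) 𝓘(ℝ, ℝ) ∞ (fun x => inner ℝ (X x) (Y x)) U :=
  ContMDiffOn.inner_bundle (E := fun x : M => TangentSpace 𝓘(ℝ, E4) x) hX hY

namespace OrthonormalFrameOn

variable {e : Fin 4 → VField M} {U : Set M} {X Y Z : VField M}

theorem smooth_bracket (F : OrthonormalFrameOn e U) (a b c : Fin 4) :
    ContMDiffOn 𝓘(ℝ, E4) 𝓘(ℝ, ℝ) ∞ (frameBracket e a b c) U :=
  (F.smooth c).inner (SmoothFieldOn.mlieBracket F.isOpen (F.smooth a) (F.smooth b))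

theorem smooth_coef (F : OrthonormalFrameOn e U) (a b c : Fin 4) :
    ContMDiffOn 𝓘(ℝ, E4) 𝓘(ℝ, ℝ) ∞ (frameCoef e a b c) U := by
  have h := contMDiffOn_mul (((F.smooth_bracket a c b).sub (F.smooth_bracket c b a)).add
    (F.smooth_bracket b a c)) (contMDiffOn_const (c := (1 / 2 : ℝ)))
  exact h.congr fun x _ => by simp [frameCoef, div_eq_mul_inv]

theorem mlieBracket_frame (F : OrthonormalFrameOn e U) (hX : SmoothFieldOn X U)
    (hY : SmoothFieldOn Y U) {x : M} (hx : x ∈ U) :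
    VectorField.mlieBracket 𝓘(ℝ, E4) X Y x
      = ∑ b, (mvfderiv 𝓘(ℝ, E4) (fun y => inner ℝ (e b y) (Y y)) x (X x) • e b x
        + inner ℝ (e b x) (Y x) • VectorField.mlieBracket 𝓘(ℝ, E4) X (e b) x) := by
  have hc : ∀ b, ContMDiffOn 𝓘(ℝ, E4) 𝓘(ℝ, ℝ) ∞ (fun y => inner ℝ (e b y) (Y y)) U :=
    fun b => (F.smooth b).inner hY
  rw [mlieBracket_congr_right F.isOpen (Z := ∑ b, (fun y => inner ℝ (e b y) (Y y)) • e b)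
    (fun y hy => by rw [Finset.sum_apply]; exact F.expand hy (Y y)) hx,
    mlieBracket_sum_right F.isOpen (fun b => (F.smooth b).smul (hc b)) hx]
  exact Finset.sum_congr rfl fun b _ => mlieBracket_smul F.isOpen (hc b) (F.smooth b) hx

theorem inner_mlieBracket (F : OrthonormalFrameOn e U) (hX : SmoothFieldOn X U)
    (hY : SmoothFieldOn Y U) {x : M} (hx : x ∈ U) (c : Fin 4) :
    inner ℝ (e c x) (VectorField.mlieBracket 𝓘(ℝ, E4) X Y x)
      = mvfderiv 𝓘(ℝ, E4) (fun y => inner ℝ (e c y) (Y y)) x (X x)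
        - mvfderiv 𝓘(ℝ, E4) (fun y => inner ℝ (e c y) (X y)) x (Y x)
        + ∑ a, ∑ b, inner ℝ (e a x) (X x) * inner ℝ (e b x) (Y x) * frameBracket e a b c x := by
  -- One argument is expanded in the frame at a time; skew-symmetry of the bracket then treats the
  -- other.
  have hone : ∀ {X Y : VField M}, SmoothFieldOn X U → SmoothFieldOn Y U →
      inner ℝ (e c x) (VectorField.mlieBracket 𝓘(ℝ, E4) X Y x)
      = mvfderiv 𝓘(ℝ, E4) (fun y => inner ℝ (e c y) (Y y)) x (X x)
        + ∑ b, inner ℝ (e b x) (Y x)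
          * inner ℝ (e c x) (VectorField.mlieBracket 𝓘(ℝ, E4) X (e b) x) := by
    intro X Y hX hY
    rw [F.mlieBracket_frame hX hY hx, inner_sum]
    simp only [inner_add_right, inner_smul_right, F.inner_frame hx, Finset.sum_add_distrib]
    simp
  rw [hone hX hY, F.mvfderiv_expand hx _ (Y x)]
  have h2 : ∀ b, inner ℝ (e c x) (VectorField.mlieBracket 𝓘(ℝ, E4) X (e b) x)
      = -mvfderiv 𝓘(ℝ, E4) (fun y => inner ℝ (e c y) (X y)) x (e b x)
        + ∑ a, inner ℝ (e a x) (X x) * frameBracket e a b c x := by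
    intro b
    rw [VectorField.mlieBracket_swap_apply, inner_neg_right, hone (F.smooth b) hX, neg_add,
      ← Finset.sum_neg_distrib]
    refine congrArg (_ + ·) (Finset.sum_congr rfl fun a _ => ?_)
    rw [frameBracket_swap e a b c]
    simp [frameBracket]
  simp only [h2, mul_add, Finset.sum_add_distrib, smul_eq_mul, mul_neg, Finset.sum_neg_distrib,
    Finset.mul_sum]
  rw [Finset.sum_comm (f := fun b a => inner ℝ (e b x) (Y x)
    * (inner ℝ (e a x) (X x) * frameBracket e a b c x)), sub_eq_add_neg, add_assoc]
  exact congrArg (_ + ·) (congrArg (_ + ·) (Finset.sum_congr rfl fun a _ =>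
    Finset.sum_congr rfl fun b _ => by ring))

/-- The Levi-Civita connection, acting on complex functions. -/
def conn (F : OrthonormalFrameOn e U) : FrameConnection (smoothRing U ℂ) where
  deriv a := fieldDerivation ℂ F.isOpen (e a) (F.smooth a)
  coef a b c := realSmooth (frameCoef e a b c) (F.smooth_coef a b c)
  coef_skew a b c := smoothRing_ext fun x => by
    simp only [Subalgebra.coe_neg, Pi.neg_apply, realSmooth_apply, frameCoef_skew e a b c,
      Complex.ofReal_neg]
  torsion_free a b f := smoothRing_ext fun x => by
    -- The frame vector `e 0` is the auxiliary nowhere vanishing field.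
    have h := mvfderiv_mlieBracket_complex F.isOpen (F.smooth a) (F.smooth b) (F.smooth 0) f.2 x.2
      ((F.orthonormal x x.2).ne_zero 0)
    rw [F.mvfderiv_expand x.2] at h
    have h2 : ∀ a b, (fieldDerivation ℂ F.isOpen (e a) (F.smooth a)
        (fieldDerivation ℂ F.isOpen (e b) (F.smooth b) f)).1 x = mvfderiv 𝓘(ℝ, E4)
          (fun y => mvfderiv 𝓘(ℝ, E4) (extendZero ℂ f.1) y (e b y)) x (e a x) := fun a b =>
      fieldDerivation_apply F.isOpen (F.smooth a) _ (fun y => rfl) x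
    rw [Subalgebra.coe_sub, Pi.sub_apply, h2, h2, ← h]
    simp only [AddSubmonoidClass.coe_finsetSum, Finset.sum_apply, Subalgebra.coe_mul,
      Subalgebra.coe_sub, Pi.mul_apply, Pi.sub_apply, realSmooth_apply]
    refine Finset.sum_congr rfl fun c _ => ?_
    rw [← Complex.ofReal_sub, frameCoef_sub, Complex.real_smul]
    rfl

theorem conn_coef_apply (F : OrthonormalFrameOn e U) (a b c : Fin 4) (x : U) :
    (F.conn.coef a b c).1 x = frameCoef e a b c x := rfl

theorem conn_curv_apply (F : OrthonormalFrameOn e U) (a b d c : Fin 4) (x : U) :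
    (F.conn.curv a b d c).1 x = frameRiem e a b d c x := by
  have h : ∀ a b c d, ((F.conn.deriv a) (F.conn.coef b c d)).1 x
      = (mvfderiv 𝓘(ℝ, E4) (frameCoef e b c d) x (e a x) : ℝ) :=
    fun a b c d => fieldDerivation_realSmooth F.isOpen (F.smooth a) (F.smooth_coef b c d) x
  simp only [FrameConnection.curv, frameRiem, AddSubmonoidClass.coe_finsetSum, Finset.sum_apply,
    Subalgebra.coe_mul, Subalgebra.coe_sub, Subalgebra.coe_add, Pi.mul_apply, Pi.sub_apply,
    Pi.add_apply, h, conn_coef_apply]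
  push_cast
  rfl

/-- The components of a smooth field. -/
def comp (F : OrthonormalFrameOn e U) (hX : SmoothFieldOn X U) (a : Fin 4) : smoothRing U ℂ :=
  realSmooth (fun x => inner ℝ (e a x) (X x)) ((F.smooth a).inner hX)

theorem comp_apply (F : OrthonormalFrameOn e U) (hX : SmoothFieldOn X U) (a : Fin 4) (x : U) :
    (F.comp hX a).1 x = (inner ℝ (e a x) (X x) : ℝ) := rfl

theorem comp_frame (F : OrthonormalFrameOn e U) (a : Fin 4) :
    F.comp (F.smooth a) = Pi.single a 1 := by
  funext b
  refine smoothRing_ext fun x => ?_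
  rw [comp_apply, F.inner_frame x.2]
  by_cases h : b = a
  · subst h; simp
  · simp [h]

theorem dir_comp (F : OrthonormalFrameOn e U) (hX : SmoothFieldOn X U) (f : smoothRing U ℂ) :
    F.conn.dir (F.comp hX) f = fieldDerivation ℂ F.isOpen X hX f := by
  refine smoothRing_ext fun x => ?_
  rw [fieldDerivation_apply', F.mvfderiv_expand x.2, FrameConnection.dir_apply]
  simp only [AddSubmonoidClass.coe_finsetSum, Finset.sum_apply, Subalgebra.coe_mul, Pi.mul_apply,
    Complex.real_smul]
  rfl

theorem dir_comp_apply (F : OrthonormalFrameOn e U) (hX : SmoothFieldOn X U) (f : smoothRing U ℂ)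
    {g : M → ℝ} (hg : ContMDiffOn 𝓘(ℝ, E4) 𝓘(ℝ, ℝ) ∞ g U) (h : ∀ x : U, f.1 x = g x) (x : U) :
    (F.conn.dir (F.comp hX) f).1 x = (mvfderiv 𝓘(ℝ, E4) g x (X x) : ℝ) := by
  have : f = realSmooth g hg := smoothRing_ext h
  rw [dir_comp, this]
  exact fieldDerivation_realSmooth F.isOpen hX hg x

theorem comp_mlieBracket (F : OrthonormalFrameOn e U) (hX : SmoothFieldOn X U)
    (hY : SmoothFieldOn Y U) :
    F.comp (SmoothFieldOn.mlieBracket F.isOpen hX hY)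
      = F.conn.bracket (F.comp hX) (F.comp hY) := by
  funext c
  refine smoothRing_ext fun x => ?_
  rw [comp_apply, F.inner_mlieBracket hX hY x.2]
  simp only [FrameConnection.bracket, FrameConnection.nab, Subalgebra.coe_sub, Subalgebra.coe_add,
    Pi.sub_apply, Pi.add_apply]
  rw [F.dir_comp_apply hX _ ((F.smooth c).inner hY) (fun _ => rfl),
    F.dir_comp_apply hY _ ((F.smooth c).inner hX) (fun _ => rfl)]
  simp only [FrameConnection.form, AddSubmonoidClass.coe_finsetSum, Finset.sum_apply,
    Subalgebra.coe_mul, Pi.mul_apply, conn_coef_apply, comp_apply, Finset.sum_mul]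
  rw [Finset.sum_comm (f := fun b a : Fin 4 =>
    ((inner ℝ (e a x) (X x) : ℝ) : ℂ) * (frameCoef e a c b x : ℂ) * (inner ℝ (e b x) (Y x) : ℝ))]
  simp only [← frameCoef_sub]
  push_cast
  simp only [mul_sub, Finset.sum_sub_distrib]
  have h1 : ∀ a b : Fin 4, ((inner ℝ (e a x) (Y x) : ℝ) : ℂ) * (frameCoef e a c b x : ℂ)
      * (inner ℝ (e b x) (X x) : ℝ)
      = ((inner ℝ (e b x) (X x) : ℝ) : ℂ) * (inner ℝ (e a x) (Y x) : ℝ)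
        * (frameCoef e a c b x : ℂ) := fun a b => by ring
  have h2 : ∀ a b : Fin 4, ((inner ℝ (e a x) (X x) : ℝ) : ℂ) * (frameCoef e a c b x : ℂ)
      * (inner ℝ (e b x) (Y x) : ℝ)
      = ((inner ℝ (e a x) (X x) : ℝ) : ℂ) * (inner ℝ (e b x) (Y x) : ℝ)
        * (frameCoef e a c b x : ℂ) := fun a b => by ring
  simp only [h1, h2]
  ring

theorem inner_comp (F : OrthonormalFrameOn e U) (hX : SmoothFieldOn X U) (hY : SmoothFieldOn Y U)
    (x : U) : (∑ c, F.comp hX c * F.comp hY c).1 x = (inner ℝ (X x) (Y x) : ℝ) := by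
  rw [F.inner_eq x.2]
  simp only [AddSubmonoidClass.coe_finsetSum, Finset.sum_apply, Subalgebra.coe_mul, Pi.mul_apply,
    comp_apply]
  push_cast
  rfl

theorem koszul_eq (F : OrthonormalFrameOn e U) (hX : SmoothFieldOn X U) (hY : SmoothFieldOn Y U)
    (hZ : SmoothFieldOn Z U) (x : U) :
    ((koszul X Y Z x : ℝ) : ℂ)
      = (∑ c, F.conn.nab (F.comp hX) (F.comp hY) c * F.comp hZ c).1 x := by
  have hd : ∀ {X Y Z : VField M} (hX : SmoothFieldOn X U) (hY : SmoothFieldOn Y U)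
      (hZ : SmoothFieldOn Z U),
      ((mvfderiv 𝓘(ℝ, E4) (fun y => inner ℝ (Y y) (Z y)) x (X x) : ℝ) : ℂ)
      = (F.conn.dir (F.comp hX) (∑ c, F.comp hY c * F.comp hZ c)).1 x := fun hX hY hZ =>
    (F.dir_comp_apply hX _ (hY.inner hZ) (F.inner_comp hY hZ) x).symm
  have hb : ∀ {X Y Z : VField M} (hX : SmoothFieldOn X U) (hY : SmoothFieldOn Y U)
      (hZ : SmoothFieldOn Z U),
      ((inner ℝ (VectorField.mlieBracket 𝓘(ℝ, E4) X Y x) (Z x) : ℝ) : ℂ)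
      = (∑ c, F.conn.bracket (F.comp hX) (F.comp hY) c * F.comp hZ c).1 x := by
    intro X Y Z hX hY hZ
    rw [← F.comp_mlieBracket hX hY, F.inner_comp]
  -- The usual uniqueness computation for the Levi-Civita connection: by metric compatibility and
  -- the definition of the bracket, all but two equal terms cancel.
  have key : F.conn.dir (F.comp hX) (∑ c, F.comp hY c * F.comp hZ c)
      + F.conn.dir (F.comp hY) (∑ c, F.comp hZ c * F.comp hX c)
      - F.conn.dir (F.comp hZ) (∑ c, F.comp hX c * F.comp hY c)
      + ∑ c, F.conn.bracket (F.comp hX) (F.comp hY) c * F.comp hZ c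
      - ∑ c, F.conn.bracket (F.comp hY) (F.comp hZ) c * F.comp hX c
      + ∑ c, F.conn.bracket (F.comp hZ) (F.comp hX) c * F.comp hY c
      = 2 * ∑ c, F.conn.nab (F.comp hX) (F.comp hY) c * F.comp hZ c := by
    simp only [FrameConnection.dir_inner, FrameConnection.bracket, sub_mul,
      Finset.sum_sub_distrib, mul_comm (F.comp _ _) (F.conn.nab _ _ _)]
    ring
  have key' := congrArg (fun f : smoothRing U ℂ => f.1 x) key
  simp only [Subalgebra.coe_add, Subalgebra.coe_sub, Subalgebra.coe_mul, Pi.add_apply,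
    Pi.sub_apply, Pi.mul_apply] at key'
  rw [koszul]
  simp only [Complex.ofReal_div, Complex.ofReal_add, Complex.ofReal_sub, Complex.ofReal_ofNat]
  rw [hd hX hY hZ, hd hY hZ hX, hd hZ hX hY, hb hX hY hZ, hb hY hZ hX, hb hZ hX hY, key']
  exact mul_div_cancel_left₀ _ two_ne_zero

/-- The components of the covariant derivative, as real functions. -/
theorem nab_apply (F : OrthonormalFrameOn e U) (hX : SmoothFieldOn X U) (hY : SmoothFieldOn Y U)
    (c : Fin 4) (x : U) :
    (F.conn.nab (F.comp hX) (F.comp hY) c).1 x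
      = ((mvfderiv 𝓘(ℝ, E4) (fun y => inner ℝ (e c y) (Y y)) x (X x)
        + ∑ b, (∑ a, inner ℝ (e a x) (X x) * frameCoef e a c b x) * inner ℝ (e b x) (Y x) : ℝ)
        : ℂ) := by
  simp only [FrameConnection.nab, Subalgebra.coe_add, Pi.add_apply]
  rw [F.dir_comp_apply hX _ ((F.smooth c).inner hY) (fun _ => rfl)]
  simp only [FrameConnection.form, AddSubmonoidClass.coe_finsetSum, Finset.sum_apply,
    Subalgebra.coe_mul, Pi.mul_apply, conn_coef_apply, comp_apply]
  push_cast
  rfl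

theorem nabla_eq (F : OrthonormalFrameOn e U) (hX : SmoothFieldOn X U) (hY : SmoothFieldOn Y U)
    (x : U) : nabla X Y x = ∑ c, ((F.conn.nab (F.comp hX) (F.comp hY) c).1 x).re • e c x := by
  set f : Fin 4 → ℝ := fun c => mvfderiv 𝓘(ℝ, E4) (fun y => inner ℝ (e c y) (Y y)) x (X x)
        + ∑ b, (∑ a, inner ℝ (e a x) (X x) * frameCoef e a c b x) * inner ℝ (e b x) (Y x) with hf
  have hk : ∀ v : TangentSpace 𝓘(ℝ, E4) x.1, koszul X Y (extendVec v) x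
      = ∑ c, f c * inner ℝ (e c x) v := by
    intro v
    -- The extension of `v` is smooth only near `x`, so the frame is restricted. Koszul's expression
    -- turns out to depend on `v` alone, and summing over `onb` then reassembles the vector.
    obtain ⟨V, hV, hxV, hv⟩ := exists_smoothFieldOn_extendVec v
    have F' := F.mono (F.isOpen.inter hV) Set.inter_subset_left
    have h := F'.koszul_eq (hX.mono Set.inter_subset_left) (hY.mono Set.inter_subset_left)
      (hv.mono Set.inter_subset_right) ⟨x, x.2, hxV⟩
    simp only [AddSubmonoidClass.coe_finsetSum, Finset.sum_apply, Subalgebra.coe_mul,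
      Pi.mul_apply, nab_apply, comp_apply, extendVec_self] at h
    exact_mod_cast h
  simp only [nabla, hk, nab_apply, Complex.ofReal_re]
  rw [Finset.sum_congr rfl fun i _ => Finset.sum_smul, Finset.sum_comm]
  refine Finset.sum_congr rfl fun c _ => ?_
  simp only [mul_smul, ← Finset.smul_sum]
  have h := (onb x.1).sum_repr' (e c x)
  simp only [real_inner_comm (e c x)] at h
  rw [h]

theorem smooth_nabla (F : OrthonormalFrameOn e U) (hX : SmoothFieldOn X U)
    (hY : SmoothFieldOn Y U) : SmoothFieldOn (nabla X Y) U := by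
  have h : ∀ c, ContMDiffOn 𝓘(ℝ, E4) 𝓘(ℝ, ℝ) ∞
      (fun x => (extendZero ℂ (F.conn.nab (F.comp hX) (F.comp hY) c).1 x).re) U := fun c =>
    Complex.reCLM.contMDiff.comp_contMDiffOn (F.conn.nab (F.comp hX) (F.comp hY) c).2
  refine (SmoothFieldOn.sum (s := Finset.univ) fun c => (F.smooth c).smul (h c)).congr
    fun x hx => ?_
  rw [F.nabla_eq hX hY ⟨x, hx⟩, Finset.sum_apply]
  refine Finset.sum_congr rfl fun c _ => ?_
  exact congrArg (fun r : ℂ => r.re • e c x) (extendZero_apply _ ⟨x, hx⟩).symm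

theorem comp_nabla (F : OrthonormalFrameOn e U) (hX : SmoothFieldOn X U)
    (hY : SmoothFieldOn Y U) :
    F.comp (F.smooth_nabla hX hY) = F.conn.nab (F.comp hX) (F.comp hY) := by
  funext c
  refine smoothRing_ext fun x => ?_
  rw [comp_apply, F.nabla_eq hX hY x, inner_sum]
  simp only [inner_smul_right, F.inner_frame x.2, nab_apply, Complex.ofReal_re]
  simp

theorem inner_nabla_frame (F : OrthonormalFrameOn e U) (a b c : Fin 4) {x : M} (hx : x ∈ U) :
    inner ℝ (e b x) (nabla (e a) (e c) x) = frameCoef e a b c x := by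
  have h : (F.comp (F.smooth_nabla (F.smooth a) (F.smooth c)) b).1 ⟨x, hx⟩
      = (F.conn.coef a b c).1 ⟨x, hx⟩ := by
    refine congrArg (fun f : smoothRing U ℂ => f.1 ⟨x, hx⟩) ?_
    rw [F.comp_nabla (F.smooth a) (F.smooth c), comp_frame, comp_frame, FrameConnection.nab]
    rw [Finset.sum_eq_single c (fun i _ hi => by simp [Pi.single_apply, hi]) (by simp)]
    rw [FrameConnection.form, Finset.sum_eq_single a (fun i _ hi => by simp [Pi.single_apply, hi])
      (by simp)]
    by_cases hbc : b = c
    · subst hbc; simp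
    · simp [hbc]
  rw [comp_apply, conn_coef_apply] at h
  exact_mod_cast h

theorem inner_curvatureField (F : OrthonormalFrameOn e U) (hX : SmoothFieldOn X U)
    (hY : SmoothFieldOn Y U) (hZ : SmoothFieldOn Z U) (d : Fin 4) {x : M} (hx : x ∈ U) :
    inner ℝ (e d x) (curvatureField X Y Z x)
      = ∑ c, ∑ a, ∑ b, inner ℝ (e a x) (X x) * inner ℝ (e b x) (Y x) * inner ℝ (e c x) (Z x)
        * frameRiem e a b d c x := by
  have h := congrArg (fun f : smoothRing U ℂ => f.1 ⟨x, hx⟩)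
    (F.conn.nab_commutator (F.comp hX) (F.comp hY) (F.comp hZ) d)
  rw [← F.comp_nabla hY hZ, ← F.comp_nabla hX hZ, ← F.comp_mlieBracket hX hY, ← F.comp_nabla,
    ← F.comp_nabla, ← F.comp_nabla] at h
  simp only [FrameConnection.curvForm_eq, Subalgebra.coe_sub, Pi.sub_apply,
    AddSubmonoidClass.coe_finsetSum, Finset.sum_apply, Subalgebra.coe_mul, Pi.mul_apply,
    comp_apply, conn_curv_apply] at h
  simp only [curvatureField, Pi.sub_apply, inner_sub_right]
  apply Complex.ofReal_injective
  push_cast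
  rw [h]
  refine Finset.sum_congr rfl fun c _ => ?_
  simp only [Finset.sum_mul]
  exact Finset.sum_congr rfl fun a _ => Finset.sum_congr rfl fun b _ => by ring

theorem riem_eq (F : OrthonormalFrameOn e U) {x : M} (hx : x ∈ U)
    (u v w z : TangentSpace 𝓘(ℝ, E4) x) :
    riem x u v w z = ∑ a, ∑ b, ∑ c, ∑ d, inner ℝ (e a x) u * inner ℝ (e b x) v
      * inner ℝ (e c x) w * inner ℝ (e d x) z * frameRiem e a b d c x := by
  obtain ⟨Vu, hVu, hxu, hu⟩ := exists_smoothFieldOn_extendVec u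
  obtain ⟨Vv, hVv, hxv, hv⟩ := exists_smoothFieldOn_extendVec v
  obtain ⟨Vw, hVw, hxw, hw⟩ := exists_smoothFieldOn_extendVec w
  -- On this neighbourhood all three extensions are smooth; by tensoriality only their values at `x`
  -- matter.
  have F' := F.mono (F.isOpen.inter (hVu.inter (hVv.inter hVw))) Set.inter_subset_left
  have hx' : x ∈ U ∩ (Vu ∩ (Vv ∩ Vw)) := ⟨hx, hxu, hxv, hxw⟩
  rw [riem, F.inner_eq hx]
  have h := fun d => F'.inner_curvatureField (hu.mono fun y hy => hy.2.1)
    (hv.mono fun y hy => hy.2.2.1) (hw.mono fun y hy => hy.2.2.2) d hx'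
  simp only [extendVec_self] at h
  simp only [h, Finset.sum_mul]
  rw [Finset.sum_comm]
  rw [Finset.sum_congr rfl fun c _ => Finset.sum_comm, Finset.sum_comm]
  refine Finset.sum_congr rfl fun a _ => ?_
  rw [Finset.sum_congr rfl fun c _ => Finset.sum_congr rfl fun d _ => rfl]
  rw [Finset.sum_congr rfl fun c _ => Finset.sum_comm, Finset.sum_comm]
  exact Finset.sum_congr rfl fun b _ => Finset.sum_congr rfl fun c _ =>
    Finset.sum_congr rfl fun d _ => by ring

theorem frameRiem_skew (F : OrthonormalFrameOn e U) {x : M} (hx : x ∈ U) (a b c d : Fin 4) :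
    frameRiem e a b c d x = -frameRiem e a b d c x := by
  have h := congrArg (fun f : smoothRing U ℂ => f.1 ⟨x, hx⟩) (F.conn.curv_skew a b c d)
  simp only [Subalgebra.coe_neg, Pi.neg_apply, conn_curv_apply] at h
  exact_mod_cast h

theorem frameRiem_swap (F : OrthonormalFrameOn e U) {x : M} (hx : x ∈ U) (a b c d : Fin 4) :
    frameRiem e a b c d x = -frameRiem e b a c d x := by
  have h := congrArg (fun f : smoothRing U ℂ => f.1 ⟨x, hx⟩) (F.conn.curv_swap a b c d)
  simp only [Subalgebra.coe_neg, Pi.neg_apply, conn_curv_apply] at h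
  exact_mod_cast h

theorem frameRiem_cyclic (F : OrthonormalFrameOn e U) {x : M} (hx : x ∈ U) (a b c d : Fin 4) :
    frameRiem e a b d c x + frameRiem e b c d a x + frameRiem e c a d b x = 0 := by
  have h := congrArg (fun f : smoothRing U ℂ => f.1 ⟨x, hx⟩)
    (F.conn.curv_cyclic (a := a) (b := b) (c := c) d (by
      have hb := fun a b => SmoothFieldOn.mlieBracket F.isOpen (F.smooth a) (F.smooth b)
      simp only [← F.comp_frame, ← F.comp_mlieBracket]
      refine smoothRing_ext fun y => ?_
      have hj := mlieBracket_jacobi F.isOpen (F.smooth a) (F.smooth b) (F.smooth c) y.2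
      -- This converts the Leibniz form of the Jacobi identity to its cyclic form.
      have h1 : VectorField.mlieBracket 𝓘(ℝ, E4) (e b)
          (VectorField.mlieBracket 𝓘(ℝ, E4) (e c) (e a)) y
          = -VectorField.mlieBracket 𝓘(ℝ, E4) (e b)
            (VectorField.mlieBracket 𝓘(ℝ, E4) (e a) (e c)) y := by
        rw [VectorField.mlieBracket_swap (V := e c) (W := e a),
          ← neg_one_smul ℝ (VectorField.mlieBracket 𝓘(ℝ, E4) (e a) (e c)),
          VectorField.mlieBracket_const_smul_right ((hb a c).mdifferentiableAt F.isOpen y.2),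
          neg_one_smul]
      simp only [Subalgebra.coe_add, Pi.add_apply, comp_apply]
      rw [h1, hj, VectorField.mlieBracket_swap_apply (V := e c), inner_add_right, inner_neg_right,
        inner_neg_right]
      push_cast
      simp))
  simp only [Subalgebra.coe_add, Pi.add_apply, conn_curv_apply, ZeroMemClass.coe_zero,
    Pi.zero_apply] at h
  exact_mod_cast h

end OrthonormalFrameOn

end Frames

end SpinorDiagram

end

noncomputable section

namespace SpinorDiagram

/-! ### The commutator as a curvature operator -/

section CurvatureOperator

open MvPolynomial

/-- Linearity over the coefficients is what permits evaluation at a point. The curvature has it; the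
covariant derivative does not. -/
theorem map_derivation {σ K L : Type*} [CommRing K] [CommRing L] (φ : K →+* L)
    (D : Derivation K (MvPolynomial σ K) (MvPolynomial σ K))
    (D' : Derivation L (MvPolynomial σ L) (MvPolynomial σ L))
    (h : ∀ i, map φ (D (X i)) = D' (X i)) (p : MvPolynomial σ K) :
    map φ (D p) = D' (map φ p) := by
  induction p using MvPolynomial.induction_on with
  | C c => simp
  | add p q hp hq => simp [hp, hq]
  | mul_X p i hp => simp [hp, h]

/-- The curvature, acting as a derivation on polynomials. -/
def pointCurvPoly (R : Fin 4 → Fin 4 → Fin 4 → Fin 4 → ℝ) (a b : Fin 4) :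
    Derivation ℂ (SpinorPoly ℂ) (SpinorPoly ℂ) :=
  mkDerivation ℂ (Sum.elim (fun B => ∑ A, C (liftPlus (R a b) A B) * xi A)
    (fun B => ∑ A, C (liftMinus (R a b) A B) * eta A))

/-- The curvature, contracted with the primed variables. -/
def curvOp (R : Fin 4 → Fin 4 → Fin 4 → Fin 4 → ℝ) :
    Derivation ℂ (SpinorPoly ℂ) (SpinorPoly ℂ) :=
  ∑ a, ∑ b, (asdPoly a b : SpinorPoly ℂ) • pointCurvPoly R a b

theorem curvOp_apply (R : Fin 4 → Fin 4 → Fin 4 → Fin 4 → ℝ) (p : SpinorPoly ℂ) :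
    curvOp R p = ∑ a, ∑ b, asdPoly a b * pointCurvPoly R a b p := by
  simp [curvOp, derivation_sum_apply]

theorem curvOp_xi (R : Fin 4 → Fin 4 → Fin 4 → Fin 4 → ℝ) (B : Fin 2) :
    curvOp R (xi B) = ∑ a, ∑ b, asdPoly a b * ∑ A, C (liftPlus (R a b) A B) * xi A := by
  simp [curvOp_apply, pointCurvPoly, xi, mkDerivation_X]

theorem curvOp_eta (R : Fin 4 → Fin 4 → Fin 4 → Fin 4 → ℝ) (B : Fin 2) :
    curvOp R (eta B) = ∑ a, ∑ b, asdPoly a b * ∑ A, C (liftMinus (R a b) A B) * eta A := by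
  simp [curvOp_apply, pointCurvPoly, eta, mkDerivation_X]

end CurvatureOperator

/-! ### Sections of the spinor bundles as arrays of smooth functions -/

section Bridge

variable {M : Type*} [TopologicalSpace M] [ChartedSpace E4 M] [IsManifold 𝓘(ℝ, E4) ∞ M]
  [RiemannianBundle (fun x : M => TangentSpace 𝓘(ℝ, E4) x)]
  [IsContMDiffRiemannianBundle 𝓘(ℝ, E4) ∞ E4 (fun x : M => TangentSpace 𝓘(ℝ, E4) x)]

namespace SpinStructure

variable {o : (x : M) → Orientation ℝ (TangentSpace 𝓘(ℝ, E4) x) (Fin 4)} {ι : Type*}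
  (S : SpinStructure M o ι)

theorem frameOn (i : ι) : OrthonormalFrameOn (S.frame i) (S.dom i) :=
  ⟨S.isOpen_dom i, S.frame_smooth i, S.frame_orthonormal i⟩

/-- The connection in the `i`-th patch. -/
def conn (i : ι) : FrameConnection (smoothRing (S.dom i) ℂ) := (S.frameOn i).conn

theorem connForm_eq (i : ι) {x : M} (hx : x ∈ S.dom i) (a b c : Fin 4) :
    S.connForm i x a b c = frameCoef (S.frame i) a b c x :=
  (S.frameOn i).inner_nabla_frame a b c hx

/-- The components of `ψ` in the `i`-th patch are the smooth functions `Ψ`. -/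
def Represents (i : ι) {k n : ℕ} (Ψ : SpinorArray (smoothRing (S.dom i) ℂ) k n)
    (ψ : S.Field k n) : Prop :=
  ∀ (x : S.dom i) A A', (Ψ A A').1 x = ψ i x A A'

variable {S} {i : ι} {k n : ℕ}

theorem liftPlus_conn (a : Fin 4) (x : S.dom i) (A B : Fin 2) :
    (algLiftPlus ((S.conn i).coef a) A B).1 x = liftPlus (S.connForm i x a) A B := by
  rw [← algLiftPlus_ofReal]
  refine (map_algLiftPlus (evalAt x) ((S.conn i).coef a) A B).trans ?_
  refine congrArg (fun om => algLiftPlus om A B) (funext fun b => funext fun c => ?_)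
  rw [S.connForm_eq i x.2]
  rfl

theorem liftMinus_conn (a : Fin 4) (x : S.dom i) (A B : Fin 2) :
    (algLiftMinus ((S.conn i).coef a) A B).1 x = liftMinus (S.connForm i x a) A B := by
  rw [← algLiftMinus_ofReal]
  refine (map_algLiftMinus (evalAt x) ((S.conn i).coef a) A B).trans ?_
  refine congrArg (fun om => algLiftMinus om A B) (funext fun b => funext fun c => ?_)
  rw [S.connForm_eq i x.2]
  rfl

theorem Represents.covDeriv {Ψ : SpinorArray (smoothRing (S.dom i) ℂ) k n} {ψ : S.Field k n}
    (h : S.Represents i Ψ ψ) (a : Fin 4) :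
    S.Represents i ((S.conn i).algCov a Ψ) (S.covDeriv a ψ) := by
  intro x A A'
  have hd : ((S.conn i).deriv a (Ψ A A')).1 x
      = mvfderiv 𝓘(ℝ, E4) (fun y => ψ i y A A') x (S.frame i a x) :=
    fieldDerivation_apply (S.isOpen_dom i) (S.frame_smooth i a) _ (fun y => h y A A') x
  simp only [FrameConnection.algCov, SpinStructure.covDeriv, Subalgebra.coe_add, Pi.add_apply,
    AddSubmonoidClass.coe_finsetSum, Finset.sum_apply, Subalgebra.coe_mul, Pi.mul_apply, hd,
    liftPlus_conn, liftMinus_conn, h x]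

theorem algSymmetrize_apply {K : Type*} [CommRing K] [Algebra ℂ K] (φ : K →ₐ[ℂ] ℂ)
    (T : SpinorArray K k n) (A : Fin k → Fin 2) (A' : Fin n → Fin 2) :
    φ (algSymmetrize T A A') = symmetrize (fun A A' => φ (T A A')) A A' := by
  simp [algSymmetrize, symmetrize, map_sum]

theorem Represents.spinorDeriv {Ψ : SpinorArray (smoothRing (S.dom i) ℂ) k n} {ψ : S.Field k n}
    (h : S.Represents i Ψ ψ) (E E' : Fin 2) :
    S.Represents i (fun A A' => ∑ a, algebraMap ℂ _ (sigma a E E') * (S.conn i).algCov a Ψ A A')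
      (S.spinorDeriv E E' ψ) := by
  intro x A A'
  rw [← evalAt_apply]
  simp only [map_sum, map_mul, AlgHom.commutes, SpinStructure.spinorDeriv, Finset.sum_apply,
    Pi.smul_apply, smul_eq_mul]
  exact Finset.sum_congr rfl fun a _ => congrArg (_ * ·) (h.covDeriv a x A A')

theorem Represents.d {Ψ : SpinorArray (smoothRing (S.dom i) ℂ) k n} {ψ : S.Field k n}
    (h : S.Represents i Ψ ψ) : S.Represents i ((S.conn i).algD Ψ) (S.d ψ) := by
  intro x A A'
  rw [← evalAt_apply]
  simp only [FrameConnection.algD, map_mul, map_natCast, algSymmetrize_apply, SpinStructure.d,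
    Pi.smul_apply, smul_eq_mul]
  refine congrArg (_ * ·) (congrArg (fun T => symmetrize T A A') (funext fun A => funext fun A' => ?_))
  exact h.spinorDeriv (A 0) (A' 0) x (Fin.tail A) (Fin.tail A')

theorem Represents.deltaStar {Ψ : SpinorArray (smoothRing (S.dom i) ℂ) (k + 1) n}
    {ψ : S.Field (k + 1) n} (h : S.Represents i Ψ ψ) :
    S.Represents i ((S.conn i).algDeltaStar Ψ) (S.deltaStar ψ) := by
  intro x A A'
  rw [← evalAt_apply]
  simp only [FrameConnection.algDeltaStar, map_mul, map_natCast, algSymmetrize_apply,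
    SpinStructure.deltaStar, Pi.smul_apply, smul_eq_mul]
  refine congrArg (_ * ·) (congrArg (fun T => symmetrize T A A') (funext fun A => funext fun A' => ?_))
  rw [map_sum]
  refine Finset.sum_congr rfl fun E _ => ?_
  rw [map_sum]
  refine Finset.sum_congr rfl fun B _ => ?_
  rw [map_mul, AlgHom.commutes]
  exact congrArg (_ * ·) (h.spinorDeriv E (A' 0) x (Fin.cons B A) (Fin.tail A'))

theorem Represents.commutator {Ψ : SpinorArray (smoothRing (S.dom i) ℂ) k n} {ψ : S.Field k n}
    (h : S.Represents i Ψ ψ) : S.Represents i ((S.conn i).algCommutator Ψ) (S.commutator ψ) := by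
  intro x A A'
  cases k with
  | zero => exact congrArg (- ·) (h.d.deltaStar x A A')
  | succ k => exact congrArg₂ (· - ·) (h.deltaStar.d x A A') (h.d.deltaStar x A A')

open MvPolynomial in
theorem Represents.map_toPoly {Ψ : SpinorArray (smoothRing (S.dom i) ℂ) k n} {ψ : S.Field k n}
    (h : S.Represents i Ψ ψ) (x : S.dom i) :
    map (evalAt x : _ →ₐ[ℂ] ℂ).toRingHom (toPoly Ψ) = toPoly (ψ i x) := by
  simp only [toPoly, map_sum, map_mul, map_prod, xi, eta, map_X, map_C]
  exact Finset.sum_congr rfl fun A _ => Finset.sum_congr rfl fun A' _ =>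
    congrArg (fun z => C z * _) (h x A A')

/-- The components of a smooth section, as smooth functions. -/
def IsSection.components {ψ : S.Field k n} (hψ : S.IsSection ψ) (i : ι) :
    SpinorArray (smoothRing (S.dom i) ℂ) k n := fun A A' =>
  toSmooth (fun x => ψ i x A A') (hψ.smooth i A A')

theorem IsSection.represents {ψ : S.Field k n} (hψ : S.IsSection ψ) (i : ι) :
    S.Represents i (hψ.components i) ψ := fun _ _ _ => rfl

theorem IsSection.isSymmArray {ψ : S.Field k n} (hψ : S.IsSection ψ) (i : ι) :
    IsSymmArray (hψ.components i) := fun τ ρ A A' =>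
  smoothRing_ext fun x => hψ.symm i x x.2 τ ρ A A'

open MvPolynomial in
theorem map_curvPoly (x : S.dom i) (a b : Fin 4) (p : SpinorPoly (smoothRing (S.dom i) ℂ)) :
    map (evalAt x : _ →ₐ[ℂ] ℂ).toRingHom ((S.conn i).curvPoly a b p)
      = pointCurvPoly (riemAt (S.frame i) x) a b (map (evalAt x : _ →ₐ[ℂ] ℂ).toRingHom p) := by
  have hc : (fun c d => evalAt x ((S.conn i).curv a b c d))
      = fun c d => ((riemAt (S.frame i) x a b c d : ℝ) : ℂ) :=
    funext fun c => funext fun d => (S.frameOn i).conn_curv_apply a b c d x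
  refine map_derivation _ _ _ (fun j => ?_) p
  rcases j with B | B
  · refine (congrArg _ ((S.conn i).curvPoly_xi a b B)).trans ?_
    simp only [pointCurvPoly, mkDerivation_X, Sum.elim_inl, map_sum, map_mul, map_C, xi, map_X]
    refine Finset.sum_congr rfl fun A _ => congrArg (fun z => C z * _) ?_
    refine (map_algLiftPlus (evalAt x) ((S.conn i).curv a b) A B).trans ?_
    rw [hc, algLiftPlus_ofReal]
  · refine (congrArg _ ((S.conn i).curvPoly_eta a b B)).trans ?_
    simp only [pointCurvPoly, mkDerivation_X, Sum.elim_inr, map_sum, map_mul, map_C, eta, map_X]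
    refine Finset.sum_congr rfl fun A _ => congrArg (fun z => C z * _) ?_
    refine (map_algLiftMinus (evalAt x) ((S.conn i).curv a b) A B).trans ?_
    rw [hc, algLiftMinus_ofReal]

open MvPolynomial in
theorem map_asdPoly {K : Type*} [CommRing K] [Algebra ℂ K] (φ : K →ₐ[ℂ] ℂ) (a b : Fin 4) :
    map φ.toRingHom (asdPoly a b : SpinorPoly K) = asdPoly a b := by
  simp [asdPoly, solderEta, eta]

theorem IsSection.toPoly_commutator {ψ : S.Field k n} (hψ : S.IsSection ψ) {x : M}
    (hx : x ∈ S.dom i) :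
    2 * toPoly (S.commutator ψ i x) = (((n + 1) * (n + 2) * (k + 1) : ℕ) : SpinorPoly ℂ) *
      curvOp (riemAt (S.frame i) x) (toPoly (ψ i x)) := by
  have h := congrArg (MvPolynomial.map (evalAt (⟨x, hx⟩ : S.dom i) : _ →ₐ[ℂ] ℂ).toRingHom)
    ((S.conn i).toPoly_algCommutator (hψ.isSymmArray i))
  rw [map_mul, map_mul, (hψ.represents i).commutator.map_toPoly, map_natCast, map_ofNat] at h
  rw [h, curvOp_apply]
  simp only [map_sum, map_mul, map_curvPoly, map_asdPoly, (hψ.represents i).map_toPoly]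

/-- The commutator has order zero, so its value at `x` depends only on that of ψ; symmetric arrays
over ℂ are determined by their polynomials. -/
theorem IsSection.commutator_eq_zero_iff {ψ : S.Field k n} (hψ : S.IsSection ψ) {x : M}
    (hx : x ∈ S.dom i) :
    S.commutator ψ i x = 0 ↔ curvOp (riemAt (S.frame i) x) (toPoly (ψ i x)) = 0 := by
  have h := hψ.toPoly_commutator hx
  have hc : (((n + 1) * (n + 2) * (k + 1) : ℕ) : SpinorPoly ℂ) ≠ 0 :=
    Nat.cast_ne_zero.2 (by positivity)
  constructor
  · intro h0
    rw [h0, toPoly_zero, mul_zero] at h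
    exact (mul_eq_zero.1 h.symm).resolve_left hc
  · intro h0
    rw [h0, mul_zero] at h
    have hs : IsSymmArray (S.commutator ψ i x) := fun τ ρ A A' => by
      have hr := (hψ.represents i).commutator ⟨x, hx⟩
      rw [← hr, ← hr, (S.conn i).isSymmArray_algCommutator (hψ.components i) τ ρ A A']
    exact hs.eq_zero_of_toPoly_eq_zero ((mul_eq_zero.1 h).resolve_left two_ne_zero)

end SpinStructure

end Bridge

end SpinorDiagram

end

noncomputable section

namespace SpinorDiagram

/-! ### Algebraic curvature tensors in dimension four -/

/-- The symmetries of `R a b d c = ⟨R(e_a, e_b) e_c, e_d⟩`. -/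
structure AlgCurv (R : Fin 4 → Fin 4 → Fin 4 → Fin 4 → ℝ) : Prop where
  swap : ∀ a b c d, R a b c d = -R b a c d
  skew : ∀ a b c d, R a b c d = -R a b d c
  cyclic : ∀ a b c d, R a b d c + R b c d a + R c a d b = 0

namespace AlgCurv

variable {R : Fin 4 → Fin 4 → Fin 4 → Fin 4 → ℝ}

/-- The classical combination of four cyclic identities and the two skew-symmetries. -/
theorem pair (h : AlgCurv R) (a b c d : Fin 4) : R a b c d = R c d a b := by
  linarith [h.cyclic a b c d, h.cyclic b c d a, h.cyclic c d a b, h.cyclic d a b c,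
    h.swap a b c d, h.skew a b c d, h.swap b c d a, h.skew b c d a, h.swap c d a b, h.skew c d a b,
    h.swap d a b c, h.skew d a b c, h.swap a c b d, h.skew a c b d, h.swap b d a c, h.skew b d a c,
    h.skew b a d c, h.skew b c a d, h.skew c a d b, h.skew c d b a, h.skew d b a c, h.skew d a c b,
    h.skew a c b d, h.skew a b c d, h.skew b d c a, h.skew c a b d, h.swap c a b d, h.swap d b a c,
    h.swap c a d b, h.swap d b c a]

end AlgCurv

/-- The components `01 - 23`, `02 - 31`, `03 - 12` of a two-form. -/
def asdPart (T : Fin 4 → Fin 4 → ℝ) : Fin 3 → ℝ := ![T 0 1 - T 2 3, T 0 2 + T 1 3, T 0 3 - T 1 2]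

/-- The components `01 + 23`, `02 + 31`, `03 + 12` of a two-form. -/
def sdPart (T : Fin 4 → Fin 4 → ℝ) : Fin 3 → ℝ := ![T 0 1 + T 2 3, T 0 2 - T 1 3, T 0 3 + T 1 2]

/-- The block `Λ⁻ → Λ⁺` of a curvature tensor. -/
def mixedBlock (R : Fin 4 → Fin 4 → Fin 4 → Fin 4 → ℝ) (i j : Fin 3) : ℝ :=
  asdPart (fun a b => sdPart (R a b) j) i

/-- The block `Λ⁻ → Λ⁻` of a curvature tensor. -/
def asdBlock (R : Fin 4 → Fin 4 → Fin 4 → Fin 4 → ℝ) (i j : Fin 3) : ℝ :=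
  asdPart (fun a b => asdPart (R a b) j) i

/-! ### Evaluating the curvature operator at spinors ξ and η -/

section Evaluation

open MvPolynomial Complex

/-- The anti-self-dual two-form of a primed spinor. -/
def asdQuad (η : Fin 2 → ℂ) : Fin 3 → ℂ :=
  ![-I * (η 0 ^ 2 - η 1 ^ 2), η 0 ^ 2 + η 1 ^ 2, 2 * I * (η 0 * η 1)]

theorem eval_solderEta (ξ η : Fin 2 → ℂ) (a : Fin 4) (A : Fin 2) :
    eval (Sum.elim ξ η) (solderEta a A : SpinorPoly ℂ) = sigma a A 0 * η 0 + sigma a A 1 * η 1 := by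
  simp [solderEta, eta, Fin.sum_univ_two]

theorem eval_asdPoly_swap (v : Fin 2 ⊕ Fin 2 → ℂ) (a b : Fin 4) :
    eval v (asdPoly a b : SpinorPoly ℂ) = -eval v (asdPoly b a : SpinorPoly ℂ) := by
  simp only [asdPoly, map_sub, map_mul]
  ring

/-- The bivector `asdPoly` is anti-self-dual: its 01, 02, 03 components agree with minus 23, minus
31, minus 12. It therefore sees only the anti-self-dual part of `T`. -/
theorem sum_eval_asdPoly (ξ η : Fin 2 → ℂ) {T : Fin 4 → Fin 4 → ℂ} (hT : ∀ a b, T a b = -T b a) :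
    ∑ a, ∑ b, eval (Sum.elim ξ η) (asdPoly a b : SpinorPoly ℂ) * T a b
      = 2 * (asdQuad η 0 * (T 0 1 - T 2 3) + asdQuad η 1 * (T 0 2 + T 1 3)
        + asdQuad η 2 * (T 0 3 - T 1 2)) := by
  have hd : ∀ a, T a a = 0 := fun a => by have := hT a a; linear_combination (1 / 2) * this
  have e01 : eval (Sum.elim ξ η) (asdPoly 0 1 : SpinorPoly ℂ) = asdQuad η 0 := by
    simp [asdPoly, eval_solderEta, sigma, asdQuad]; ring
  have e02 : eval (Sum.elim ξ η) (asdPoly 0 2 : SpinorPoly ℂ) = asdQuad η 1 := by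
    simp [asdPoly, eval_solderEta, sigma, asdQuad]; ring
  have e03 : eval (Sum.elim ξ η) (asdPoly 0 3 : SpinorPoly ℂ) = asdQuad η 2 := by
    simp [asdPoly, eval_solderEta, sigma, asdQuad]; ring
  have e12 : eval (Sum.elim ξ η) (asdPoly 1 2 : SpinorPoly ℂ) = -asdQuad η 2 := by
    simp [asdPoly, eval_solderEta, sigma, asdQuad]; ring
  have e13 : eval (Sum.elim ξ η) (asdPoly 1 3 : SpinorPoly ℂ) = asdQuad η 1 := by
    simp [asdPoly, eval_solderEta, sigma, asdQuad]
    linear_combination (-η 0 ^ 2 - η 1 ^ 2) * I_mul_I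
  have e23 : eval (Sum.elim ξ η) (asdPoly 2 3 : SpinorPoly ℂ) = -asdQuad η 0 := by
    simp [asdPoly, eval_solderEta, sigma, asdQuad]; ring
  simp only [Fin.sum_univ_four, hd, hT 1 0, hT 2 0, hT 3 0, hT 2 1, hT 3 1, hT 3 2,
    eval_asdPoly_swap _ 1 0, eval_asdPoly_swap _ 2 0, eval_asdPoly_swap _ 3 0,
    eval_asdPoly_swap _ 2 1, eval_asdPoly_swap _ 3 1, eval_asdPoly_swap _ 3 2,
    e01, e02, e03, e12, e13, e23]
  ring

variable {R : Fin 4 → Fin 4 → Fin 4 → Fin 4 → ℝ}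

theorem liftPlus_eq {om : Fin 4 → Fin 4 → ℝ} (h : ∀ b c, om b c = -om c b) (A B : Fin 2) :
    liftPlus om A B = 1 / 2 * (!![I * sdPart om 2, I * sdPart om 0 + sdPart om 1;
      I * sdPart om 0 - sdPart om 1, -(I * sdPart om 2)] : Matrix (Fin 2) (Fin 2) ℂ) A B := by
  rw [← algLiftPlus_ofReal, algLiftPlus_eq (fun b c => by rw [h b c, ofReal_neg])]
  simp [sdPart]

theorem liftMinus_eq {om : Fin 4 → Fin 4 → ℝ} (h : ∀ b c, om b c = -om c b) (A B : Fin 2) :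
    liftMinus om A B = 1 / 2 * (!![I * asdPart om 2, I * asdPart om 0 - asdPart om 1;
      I * asdPart om 0 + asdPart om 1, -(I * asdPart om 2)] : Matrix (Fin 2) (Fin 2) ℂ) A B := by
  rw [← algLiftMinus_ofReal, algLiftMinus_eq (fun b c => by rw [h b c, ofReal_neg])]
  simp [asdPart]

theorem sum_eval_asdPoly_real (ξ η : Fin 2 → ℂ) {T : Fin 4 → Fin 4 → ℝ}
    (hT : ∀ a b, T a b = -T b a) :
    ∑ a, ∑ b, eval (Sum.elim ξ η) (asdPoly a b : SpinorPoly ℂ) * T a b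
      = 2 * ∑ i, asdQuad η i * asdPart T i := by
  rw [sum_eval_asdPoly ξ η (fun a b => by rw [hT a b, ofReal_neg])]
  simp [Fin.sum_univ_three, asdPart]

theorem AlgCurv.sum_mixed (h : AlgCurv R) (ξ η : Fin 2 → ℂ) (j : Fin 3) :
    ∑ a, ∑ b, eval (Sum.elim ξ η) (asdPoly a b : SpinorPoly ℂ) * sdPart (R a b) j
      = 2 * ∑ i, asdQuad η i * mixedBlock R i j := by
  refine sum_eval_asdPoly_real ξ η (T := fun a b => sdPart (R a b) j) fun a b => ?_
  fin_cases j <;> simp only [sdPart] <;> simp [h.swap a b] <;> ring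

theorem AlgCurv.sum_asd (h : AlgCurv R) (ξ η : Fin 2 → ℂ) (j : Fin 3) :
    ∑ a, ∑ b, eval (Sum.elim ξ η) (asdPoly a b : SpinorPoly ℂ) * asdPart (R a b) j
      = 2 * ∑ i, asdQuad η i * asdBlock R i j := by
  refine sum_eval_asdPoly_real ξ η (T := fun a b => asdPart (R a b) j) fun a b => ?_
  fin_cases j <;> simp only [asdPart] <;> simp [h.swap a b] <;> ring

/-- The blocks of the curvature, evaluated on the primed spinor `η`. -/
def blockVal (B : Fin 3 → Fin 3 → ℝ) (η : Fin 2 → ℂ) (j : Fin 3) : ℂ := ∑ i, asdQuad η i * B i j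

theorem AlgCurv.sum_mixed_comb (h : AlgCurv R) (ξ η : Fin 2 → ℂ) (p q r : ℂ) :
    ∑ a, ∑ b, eval (Sum.elim ξ η) (asdPoly a b : SpinorPoly ℂ)
        * (1 / 2 * (p * sdPart (R a b) 0 + q * sdPart (R a b) 1 + r * sdPart (R a b) 2))
      = p * blockVal (mixedBlock R) η 0 + q * blockVal (mixedBlock R) η 1
        + r * blockVal (mixedBlock R) η 2 := by
  have key : ∀ (j : Fin 3) (c : ℂ), c * blockVal (mixedBlock R) η j
      = ∑ a, ∑ b, eval (Sum.elim ξ η) (asdPoly a b : SpinorPoly ℂ)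
        * (1 / 2 * (c * sdPart (R a b) j)) := by
    intro j c
    rw [blockVal, show c * ∑ i, asdQuad η i * (mixedBlock R i j : ℂ)
      = 1 / 2 * c * (2 * ∑ i, asdQuad η i * (mixedBlock R i j : ℂ)) by ring, ← h.sum_mixed ξ η j]
    simp only [Finset.mul_sum]
    exact Finset.sum_congr rfl fun a _ => Finset.sum_congr rfl fun b _ => by ring
  simp only [key, mul_add, Finset.sum_add_distrib]

theorem AlgCurv.sum_asd_comb (h : AlgCurv R) (ξ η : Fin 2 → ℂ) (p q r : ℂ) :
    ∑ a, ∑ b, eval (Sum.elim ξ η) (asdPoly a b : SpinorPoly ℂ)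
        * (1 / 2 * (p * asdPart (R a b) 0 + q * asdPart (R a b) 1 + r * asdPart (R a b) 2))
      = p * blockVal (asdBlock R) η 0 + q * blockVal (asdBlock R) η 1
        + r * blockVal (asdBlock R) η 2 := by
  have key : ∀ (j : Fin 3) (c : ℂ), c * blockVal (asdBlock R) η j
      = ∑ a, ∑ b, eval (Sum.elim ξ η) (asdPoly a b : SpinorPoly ℂ)
        * (1 / 2 * (c * asdPart (R a b) j)) := by
    intro j c
    rw [blockVal, show c * ∑ i, asdQuad η i * (asdBlock R i j : ℂ)
      = 1 / 2 * c * (2 * ∑ i, asdQuad η i * (asdBlock R i j : ℂ)) by ring, ← h.sum_asd ξ η j]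
    simp only [Finset.mul_sum]
    exact Finset.sum_congr rfl fun a _ => Finset.sum_congr rfl fun b _ => by ring
  simp only [key, mul_add, Finset.sum_add_distrib]

theorem AlgCurv.eval_curvOp_xi_zero (h : AlgCurv R) (ξ η : Fin 2 → ℂ) :
    eval (Sum.elim ξ η) (curvOp R (xi 0)) = I * ξ 1 * blockVal (mixedBlock R) η 0
      + -ξ 1 * blockVal (mixedBlock R) η 1 + I * ξ 0 * blockVal (mixedBlock R) η 2 := by
  rw [← h.sum_mixed_comb ξ η, curvOp_xi]
  simp only [map_sum, map_mul, eval_C, xi, eval_X, Sum.elim_inl]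
  refine Finset.sum_congr rfl fun a _ => Finset.sum_congr rfl fun b _ => congrArg (_ * ·) ?_
  simp [Fin.sum_univ_two, liftPlus_eq (h.skew a b)]
  ring

theorem AlgCurv.eval_curvOp_xi_one (h : AlgCurv R) (ξ η : Fin 2 → ℂ) :
    eval (Sum.elim ξ η) (curvOp R (xi 1)) = I * ξ 0 * blockVal (mixedBlock R) η 0
      + ξ 0 * blockVal (mixedBlock R) η 1 + -(I * ξ 1) * blockVal (mixedBlock R) η 2 := by
  rw [← h.sum_mixed_comb ξ η, curvOp_xi]
  simp only [map_sum, map_mul, eval_C, xi, eval_X, Sum.elim_inl]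
  refine Finset.sum_congr rfl fun a _ => Finset.sum_congr rfl fun b _ => congrArg (_ * ·) ?_
  simp [Fin.sum_univ_two, liftPlus_eq (h.skew a b)]
  ring

theorem AlgCurv.eval_curvOp_eta_zero (h : AlgCurv R) (ξ η : Fin 2 → ℂ) :
    eval (Sum.elim ξ η) (curvOp R (eta 0)) = I * η 1 * blockVal (asdBlock R) η 0
      + η 1 * blockVal (asdBlock R) η 1 + I * η 0 * blockVal (asdBlock R) η 2 := by
  rw [← h.sum_asd_comb ξ η, curvOp_eta]
  simp only [map_sum, map_mul, eval_C, eta, eval_X, Sum.elim_inr]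
  refine Finset.sum_congr rfl fun a _ => Finset.sum_congr rfl fun b _ => congrArg (_ * ·) ?_
  simp [Fin.sum_univ_two, liftMinus_eq (h.skew a b)]
  ring

theorem AlgCurv.eval_curvOp_eta_one (h : AlgCurv R) (ξ η : Fin 2 → ℂ) :
    eval (Sum.elim ξ η) (curvOp R (eta 1)) = I * η 0 * blockVal (asdBlock R) η 0
      + -η 0 * blockVal (asdBlock R) η 1 + -(I * η 1) * blockVal (asdBlock R) η 2 := by
  rw [← h.sum_asd_comb ξ η, curvOp_eta]
  simp only [map_sum, map_mul, eval_C, eta, eval_X, Sum.elim_inr]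
  refine Finset.sum_congr rfl fun a _ => Finset.sum_congr rfl fun b _ => congrArg (_ * ·) ?_
  simp [Fin.sum_univ_two, liftMinus_eq (h.skew a b)]
  ring

theorem sumElim_inl_inr (v : Fin 2 ⊕ Fin 2 → ℂ) :
    v = Sum.elim (fun A => v (Sum.inl A)) fun A => v (Sum.inr A) := by
  funext j
  rcases j with j | j <;> rfl

theorem AlgCurv.curvOp_xi_eq_zero (h : AlgCurv R) (hB : ∀ i j, mixedBlock R i j = 0) (B : Fin 2) :
    curvOp R (xi B) = 0 := by
  refine MvPolynomial.funext fun v => ?_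
  rw [sumElim_inl_inr v, map_zero]
  fin_cases B
  · exact (h.eval_curvOp_xi_zero _ _).trans (by simp [blockVal, hB])
  · exact (h.eval_curvOp_xi_one _ _).trans (by simp [blockVal, hB])

/-- The block `Λ⁻ → Λ⁻` is a multiple of the identity. -/
def IsScalarBlock (B : Fin 3 → Fin 3 → ℝ) : Prop := ∃ c : ℝ, ∀ i j, B i j = if i = j then c else 0

/-- With a scalar block, the endomorphism attached to the bivector of η ⊗ η acts on η itself, and
ε(η, η) = 0. -/
theorem AlgCurv.curvOp_eta_eq_zero (h : AlgCurv R) (hA : IsScalarBlock (asdBlock R)) (B : Fin 2) :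
    curvOp R (eta B) = 0 := by
  obtain ⟨c, hc⟩ := hA
  refine MvPolynomial.funext fun v => ?_
  rw [sumElim_inl_inr v, map_zero]
  fin_cases B
  · refine (h.eval_curvOp_eta_zero _ _).trans ?_
    simp [blockVal, hc, Fin.sum_univ_three, asdQuad]
    linear_combination (v (Sum.inr 1) * (-(v (Sum.inr 0) ^ 2 - v (Sum.inr 1) ^ 2) * c)
      + 2 * v (Sum.inr 0) * (v (Sum.inr 0) * v (Sum.inr 1)) * c) * I_mul_I
  · refine (h.eval_curvOp_eta_one _ _).trans ?_
    simp [blockVal, hc, Fin.sum_univ_three, asdQuad]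
    linear_combination (v (Sum.inr 0) * (-(v (Sum.inr 0) ^ 2 - v (Sum.inr 1) ^ 2) * c)
      - 2 * v (Sum.inr 1) * (v (Sum.inr 0) * v (Sum.inr 1)) * c) * I_mul_I

/-- The vectors `asdQuad η` at these three spinors form a basis of ℂ³. -/
theorem eq_zero_of_blockVal {B : Fin 3 → Fin 3 → ℝ} {j : Fin 3}
    (h0 : blockVal B ![1, 0] j = 0) (h1 : blockVal B ![0, 1] j = 0) (h2 : blockVal B ![1, 1] j = 0)
    (i : Fin 3) : B i j = 0 := by
  simp [blockVal, Fin.sum_univ_three, asdQuad] at h0 h1 h2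
  have e1 : (B 1 j : ℂ) = 0 := by linear_combination (h0 + h1) / 2
  have e0 : (B 0 j : ℂ) = 0 := by
    linear_combination -I * (h1 - h0) / 2 + B 0 j * I_mul_I
  have e2 : (B 2 j : ℂ) = 0 := by
    linear_combination -I * h2 / 2 + I * e1 + B 2 j * I_mul_I
  fin_cases i
  · exact_mod_cast e0
  · exact_mod_cast e1
  · exact_mod_cast e2

/-- Each row satisfies i B_{i0} - B_{i1} = 0; as the entries are real, both vanish. -/
theorem eq_zero_of_blockVal_comb {B : Fin 3 → Fin 3 → ℝ}
    (h : ∀ η : Fin 2 → ℂ, η ≠ 0 → I * blockVal B η 0 - blockVal B η 1 = 0) (i : Fin 3) :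
    B i 0 = 0 ∧ B i 1 = 0 := by
  have h0 := h ![1, 0] (fun h => by simpa using congrFun h 0)
  have h1 := h ![0, 1] (fun h => by simpa using congrFun h 1)
  have h2 := h ![1, 1] (fun h => by simpa using congrFun h 0)
  simp [blockVal, Fin.sum_univ_three, asdQuad] at h0 h1 h2
  have e1 : I * (B 1 0 : ℂ) - B 1 1 = 0 := by linear_combination (h0 + h1) / 2
  have e0 : I * (B 0 0 : ℂ) - B 0 1 = 0 := by
    linear_combination -I * (h1 - h0) / 2 + (I * B 0 0 - B 0 1) * I_mul_I
  have e2 : I * (B 2 0 : ℂ) - B 2 1 = 0 := by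
    linear_combination -I * h2 / 2 + I * e1 + (I * B 2 0 - B 2 1) * I_mul_I
  have key : ∀ x y : ℝ, I * (x : ℂ) - y = 0 → x = 0 ∧ y = 0 := by
    intro x y hxy
    have hre := congrArg Complex.re hxy
    have him := congrArg Complex.im hxy
    simp at hre him
    exact ⟨him, hre⟩
  fin_cases i
  · exact key _ _ e0
  · exact key _ _ e1
  · exact key _ _ e2

theorem AlgCurv.asdBlock_symm (h : AlgCurv R) (i j : Fin 3) : asdBlock R i j = asdBlock R j i := by
  fin_cases i <;> fin_cases j <;> simp [asdBlock, asdPart] <;>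
    linarith [h.pair 0 1 0 2, h.pair 0 1 1 3, h.pair 2 3 0 2, h.pair 2 3 1 3, h.pair 0 1 0 3,
      h.pair 0 1 1 2, h.pair 2 3 0 3, h.pair 2 3 1 2, h.pair 0 2 0 3, h.pair 0 2 1 2,
      h.pair 1 3 0 3, h.pair 1 3 1 2]

/-- The value is a cubic form in η, determined by the four test spinors. Since the block is real and
symmetric, the real and imaginary parts of these equations already make it scalar, so `eta 1` is not
needed. -/
theorem AlgCurv.isScalarBlock (h : AlgCurv R) (h0 : curvOp R (eta 0) = 0) :
    IsScalarBlock (asdBlock R) := by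
  have key : ∀ η : Fin 2 → ℂ, I * η 1 * blockVal (asdBlock R) η 0
      + η 1 * blockVal (asdBlock R) η 1 + I * η 0 * blockVal (asdBlock R) η 2 = 0 := by
    intro η
    rw [← h.eval_curvOp_eta_zero 0 η, h0, map_zero]
  have k0 := key ![1, 0]
  have k1 := key ![0, 1]
  have k2 := key ![1, 1]
  have k3 := key ![1, -1]
  have s01 := h.asdBlock_symm 1 0
  have s02 := h.asdBlock_symm 2 0
  have s12 := h.asdBlock_symm 2 1
  generalize asdBlock R = B at *
  simp [blockVal, Fin.sum_univ_three, asdQuad, s01, s02, s12] at k0 k1 k2 k3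
  have r0 := congrArg Complex.re k0
  have i0 := congrArg Complex.im k0
  have r1 := congrArg Complex.re k1
  have i1 := congrArg Complex.im k1
  have r2 := congrArg Complex.re k2
  have i2 := congrArg Complex.im k2
  have r3 := congrArg Complex.re k3
  have i3 := congrArg Complex.im k3
  simp at r0 i0 r1 i1 r2 i2 r3 i3
  refine ⟨B 0 0, fun i j => ?_⟩
  fin_cases i <;> fin_cases j <;> simp <;> linarith

end Evaluation

end SpinorDiagram

end

noncomputable section

namespace SpinorDiagram

/-! ### The Ricci and Weyl parts of an algebraic curvature tensor -/

/-- The Ricci tensor of an algebraic curvature tensor. -/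
def ricOf (R : Fin 4 → Fin 4 → Fin 4 → Fin 4 → ℝ) (b c : Fin 4) : ℝ := ∑ a, R a b a c

/-- The Weyl tensor of an algebraic curvature tensor. -/
def weylOf (R : Fin 4 → Fin 4 → Fin 4 → Fin 4 → ℝ) (a b c d : Fin 4) : ℝ :=
  R a b d c
    - (ricOf R b c * (if a = d then 1 else 0) + (if b = c then 1 else 0) * ricOf R a d
        - ricOf R a c * (if b = d then 1 else 0) - (if a = c then 1 else 0) * ricOf R b d) / 2
    + (∑ i, ricOf R i i) / 6 * ((if b = c then 1 else 0) * (if a = d then 1 else 0)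
        - (if a = c then 1 else 0) * (if b = d then 1 else 0))

namespace AlgCurv

variable {R : Fin 4 → Fin 4 → Fin 4 → Fin 4 → ℝ}

theorem diag_left (h : AlgCurv R) (a c d : Fin 4) : R a a c d = 0 := by
  linarith [h.swap a a c d]

theorem diag_right (h : AlgCurv R) (a b c : Fin 4) : R a b c c = 0 := by
  linarith [h.skew a b c c]

/-- In dimension four this is the only relation that the cyclic identity adds to skewness and pair
symmetry. -/
theorem bianchi (h : AlgCurv R) : R 0 3 1 2 = R 0 2 1 3 - R 0 1 2 3 := by
  linarith [h.cyclic 0 1 2 3, h.skew 0 1 3 2, h.pair 1 2 3 0, h.swap 3 0 1 2, h.skew 2 0 3 1,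
    h.swap 2 0 1 3]

/-- The components of the Ricci tensor. -/
theorem ricOf_eq (h : AlgCurv R) : ricOf R = ![
    ![R 0 1 0 1 + R 0 2 0 2 + R 0 3 0 3, R 0 2 1 2 + R 0 3 1 3,
      R 0 3 2 3 - R 0 1 1 2, -R 0 1 1 3 - R 0 2 2 3],
    ![R 0 2 1 2 + R 0 3 1 3, R 0 1 0 1 + R 1 2 1 2 + R 1 3 1 3,
      R 0 1 0 2 + R 1 3 2 3, R 0 1 0 3 - R 1 2 2 3],
    ![R 0 3 2 3 - R 0 1 1 2, R 0 1 0 2 + R 1 3 2 3,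
      R 0 2 0 2 + R 1 2 1 2 + R 2 3 2 3, R 0 2 0 3 + R 1 2 1 3],
    ![-R 0 1 1 3 - R 0 2 2 3, R 0 1 0 3 - R 1 2 2 3,
      R 0 2 0 3 + R 1 2 1 3, R 0 3 0 3 + R 1 3 1 3 + R 2 3 2 3]] := by
  funext b c
  fin_cases b <;> fin_cases c <;>
  · simp [ricOf, Fin.sum_univ_four, h.diag_left, h.diag_right, h.swap 1 0, h.swap 2 0, h.swap 3 0,
      h.swap 2 1, h.swap 3 1, h.swap 3 2, h.skew _ _ 1 0, h.skew _ _ 2 0, h.skew _ _ 3 0,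
      h.skew _ _ 2 1, h.skew _ _ 3 1, h.skew _ _ 3 2]
    try linarith [h.pair 0 2 1 2, h.pair 0 3 1 3, h.pair 0 3 2 3, h.pair 0 1 1 2, h.pair 0 1 1 3,
      h.pair 0 2 2 3, h.pair 0 1 0 2, h.pair 1 3 2 3, h.pair 0 1 0 3, h.pair 1 2 2 3,
      h.pair 0 2 0 3, h.pair 1 2 1 3]

/-- The nine entries of the block are independent linear combinations of the nine components of the
trace-free Ricci tensor. -/
theorem mixedBlock_eq_zero_iff (h : AlgCurv R) : (∀ i j, mixedBlock R i j = 0) ↔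
    ∃ l : ℝ, ∀ b c, ricOf R b c = if b = c then l else 0 := by
  rw [h.ricOf_eq]
  have hm : mixedBlock R = ![
      ![R 0 1 0 1 - R 2 3 2 3, R 0 1 0 2 - R 0 1 1 3 - R 0 2 2 3 + R 1 3 2 3,
        R 0 1 0 3 + R 0 1 1 2 - R 0 3 2 3 - R 1 2 2 3],
      ![R 0 1 0 2 + R 0 2 2 3 + R 0 1 1 3 + R 1 3 2 3, R 0 2 0 2 - R 1 3 1 3,
        R 0 2 0 3 + R 0 2 1 2 + R 0 3 1 3 + R 1 2 1 3],
      ![R 0 1 0 3 + R 0 3 2 3 - R 0 1 1 2 - R 1 2 2 3,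
        R 0 2 0 3 - R 0 3 1 3 - R 0 2 1 2 + R 1 2 1 3, R 0 3 0 3 - R 1 2 1 2]] := by
    funext i j
    fin_cases i <;> fin_cases j <;> simp [mixedBlock, sdPart, asdPart] <;>
      linarith [h.pair 0 2 1 2, h.pair 0 3 1 3, h.pair 0 3 2 3, h.pair 0 1 1 2, h.pair 0 1 1 3,
      h.pair 0 2 2 3, h.pair 0 1 0 2, h.pair 1 3 2 3, h.pair 0 1 0 3, h.pair 1 2 2 3,
      h.pair 0 2 0 3, h.pair 1 2 1 3, h.pair 0 1 2 3, h.pair 0 2 1 3, h.pair 0 3 1 2]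
  rw [hm]
  constructor
  · intro H
    have h00 := H 0 0
    have h01 := H 0 1
    have h02 := H 0 2
    have h10 := H 1 0
    have h11 := H 1 1
    have h12 := H 1 2
    have h20 := H 2 0
    have h21 := H 2 1
    have h22 := H 2 2
    simp at h00 h01 h02 h10 h11 h12 h20 h21 h22
    -- The factor is the component 00 of the Ricci tensor.
    refine ⟨R 0 1 0 1 + R 0 2 0 2 + R 0 3 0 3, fun b c => ?_⟩
    fin_cases b <;> fin_cases c <;> simp <;> linarith
  · rintro ⟨l, H⟩
    have h00 := H 0 0
    have h01 := H 0 1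
    have h02 := H 0 2
    have h03 := H 0 3
    have h11 := H 1 1
    have h12 := H 1 2
    have h13 := H 1 3
    have h22 := H 2 2
    have h23 := H 2 3
    have h33 := H 3 3
    simp at h00 h01 h02 h03 h11 h12 h13 h22 h23 h33
    intro i j
    fin_cases i <;> fin_cases j <;> simp <;> linarith

/-- The components of the block `Λ⁻ → Λ⁻`. -/
theorem asdBlock_eq (h : AlgCurv R) : asdBlock R = ![
    ![R 0 1 0 1 - 2 * R 0 1 2 3 + R 2 3 2 3, R 0 1 0 2 + R 0 1 1 3 - R 0 2 2 3 - R 1 3 2 3,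
      R 0 1 0 3 - R 0 1 1 2 - R 0 3 2 3 + R 1 2 2 3],
    ![R 0 1 0 2 - R 0 2 2 3 + R 0 1 1 3 - R 1 3 2 3, R 0 2 0 2 + 2 * R 0 2 1 3 + R 1 3 1 3,
      R 0 2 0 3 - R 0 2 1 2 + R 0 3 1 3 - R 1 2 1 3],
    ![R 0 1 0 3 - R 0 3 2 3 - R 0 1 1 2 + R 1 2 2 3,
      R 0 2 0 3 + R 0 3 1 3 - R 0 2 1 2 - R 1 2 1 3,
      R 0 3 0 3 - 2 * (R 0 2 1 3 - R 0 1 2 3) + R 1 2 1 2]] := by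
  funext i j
  fin_cases i <;> fin_cases j <;> simp [asdBlock, asdPart] <;>
    linarith [h.pair 0 2 1 2, h.pair 0 3 1 3, h.pair 0 3 2 3, h.pair 0 1 1 2, h.pair 0 1 1 3,
    h.pair 0 2 2 3, h.pair 0 1 0 2, h.pair 1 3 2 3, h.pair 0 1 0 3, h.pair 1 2 2 3,
    h.pair 0 2 0 3, h.pair 1 2 1 3, h.pair 0 1 2 3, h.pair 0 2 1 3, h.pair 0 3 1 2, h.bianchi]

theorem asdPart_weylOf_eq_zero (h : AlgCurv R) : IsScalarBlock (asdBlock R) →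
    ∀ i c d, asdPart (fun a b => weylOf R a b c d) i = 0 := by
  rintro ⟨l, H⟩
  rw [h.asdBlock_eq] at H
  have h00 := H 0 0
  have h01 := H 0 1
  have h02 := H 0 2
  have h11 := H 1 1
  have h12 := H 1 2
  have h22 := H 2 2
  simp at h00 h01 h02 h11 h12 h22
  intro i c d
  fin_cases i <;> fin_cases c <;> fin_cases d <;>
  · simp [asdPart, weylOf, h.ricOf_eq, Fin.sum_univ_four, h.diag_left, h.diag_right,
      h.skew _ _ 1 0, h.skew _ _ 2 0, h.skew _ _ 3 0, h.skew _ _ 2 1, h.skew _ _ 3 1,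
      h.skew _ _ 3 2, ← h.pair 0 1, ← h.pair 0 2 1 2, ← h.pair 0 3 1 3, ← h.pair 0 3 2 3,
      ← h.pair 0 2 2 3, ← h.pair 1 3 2 3, ← h.pair 1 2 2 3, ← h.pair 0 2 0 3, ← h.pair 1 2 1 3,
      ← h.pair 0 2 1 3, ← h.pair 0 3 1 2, h.bianchi]
    try linarith

theorem isScalarBlock_of_weylOf (h : AlgCurv R) :
    (∀ i c d, asdPart (fun a b => weylOf R a b c d) i = 0) → IsScalarBlock (asdBlock R) := by
  intro H
  rw [h.asdBlock_eq]
  have h001 := H 0 0 1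
  have h023 := H 0 2 3
  have h102 := H 1 0 2
  have h113 := H 1 1 3
  have h002 := H 0 0 2
  have h013 := H 0 1 3
  have h003 := H 0 0 3
  have h012 := H 0 1 2
  have h103 := H 1 0 3
  have h112 := H 1 1 2
  have h203 := H 2 0 3
  have h212 := H 2 1 2
  simp [asdPart, weylOf, h.ricOf_eq, Fin.sum_univ_four,
    h.skew _ _ 1 0, h.skew _ _ 2 0, h.skew _ _ 3 0, h.skew _ _ 2 1, h.skew _ _ 3 1,
    h.skew _ _ 3 2, ← h.pair 0 1, ← h.pair 0 2 1 2, ← h.pair 0 3 1 3, ← h.pair 0 3 2 3,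
    ← h.pair 0 2 2 3, ← h.pair 1 3 2 3, ← h.pair 1 2 2 3, ← h.pair 0 2 0 3, ← h.pair 1 2 1 3,
    ← h.pair 0 2 1 3, ← h.pair 0 3 1 2, h.bianchi]
    at h001 h023 h102 h113 h002 h013 h003 h012 h103 h112 h203 h212
  refine ⟨R 0 1 0 1 - 2 * R 0 1 2 3 + R 2 3 2 3, fun i j => ?_⟩
  fin_cases i <;> fin_cases j <;> simp <;> linarith

/-- On Λ⁻ the Weyl tensor has no component into Λ⁺, and its component into Λ⁻ is, up to sign, the
trace-free part of `asdBlock R`. -/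
theorem isScalarBlock_iff (h : AlgCurv R) : IsScalarBlock (asdBlock R) ↔
    ∀ i c d, asdPart (fun a b => weylOf R a b c d) i = 0 :=
  ⟨h.asdPart_weylOf_eq_zero, h.isScalarBlock_of_weylOf⟩

/-! ### Consequences of the vanishing of the curvature operator -/

section Vanishing

open MvPolynomial Complex

/-- The linear form with coefficients `α` in the unprimed variables. -/
def linXi (α : Fin 2 → ℂ) : SpinorPoly ℂ := ∑ A, C (α A) * xi A

/-- The linear form with coefficients `β` in the primed variables. -/
def linEta (β : Fin 2 → ℂ) : SpinorPoly ℂ := ∑ A, C (β A) * eta A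

theorem linXi_ne_zero {α : Fin 2 → ℂ} (hα : α ≠ 0) : linXi α ≠ 0 := by
  intro h0
  refine hα (_root_.funext fun A => ?_)
  have := congrArg (eval (Sum.elim (Pi.single A 1) 0)) h0
  fin_cases A <;> simpa [linXi, xi, Pi.single_apply] using this

theorem linEta_ne_zero {β : Fin 2 → ℂ} (hβ : β ≠ 0) : linEta β ≠ 0 := by
  intro h0
  refine hβ (_root_.funext fun A => ?_)
  have := congrArg (eval (Sum.elim 0 (Pi.single A 1))) h0
  fin_cases A <;> simpa [linEta, eta, Pi.single_apply] using this

theorem curvOp_linXi (α : Fin 2 → ℂ) : curvOp R (linXi α) = ∑ A, C (α A) * curvOp R (xi A) := by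
  simp [linXi, map_sum, Derivation.leibniz]

theorem curvOp_linEta (β : Fin 2 → ℂ) :
    curvOp R (linEta β) = ∑ A, C (β A) * curvOp R (eta A) := by
  simp [linEta, map_sum, Derivation.leibniz]

theorem curvOp_pow_mul_pow (k n : ℕ) (α β : Fin 2 → ℂ) :
    curvOp R (linXi α ^ (k + 1) * linEta β ^ (n + 1)) = linXi α ^ k * linEta β ^ n *
      (((k + 1 : ℕ) : SpinorPoly ℂ) * linEta β * curvOp R (linXi α)
        + ((n + 1 : ℕ) : SpinorPoly ℂ) * linXi α * curvOp R (linEta β)) := by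
  simp only [Derivation.leibniz, Derivation.leibniz_pow, smul_eq_mul, nsmul_eq_mul,
    Nat.add_sub_cancel]
  ring

/-- On unprimed spinors the curvature acts by trace-free matrices, that is, by quadratic forms, and
these are determined by the values of curvOp(α) at the zeros of α. Demanding no more allows use for
products, where a second term is a multiple of α. -/
theorem mixedBlock_eq_zero_of_eval (h : AlgCurv R)
    (H : ∀ α ξ η : Fin 2 → ℂ, α ≠ 0 → α 0 * ξ 0 + α 1 * ξ 1 = 0 → η ≠ 0 →
      eval (Sum.elim ξ η) (curvOp R (linXi α)) = 0) (i j : Fin 3) : mixedBlock R i j = 0 := by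
  have h1 : ∀ i, mixedBlock R i 0 = 0 ∧ mixedBlock R i 1 = 0 := by
    refine eq_zero_of_blockVal_comb fun η hη => ?_
    have := H ![1, 0] ![0, 1] η (fun h => by simpa using congrFun h 0) (by simp) hη
    simp [curvOp_linXi, Fin.sum_univ_two, h.eval_curvOp_xi_zero, h.eval_curvOp_xi_one] at this
    linear_combination this
  have h2 : ∀ η : Fin 2 → ℂ, η ≠ 0 → blockVal (mixedBlock R) η 2 = 0 := by
    intro η hη
    -- This choice gives 2 b_1 + 2i b_2 = 0 for the block values b_j, and b_1 = 0 is known.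
    have := H ![1, 1] ![1, -1] η (fun h => by simpa using congrFun h 0) (by simp) hη
    have h0 : blockVal (mixedBlock R) η 1 = 0 := by simp [blockVal, h1]
    simp [curvOp_linXi, Fin.sum_univ_two, h.eval_curvOp_xi_zero, h.eval_curvOp_xi_one] at this
    linear_combination -I / 2 * this + I * h0 + blockVal (mixedBlock R) η 2 * I_mul_I
  have h3 : mixedBlock R i 2 = 0 :=
    eq_zero_of_blockVal (h2 _ fun h => by simpa using congrFun h 0)
      (h2 _ fun h => by simpa using congrFun h 1) (h2 _ fun h => by simpa using congrFun h 0) i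
  fin_cases j
  · exact (h1 i).1
  · exact (h1 i).2
  · exact h3

theorem mixedBlock_eq_zero_of_curvOp_pow (h : AlgCurv R) {k : ℕ} (hk : 1 ≤ k)
    (H : ∀ α, curvOp R (linXi α ^ k) = 0) (i j : Fin 3) : mixedBlock R i j = 0 := by
  obtain ⟨k, rfl⟩ := Nat.exists_eq_add_of_le' hk
  refine h.mixedBlock_eq_zero_of_eval (fun α ξ η hα _ _ => ?_) i j
  have h0 := H α
  rw [Derivation.leibniz_pow, Nat.add_sub_cancel, smul_eq_mul, nsmul_eq_mul] at h0
  rw [((mul_eq_zero.1 ((mul_eq_zero.1 h0).resolve_left (Nat.cast_ne_zero.2 k.succ_ne_zero)))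
    ).resolve_left (pow_ne_zero _ (linXi_ne_zero hα)), map_zero]

theorem isScalarBlock_of_curvOp_pow (h : AlgCurv R) {n : ℕ} (hn : 1 ≤ n)
    (H : ∀ β, curvOp R (linEta β ^ n) = 0) : IsScalarBlock (asdBlock R) := by
  obtain ⟨n, rfl⟩ := Nat.exists_eq_add_of_le' hn
  have hβ : (![1, 0] : Fin 2 → ℂ) ≠ 0 := fun h => by simpa using congrFun h 0
  have h0 := H ![1, 0]
  rw [Derivation.leibniz_pow, Nat.add_sub_cancel, smul_eq_mul, nsmul_eq_mul] at h0
  have h1 := (mul_eq_zero.1 ((mul_eq_zero.1 h0).resolve_left (Nat.cast_ne_zero.2 n.succ_ne_zero))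
    ).resolve_left (pow_ne_zero _ (linEta_ne_zero hβ))
  refine h.isScalarBlock ?_
  simpa [curvOp_linEta, Fin.sum_univ_two] using h1

theorem blocks_of_curvOp_pow_mul_pow (h : AlgCurv R) {k n : ℕ} (hk : 1 ≤ k) (hn : 1 ≤ n)
    (H : ∀ α β, curvOp R (linXi α ^ k * linEta β ^ n) = 0) :
    (∀ i j, mixedBlock R i j = 0) ∧ IsScalarBlock (asdBlock R) := by
  obtain ⟨k, rfl⟩ := Nat.exists_eq_add_of_le' hk
  obtain ⟨n, rfl⟩ := Nat.exists_eq_add_of_le' hn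
  have H' : ∀ α β : Fin 2 → ℂ, α ≠ 0 → β ≠ 0 →
      ((k + 1 : ℕ) : SpinorPoly ℂ) * linEta β * curvOp R (linXi α)
        + ((n + 1 : ℕ) : SpinorPoly ℂ) * linXi α * curvOp R (linEta β) = 0 := fun α β hα hβ =>
    (mul_eq_zero.1 ((curvOp_pow_mul_pow k n α β).symm.trans (H α β))).resolve_left
      (mul_ne_zero (pow_ne_zero _ (linXi_ne_zero hα)) (pow_ne_zero _ (linEta_ne_zero hβ)))
  have hB : ∀ i j, mixedBlock R i j = 0 := by
    refine h.mixedBlock_eq_zero_of_eval fun α ξ η hα hαξ hη => ?_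
    -- With β a coordinate form that does not vanish at η, and ξ a zero of α, only the term with
    -- curvOp(α) survives.
    obtain ⟨A, hA⟩ := Function.ne_iff.1 hη
    have hβ : (Pi.single A 1 : Fin 2 → ℂ) ≠ 0 := by simp
    have h0 := congrArg (eval (Sum.elim ξ η)) (H' α (Pi.single A 1) hα hβ)
    have hl : eval (Sum.elim ξ η) (linXi α) = 0 := by
      simpa [linXi, xi, Fin.sum_univ_two] using hαξ
    have hm : eval (Sum.elim ξ η) (linEta (Pi.single A 1)) = η A := by
      simp [linEta, eta, Pi.single_apply]
    rw [map_add, map_mul, map_mul, map_mul, map_mul, hl, hm, mul_zero, zero_mul, add_zero,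
      map_natCast, map_zero] at h0
    exact (mul_eq_zero.1 h0).resolve_left
      (mul_ne_zero (Nat.cast_ne_zero.2 k.succ_ne_zero) (by simpa using hA))
  refine ⟨hB, h.isScalarBlock ?_⟩
  have hα : (![1, 0] : Fin 2 → ℂ) ≠ 0 := fun h => by simpa using congrFun h 0
  have h0 := H' ![1, 0] ![1, 0] hα hα
  rw [curvOp_linXi, Finset.sum_eq_zero (fun A _ => by rw [h.curvOp_xi_eq_zero hB, mul_zero]),
    mul_zero, zero_add] at h0
  have h1 := (mul_eq_zero.1 h0).resolve_left
    (mul_ne_zero (Nat.cast_ne_zero.2 n.succ_ne_zero) (linXi_ne_zero hα))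
  simpa [curvOp_linEta, Fin.sum_univ_two] using h1

end Vanishing

end AlgCurv

/-! ### Vanishing of the curvature operator on arrays -/

theorem derivation_prod_eq_zero {K A : Type*} [CommRing K] [CommRing A] [Algebra K A]
    (D : Derivation K A A) {m : ℕ} (f : Fin m → A) (hf : ∀ s, D (f s) = 0) : D (∏ s, f s) = 0 := by
  rw [derivation_prod]
  exact Finset.sum_eq_zero fun s _ => by rw [hf s, mul_zero]

/-- A derivation is controlled by the variables that occur. The conditions `1 ≤ k` and `1 ≤ n` let
the pure cases use one curvature condition alone. -/
theorem curvOp_toPoly_eq_zero {R : Fin 4 → Fin 4 → Fin 4 → Fin 4 → ℝ} {k n : ℕ}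
    (hξ : 1 ≤ k → ∀ B, curvOp R (xi B) = 0) (hη : 1 ≤ n → ∀ B, curvOp R (eta B) = 0)
    (T : SpinorArray ℂ k n) : curvOp R (toPoly T) = 0 := by
  simp only [toPoly, map_sum]
  refine Finset.sum_eq_zero fun A _ => Finset.sum_eq_zero fun A' _ => ?_
  have h1 : curvOp R (∏ s, xi (A s)) = 0 :=
    derivation_prod_eq_zero _ _ fun s => hξ (Fin.pos s) _
  have h2 : curvOp R (∏ t, eta (A' t)) = 0 :=
    derivation_prod_eq_zero _ _ fun s => hη (Fin.pos s) _
  simp only [Derivation.leibniz, h1, h2, smul_zero, add_zero, zero_add]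
  rw [← MvPolynomial.algebraMap_eq, Derivation.map_algebraMap, smul_zero]

end SpinorDiagram

end

noncomputable section

namespace SpinorDiagram

/-! ### Curvature tensors in coordinates -/

section Coordinates

/-- A covariant 4-tensor in coordinates. -/
def quad (p q r s : Fin 4 → ℝ) (T : Fin 4 → Fin 4 → Fin 4 → Fin 4 → ℝ) : ℝ :=
  ∑ a, ∑ b, ∑ c, ∑ d, p a * q b * r c * s d * T a b c d

/-- A covariant 2-tensor in coordinates. -/
def bil (p q : Fin 4 → ℝ) (P : Fin 4 → Fin 4 → ℝ) : ℝ := ∑ a, ∑ b, p a * q b * P a b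

variable (p q r s : Fin 4 → ℝ)

theorem quad_outer (P Q : Fin 4 → Fin 4 → ℝ) :
    quad p q r s (fun a b c d => P b c * Q a d) = bil q r P * bil p s Q := by
  have h : bil q r P * bil p s Q
      = ∑ a, ∑ d, ∑ b, ∑ c, q b * r c * P b c * (p a * s d * Q a d) := by
    simp only [bil, Finset.sum_mul, Finset.mul_sum]
  rw [h, quad]
  refine Finset.sum_congr rfl fun a _ => ?_
  rw [Finset.sum_congr rfl fun b _ => Finset.sum_comm, Finset.sum_comm]
  exact Finset.sum_congr rfl fun d _ => Finset.sum_congr rfl fun b _ =>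
    Finset.sum_congr rfl fun c _ => by ring

theorem quad_cross (P Q : Fin 4 → Fin 4 → ℝ) :
    quad p q r s (fun a b c d => P a c * Q b d) = bil p r P * bil q s Q := by
  have h : bil p r P * bil q s Q
      = ∑ b, ∑ d, ∑ a, ∑ c, p a * r c * P a c * (q b * s d * Q b d) := by
    simp only [bil, Finset.sum_mul, Finset.mul_sum]
  rw [h, quad, Finset.sum_comm]
  refine Finset.sum_congr rfl fun b _ => ?_
  rw [Finset.sum_congr rfl fun a _ => Finset.sum_comm, Finset.sum_comm]
  exact Finset.sum_congr rfl fun d _ => Finset.sum_congr rfl fun a _ =>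
    Finset.sum_congr rfl fun c _ => by ring

theorem quad_add (T T' : Fin 4 → Fin 4 → Fin 4 → Fin 4 → ℝ) :
    quad p q r s (fun a b c d => T a b c d + T' a b c d) = quad p q r s T + quad p q r s T' := by
  simp only [quad, mul_add, Finset.sum_add_distrib]

theorem quad_smul (k : ℝ) (T : Fin 4 → Fin 4 → Fin 4 → Fin 4 → ℝ) :
    quad p q r s (fun a b c d => k * T a b c d) = k * quad p q r s T := by
  simp only [quad, Finset.mul_sum]
  exact Finset.sum_congr rfl fun a _ => Finset.sum_congr rfl fun b _ =>
    Finset.sum_congr rfl fun c _ => Finset.sum_congr rfl fun d _ => by ring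

theorem quad_eq_bil (T : Fin 4 → Fin 4 → Fin 4 → Fin 4 → ℝ) :
    quad p q r s T = bil p q fun a b => bil r s (T a b) := by
  simp only [quad, bil, Finset.mul_sum]
  exact Finset.sum_congr rfl fun a _ => Finset.sum_congr rfl fun b _ =>
    Finset.sum_congr rfl fun c _ => Finset.sum_congr rfl fun d _ => by ring

theorem quad_weylOf (R : Fin 4 → Fin 4 → Fin 4 → Fin 4 → ℝ) {δ : Fin 4 → Fin 4 → ℝ}
    (hδ : δ = fun a b => if a = b then 1 else 0) :
    quad p q r s (weylOf R) = quad p q r s (fun a b c d => R a b d c)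
      - (bil q r (ricOf R) * bil p s δ + bil q r δ * bil p s (ricOf R)
        - bil p r (ricOf R) * bil q s δ - bil p r δ * bil q s (ricOf R)) / 2
      + (∑ i, ricOf R i i) / 6 * (bil q r δ * bil p s δ - bil p r δ * bil q s δ) := by
  have h : weylOf R = fun a b c d => R a b d c + (-1 / 2 * (ricOf R b c * δ a d)
      + (-1 / 2 * (δ b c * ricOf R a d) + (1 / 2 * (ricOf R a c * δ b d)
      + (1 / 2 * (δ a c * ricOf R b d) + ((∑ i, ricOf R i i) / 6 * (δ b c * δ a d)
      + -((∑ i, ricOf R i i) / 6) * (δ a c * δ b d)))))) := by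
    subst hδ
    funext a b c d
    simp only [weylOf]
    ring
  rw [h]
  simp only [quad_add, quad_smul, quad_outer, quad_cross]
  ring

/-- The wedge product of two vectors. -/
def wedge (a b : Fin 4) : ℝ := p a * q b - p b * q a

/-- The Hodge dual of the wedge product of two vectors. -/
def starWedge : Fin 4 → Fin 4 → ℝ :=
  ![![0, wedge p q 2 3, -wedge p q 1 3, wedge p q 1 2],
    ![-wedge p q 2 3, 0, wedge p q 0 3, -wedge p q 0 2],
    ![wedge p q 1 3, -wedge p q 0 3, 0, wedge p q 0 1],
    ![-wedge p q 1 2, wedge p q 0 2, -wedge p q 0 1, 0]]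

theorem det_eq_bil_starWedge :
    Matrix.det (Matrix.of fun i j => (![p, q, r, s] : Fin 4 → Fin 4 → ℝ) j i)
      = bil r s (starWedge p q) := by
  simp [Matrix.det_succ_row_zero, Fin.sum_univ_succ, bil, starWedge, wedge, Fin.succAbove]
  ring

/-- The operator 1 - ⋆ is twice the projection to Λ⁻, so only the anti-self-dual parts are paired.
-/
theorem bil_sub_starWedge {T : Fin 4 → Fin 4 → ℝ} (hT : ∀ a b, T a b = -T b a) :
    bil p q T - (∑ a, ∑ b, starWedge p q a b * T a b) / 2
      = ∑ i, asdPart (wedge p q) i * asdPart T i := by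
  have hd : ∀ a, T a a = 0 := fun a => by linarith [hT a a]
  simp [bil, starWedge, Fin.sum_univ_four, Fin.sum_univ_three, asdPart, wedge, hd, hT 1 0, hT 2 0,
    hT 3 0, hT 2 1, hT 3 1, hT 3 2]
  ring

theorem asdPart_bil (T : Fin 4 → Fin 4 → Fin 4 → Fin 4 → ℝ) (i : Fin 3) :
    asdPart (fun a b => bil r s (T a b)) i
      = bil r s fun c d => asdPart (fun a b => T a b c d) i := by
  fin_cases i <;> simp [asdPart, bil, mul_add, mul_sub, Finset.sum_add_distrib]

end Coordinates

/-! ### Traces computed in different orthonormal bases -/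

section Trace

variable {O : Fin 4 → Fin 4 → ℝ}

theorem sum_mul_sum_of_orthogonal (hO : ∀ a b, ∑ i, O i a * O i b = if a = b then 1 else 0)
    (f g : Fin 4 → ℝ) :
    ∑ i, (∑ a, O i a * f a) * (∑ b, O i b * g b) = ∑ a, f a * g a := by
  simp only [Finset.sum_mul_sum]
  rw [Finset.sum_comm]
  refine Finset.sum_congr rfl fun a _ => ?_
  rw [Finset.sum_comm]
  have h : ∀ b, ∑ i, O i a * f a * (O i b * g b) = (if a = b then 1 else 0) * (f a * g b) := by
    intro b
    rw [← hO a b, Finset.sum_mul]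
    exact Finset.sum_congr rfl fun i _ => by ring
  simp [h]

theorem sum_bil_of_orthogonal (hO : ∀ a b, ∑ i, O i a * O i b = if a = b then 1 else 0)
    (P : Fin 4 → Fin 4 → ℝ) : ∑ i, bil (O i) (O i) P = ∑ a, P a a := by
  simp only [bil]
  rw [Finset.sum_comm]
  refine Finset.sum_congr rfl fun a _ => ?_
  rw [Finset.sum_comm]
  have h : ∀ b, ∑ i, O i a * O i b * P a b = (if a = b then 1 else 0) * P a b := by
    intro b
    rw [← hO a b, Finset.sum_mul]
  simp [h]

theorem sum_bil_mul_bil_of_orthogonal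
    (hO : ∀ a b, ∑ i, O i a * O i b = if a = b then 1 else 0) (P Q : Fin 4 → Fin 4 → ℝ) :
    ∑ i, ∑ j, bil (O i) (O j) P * bil (O i) (O j) Q = ∑ a, ∑ b, P a b * Q a b := by
  have hb : ∀ i j P, bil (O i) (O j) P = ∑ b, O j b * ∑ a, O i a * P a b := by
    intro i j P
    simp only [bil, Finset.mul_sum]
    rw [Finset.sum_comm]
    exact Finset.sum_congr rfl fun a _ => Finset.sum_congr rfl fun b _ => by ring
  simp only [hb, sum_mul_sum_of_orthogonal hO]
  rw [Finset.sum_comm]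
  simp only [sum_mul_sum_of_orthogonal hO]
  exact Finset.sum_comm

end Trace

/-! ### The curvature tensors of the manifold in an orthonormal frame -/

section Geometry

variable {M : Type*} [TopologicalSpace M] [ChartedSpace E4 M] [IsManifold 𝓘(ℝ, E4) ∞ M]
  [RiemannianBundle (fun x : M => TangentSpace 𝓘(ℝ, E4) x)]
  [IsContMDiffRiemannianBundle 𝓘(ℝ, E4) ∞ E4 (fun x : M => TangentSpace 𝓘(ℝ, E4) x)]

namespace OrthonormalFrameOn

variable {e : Fin 4 → VField M} {U : Set M}

/-- The coordinates of a tangent vector. -/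
def coord (e : Fin 4 → VField M) (x : M) (u : TangentSpace 𝓘(ℝ, E4) x) (a : Fin 4) : ℝ :=
  inner ℝ (e a x) u

theorem algCurv (F : OrthonormalFrameOn e U) {x : M} (hx : x ∈ U) : AlgCurv (riemAt e x) :=
  ⟨F.frameRiem_swap hx, F.frameRiem_skew hx, F.frameRiem_cyclic hx⟩

theorem coord_frame (F : OrthonormalFrameOn e U) {x : M} (hx : x ∈ U) (a : Fin 4) :
    coord e x (e a x) = Pi.single a 1 := by
  funext b
  rw [coord, F.inner_frame hx, Pi.single_apply]

theorem sum_onb (F : OrthonormalFrameOn e U) {x : M} (hx : x ∈ U) (a b : Fin 4) :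
    ∑ i, coord e x (onb x i) a * coord e x (onb x i) b = if a = b then 1 else 0 := by
  rw [← F.inner_frame hx a b, ← (onb x).sum_inner_mul_inner]
  exact Finset.sum_congr rfl fun i _ => by rw [coord, coord, real_inner_comm _ (e b x)]

theorem riem_eq_quad (F : OrthonormalFrameOn e U) {x : M} (hx : x ∈ U)
    (u v w z : TangentSpace 𝓘(ℝ, E4) x) :
    riem x u v w z = quad (coord e x u) (coord e x v) (coord e x w) (coord e x z)
      fun a b c d => riemAt e x a b d c :=
  F.riem_eq hx u v w z

theorem inner_eq_bil (F : OrthonormalFrameOn e U) {x : M} (hx : x ∈ U)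
    (u v : TangentSpace 𝓘(ℝ, E4) x) :
    inner ℝ u v = bil (coord e x u) (coord e x v) fun a b => if a = b then 1 else 0 := by
  rw [F.inner_eq hx]
  simp [bil, coord]

theorem ric_eq_bil (F : OrthonormalFrameOn e U) {x : M} (hx : x ∈ U)
    (u v : TangentSpace 𝓘(ℝ, E4) x) :
    ric x u v = bil (coord e x u) (coord e x v) (ricOf (riemAt e x)) := by
  have h : ∀ i, riem x (onb x i) u v (onb x i) = bil (coord e x (onb x i)) (coord e x (onb x i))
      fun a d => bil (coord e x u) (coord e x v) fun b c => riemAt e x a b d c := by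
    intro i
    rw [F.riem_eq_quad hx]
    simp only [quad, bil, Finset.mul_sum]
    refine Finset.sum_congr rfl fun a _ => ?_
    rw [Finset.sum_congr rfl fun b _ => Finset.sum_comm, Finset.sum_comm]
    exact Finset.sum_congr rfl fun d _ => Finset.sum_congr rfl fun b _ =>
      Finset.sum_congr rfl fun c _ => by ring
  simp only [ric, h]
  rw [sum_bil_of_orthogonal (F.sum_onb hx)]
  simp only [bil, ricOf, Finset.mul_sum]
  rw [Finset.sum_comm]
  exact Finset.sum_congr rfl fun b _ => Finset.sum_comm

theorem scal_eq (F : OrthonormalFrameOn e U) {x : M} (hx : x ∈ U) :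
    scal x = ∑ i, ricOf (riemAt e x) i i := by
  simp only [scal, F.ric_eq_bil hx]
  exact sum_bil_of_orthogonal (F.sum_onb hx) _

theorem weyl_eq_quad (F : OrthonormalFrameOn e U) {x : M} (hx : x ∈ U)
    (u v w z : TangentSpace 𝓘(ℝ, E4) x) :
    weyl x u v w z = quad (coord e x u) (coord e x v) (coord e x w) (coord e x z)
      (weylOf (riemAt e x)) := by
  rw [quad_weylOf _ _ _ _ _ rfl, weyl, F.riem_eq_quad hx, F.scal_eq hx]
  simp only [F.ric_eq_bil hx, F.inner_eq_bil hx]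

theorem volumeForm_eq (F : OrthonormalFrameOn e U) {x : M} (hx : x ∈ U)
    {o : Orientation ℝ (TangentSpace 𝓘(ℝ, E4) x) (Fin 4)}
    (ho : o.volumeForm (fun a => e a x) = 1) (u v w z : TangentSpace 𝓘(ℝ, E4) x) :
    o.volumeForm ![u, v, w, z] = bil (coord e x w) (coord e x z)
      (starWedge (coord e x u) (coord e x v)) := by
  have hb : (fun a => e a x) = F.basis hx := funext fun a => (F.basis_apply hx a).symm
  have hor : (F.basis hx).toBasis.orientation = o := by
    -- For the opposite orientation the volume form of the frame would be -1.
    by_contra hne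
    rw [o.volumeForm_robust_neg (F.basis hx) hne, hb] at ho
    have h1 : (F.basis hx).toBasis.det (F.basis hx) = 1 := by
      rw [← OrthonormalBasis.coe_toBasis]; exact (F.basis hx).toBasis.det_self
    rw [AlternatingMap.neg_apply, h1] at ho
    norm_num at ho
  rw [o.volumeForm_robust (F.basis hx) hor, Module.Basis.det_apply, ← det_eq_bil_starWedge]
  refine congrArg Matrix.det (Matrix.ext fun i j => ?_)
  rw [Module.Basis.toMatrix_apply, OrthonormalBasis.coe_toBasis_repr_apply,
    OrthonormalBasis.repr_apply_apply, F.basis_apply hx]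
  fin_cases j <;> rfl

theorem weylMinus_eq (F : OrthonormalFrameOn e U) {x : M} (hx : x ∈ U)
    {o : Orientation ℝ (TangentSpace 𝓘(ℝ, E4) x) (Fin 4)}
    (ho : o.volumeForm (fun a => e a x) = 1) (u v w z : TangentSpace 𝓘(ℝ, E4) x) :
    weylMinus x o u v w z = (∑ i, asdPart (wedge (coord e x u) (coord e x v)) i
      * bil (coord e x w) (coord e x z)
        fun c d => asdPart (fun a b => weylOf (riemAt e x) a b c d) i) / 2 := by
  have hs : ∀ a b c d, weylOf (riemAt e x) a b c d = -weylOf (riemAt e x) b a c d := by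
    intro a b c d
    simp only [weylOf, (F.algCurv hx).swap a b d c]
    ring
  simp only [weylMinus, starWeyl, F.weyl_eq_quad hx, F.volumeForm_eq hx ho, quad_eq_bil]
  rw [sum_bil_mul_bil_of_orthogonal (F.sum_onb hx), bil_sub_starWedge]
  · simp only [asdPart_bil]
  · intro a b
    simp only [bil, ← Finset.sum_neg_distrib]
    exact Finset.sum_congr rfl fun c _ => Finset.sum_congr rfl fun d _ => by rw [hs a b]; ring

theorem bil_single (a b : Fin 4) (P : Fin 4 → Fin 4 → ℝ) :
    bil (Pi.single a 1) (Pi.single b 1) P = P a b := by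
  rw [bil, Finset.sum_eq_single a, Finset.sum_eq_single b] <;>
    simp +contextual [Pi.single_apply]

theorem weylMinus_eq_zero_iff (F : OrthonormalFrameOn e U) {x : M} (hx : x ∈ U)
    {o : Orientation ℝ (TangentSpace 𝓘(ℝ, E4) x) (Fin 4)}
    (ho : o.volumeForm (fun a => e a x) = 1) :
    (∀ u v w z, weylMinus x o u v w z = 0) ↔ IsScalarBlock (asdBlock (riemAt e x)) := by
  rw [(F.algCurv hx).isScalarBlock_iff]
  constructor
  · intro h i c d
    -- For b = 1, 2, 3 the bivector e_0 ∧ e_b has exactly one nonzero entry in `asdPart`, so it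
    -- isolates one component.
    have key : ∀ b, (∑ i, asdPart (wedge (Pi.single 0 1) (Pi.single b 1)) i
        * asdPart (fun a b => weylOf (riemAt e x) a b c d) i) / 2 = 0 := by
      intro b
      have := h (e 0 x) (e b x) (e c x) (e d x)
      simpa only [F.weylMinus_eq hx ho, F.coord_frame hx, bil_single] using this
    have h1 := key 1
    have h2 := key 2
    have h3 := key 3
    simp [Fin.sum_univ_three, asdPart.eq_1 (wedge _ _), wedge] at h1 h2 h3
    fin_cases i
    · exact h1
    · exact h2
    · exact h3
  · intro h u v w z
    rw [F.weylMinus_eq hx ho]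
    simp [h, bil]

theorem ric_eq_smul_iff (F : OrthonormalFrameOn e U) {x : M} (hx : x ∈ U) :
    (∃ l : ℝ, ∀ u v : TangentSpace 𝓘(ℝ, E4) x, ric x u v = l * inner ℝ u v)
      ↔ ∀ i j, mixedBlock (riemAt e x) i j = 0 := by
  rw [(F.algCurv hx).mixedBlock_eq_zero_iff]
  refine exists_congr fun l => ⟨fun h b c => ?_, fun h u v => ?_⟩
  · have := h (e b x) (e c x)
    rw [F.ric_eq_bil hx, F.inner_frame hx, F.coord_frame hx, F.coord_frame hx, bil_single] at this
    rw [this]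
    split_ifs <;> simp
  · rw [F.ric_eq_bil hx, F.inner_eq_bil hx]
    simp only [bil, h, Finset.mul_sum]
    exact Finset.sum_congr rfl fun b _ => Finset.sum_congr rfl fun c _ => by
      split_ifs <;> ring

end OrthonormalFrameOn

end Geometry

end SpinorDiagram

end

noncomputable section

namespace SpinorDiagram

/-! ### Decomposable sections -/

/-- The symmetric array `t αᵏ βⁿ`. -/
def decomposable (k n : ℕ) (t : ℂ) (α β : Fin 2 → ℂ) : Spinor k n :=
  fun A A' => t * ((∏ s, α (A s)) * ∏ r, β (A' r))

theorem decomposable_symm {k n : ℕ} (t : ℂ) (α β : Fin 2 → ℂ) (τ : Equiv.Perm (Fin k))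
    (ρ : Equiv.Perm (Fin n)) (A : Fin k → Fin 2) (A' : Fin n → Fin 2) :
    decomposable k n t α β (A ∘ τ) (A' ∘ ρ) = decomposable k n t α β A A' := by
  simp only [decomposable, Function.comp_apply]
  rw [Equiv.prod_comp τ fun s => α (A s), Equiv.prod_comp ρ fun s => β (A' s)]

theorem spinAct_decomposable {k n : ℕ} (p q : Matrix (Fin 2) (Fin 2) ℂ) (t : ℂ)
    (α β : Fin 2 → ℂ) :
    spinAct p q (decomposable k n t α β) = decomposable k n t (p.mulVec α) (q.mulVec β) := by
  funext A A'
  simp only [spinAct, decomposable, Matrix.mulVec, dotProduct]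
  rw [Fintype.prod_sum, Fintype.prod_sum, Finset.sum_mul_sum, Finset.mul_sum]
  refine Finset.sum_congr rfl fun B _ => ?_
  rw [Finset.mul_sum]
  refine Finset.sum_congr rfl fun B' _ => ?_
  rw [Finset.prod_mul_distrib, Finset.prod_mul_distrib]
  ring

theorem toPoly_decomposable (k n : ℕ) (α β : Fin 2 → ℂ) :
    toPoly (decomposable k n 1 α β) = AlgCurv.linXi α ^ k * AlgCurv.linEta β ^ n := by
  have hx : AlgCurv.linXi α ^ k = ∏ _s : Fin k, AlgCurv.linXi α := by simp
  have hy : AlgCurv.linEta β ^ n = ∏ _s : Fin n, AlgCurv.linEta β := by simp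
  rw [hx, hy]
  simp only [AlgCurv.linXi, AlgCurv.linEta, Fintype.prod_sum, Finset.sum_mul_sum, toPoly,
    decomposable]
  refine Finset.sum_congr rfl fun A _ => Finset.sum_congr rfl fun A' _ => ?_
  rw [Finset.prod_mul_distrib, Finset.prod_mul_distrib, one_mul, map_mul, map_prod, map_prod]
  ring

/-! ### Sections with prescribed values and the equivalences -/

section Sections

variable {M : Type*} [TopologicalSpace M] [T2Space M] [ChartedSpace E4 M]
  [IsManifold 𝓘(ℝ, E4) ∞ M] [RiemannianBundle (fun x : M => TangentSpace 𝓘(ℝ, E4) x)]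

theorem exists_bump {U : Set M} (hU : IsOpen U) {x : M} (hx : x ∈ U) :
    ∃ χ : M → ℝ, ContMDiff 𝓘(ℝ, E4) 𝓘(ℝ, ℝ) ∞ χ ∧ tsupport χ ⊆ U ∧ χ x = 1 := by
  obtain ⟨f, -, hf⟩ :=
    (SmoothBumpFunction.nhds_basis_tsupport (I := 𝓘(ℝ, E4)) x).mem_iff.1 (hU.mem_nhds hx)
  exact ⟨f, f.contMDiff, hf, f.eq_one⟩

namespace SpinStructure

variable {o : (x : M) → Orientation ℝ (TangentSpace 𝓘(ℝ, E4) x) (Fin 4)} {ι : Type*}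
  (S : SpinStructure M o ι)

/-- The section `χ αᵏ βⁿ`, with `α` and `β` constant in the patch `i₀`. -/
def decomposableField (k n : ℕ) (i₀ : ι) (χ : M → ℝ) (α β : Fin 2 → ℂ) : S.Field k n :=
  open Classical in fun j y => if y ∈ S.dom i₀ then
    decomposable k n (χ y) ((S.plus j i₀ y).mulVec α) ((S.minus j i₀ y).mulVec β) else 0

theorem isSection_decomposableField (k n : ℕ) (i₀ : ι) {χ : M → ℝ}
    (hχ : ContMDiff 𝓘(ℝ, E4) 𝓘(ℝ, ℝ) ∞ χ) (hs : tsupport χ ⊆ S.dom i₀) (α β : Fin 2 → ℂ) :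
    S.IsSection (S.decomposableField k n i₀ χ α β) where
  smooth j A A' := by
    have hc : ContMDiff 𝓘(ℝ, E4) 𝓘(ℝ, ℂ) ∞ (fun y => (χ y : ℂ)) :=
      Complex.ofRealCLM.contMDiff.comp hχ
    have hp : ∀ B, ContMDiffOn 𝓘(ℝ, E4) 𝓘(ℝ, ℂ) ∞ (fun y => (S.plus j i₀ y).mulVec α B)
        (S.dom j ∩ S.dom i₀) := fun B => by
      have := ((contMDiffOn_mul (S.plus_smooth j i₀ B 0) (contMDiffOn_const (c := α 0))).add
        (contMDiffOn_mul (S.plus_smooth j i₀ B 1) (contMDiffOn_const (c := α 1))))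
      exact this.congr fun y _ => by simp [Matrix.mulVec, dotProduct, Fin.sum_univ_two]
    have hm : ∀ B, ContMDiffOn 𝓘(ℝ, E4) 𝓘(ℝ, ℂ) ∞ (fun y => (S.minus j i₀ y).mulVec β B)
        (S.dom j ∩ S.dom i₀) := fun B => by
      have := ((contMDiffOn_mul (S.minus_smooth j i₀ B 0) (contMDiffOn_const (c := β 0))).add
        (contMDiffOn_mul (S.minus_smooth j i₀ B 1) (contMDiffOn_const (c := β 1))))
      exact this.congr fun y _ => by simp [Matrix.mulVec, dotProduct, Fin.sum_univ_two]
    have hprod : ∀ {m : ℕ} {f : Fin m → M → ℂ}, (∀ s, ContMDiffOn 𝓘(ℝ, E4) 𝓘(ℝ, ℂ) ∞ (f s)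
        (S.dom j ∩ S.dom i₀)) → ContMDiffOn 𝓘(ℝ, E4) 𝓘(ℝ, ℂ) ∞ (fun y => ∏ s, f s y)
        (S.dom j ∩ S.dom i₀) := by
      intro m f hf
      induction m with
      | zero => simpa using contMDiffOn_const
      | succ m ih =>
        simp only [Fin.prod_univ_succ]
        exact contMDiffOn_mul (hf 0) (ih fun s => hf s.succ)
    have hall := contMDiffOn_mul (hc.contMDiffOn (s := S.dom j ∩ S.dom i₀))
      (contMDiffOn_mul (hprod fun s => hp (A s)) (hprod fun s => hm (A' s)))
    intro y hy
    by_cases hy0 : y ∈ S.dom i₀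
    · have hV : S.dom j ∩ S.dom i₀ ∈ nhds y :=
        ((S.isOpen_dom j).inter (S.isOpen_dom i₀)).mem_nhds ⟨hy, hy0⟩
      refine ((hall.contMDiffAt hV).congr_of_eventuallyEq ?_).contMDiffWithinAt
      refine Filter.eventuallyEq_of_mem hV fun z hz => ?_
      simp only [decomposableField, if_pos hz.2, decomposable]
    -- Off the patch `i₀` the point has a neighbourhood where χ vanishes, so the extension by zero
    -- is smooth there.
    · have hV : (tsupport χ)ᶜ ∈ nhds y :=
        (isClosed_tsupport χ).isOpen_compl.mem_nhds fun h => hy0 (hs h)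
      refine ((contMDiffAt_const (c := (0 : ℂ))).congr_of_eventuallyEq ?_).contMDiffWithinAt
      refine Filter.eventuallyEq_of_mem hV fun z hz => ?_
      have hz0 : χ z = 0 := image_eq_zero_of_notMem_tsupport hz
      simp only [decomposableField, decomposable, hz0]
      split_ifs <;> simp [decomposable]
  symm j y _ τ ρ A A' := by
    simp only [decomposableField]
    split_ifs
    · exact decomposable_symm _ _ _ τ ρ A A'
    · rfl
  compat i j y hy := by
    simp only [decomposableField]
    split_ifs with h0
    · rw [spinAct_decomposable, Matrix.mulVec_mulVec, Matrix.mulVec_mulVec,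
        S.plus_cocycle i j i₀ y ⟨hy, h0⟩, S.minus_cocycle i j i₀ y ⟨hy, h0⟩]
    · funext A A'
      simp [spinAct]

theorem eq_one_of_mul_self {p : Matrix (Fin 2) (Fin 2) ℂ}
    (hp : p ∈ Matrix.specialUnitaryGroup (Fin 2) ℂ) (h : p * p = p) : p = 1 := by
  have hu := (Matrix.mem_unitaryGroup_iff'.1 (Matrix.mem_specialUnitaryGroup_iff.1 hp).1)
  calc p = star p * p * p := by rw [hu, one_mul]
    _ = 1 := by rw [mul_assoc, h, hu]

theorem decomposableField_self (k n : ℕ) {i₀ : ι} {χ : M → ℝ} (α β : Fin 2 → ℂ) {x : M}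
    (hx : x ∈ S.dom i₀) (hχ : χ x = 1) :
    S.decomposableField k n i₀ χ α β i₀ x = decomposable k n 1 α β := by
  have hp : S.plus i₀ i₀ x = 1 := eq_one_of_mul_self (S.plus_mem i₀ i₀ x ⟨hx, hx⟩)
    (S.plus_cocycle i₀ i₀ i₀ x ⟨⟨hx, hx⟩, hx⟩)
  have hm : S.minus i₀ i₀ x = 1 := eq_one_of_mul_self (S.minus_mem i₀ i₀ x ⟨hx, hx⟩)
    (S.minus_cocycle i₀ i₀ i₀ x ⟨⟨hx, hx⟩, hx⟩)
  simp [decomposableField, hx, hp, hm, hχ]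

variable [IsContMDiffRiemannianBundle 𝓘(ℝ, E4) ∞ E4 (fun x : M => TangentSpace 𝓘(ℝ, E4) x)]

variable {S}

/-- The operator has order zero, so it suffices to prescribe the value of a section at `x`; a
cut-off constant spinor does this. -/
theorem CommutatorVanishes.curvOp_eq_zero {k n : ℕ} (h : S.CommutatorVanishes k n) {i : ι} {x : M}
    (hx : x ∈ S.dom i) (α β : Fin 2 → ℂ) :
    curvOp (riemAt (S.frame i) x) (AlgCurv.linXi α ^ k * AlgCurv.linEta β ^ n) = 0 := by
  obtain ⟨χ, hχ, hs, h1⟩ := exists_bump (S.isOpen_dom i) hx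
  have hψ := S.isSection_decomposableField k n i hχ hs α β
  have h0 := (hψ.commutator_eq_zero_iff hx).1 (h _ hψ i x hx)
  rwa [S.decomposableField_self k n α β hx h1, toPoly_decomposable] at h0

theorem commutatorVanishes_of_blocks {k n : ℕ}
    (hB : 1 ≤ k → ∀ i, ∀ x ∈ S.dom i, ∀ a b, mixedBlock (riemAt (S.frame i) x) a b = 0)
    (hA : 1 ≤ n → ∀ i, ∀ x ∈ S.dom i, IsScalarBlock (asdBlock (riemAt (S.frame i) x))) :
    S.CommutatorVanishes k n := fun _ hψ i x hx =>
  (hψ.commutator_eq_zero_iff hx).2 (curvOp_toPoly_eq_zero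
    (fun hk => ((S.frameOn i).algCurv hx).curvOp_xi_eq_zero (hB hk i x hx))
    (fun hn => ((S.frameOn i).algCurv hx).curvOp_eta_eq_zero (hA hn i x hx)) _)

variable (S)

theorem isEinstein_iff :
    IsEinstein M ↔ ∀ i, ∀ x ∈ S.dom i, ∀ a b, mixedBlock (riemAt (S.frame i) x) a b = 0 := by
  constructor
  · rintro ⟨lam, h⟩ i x hx
    exact ((S.frameOn i).ric_eq_smul_iff hx).1 ⟨lam x, h x⟩
  · intro h
    have : ∀ x : M, ∃ l : ℝ, ∀ u v : TangentSpace 𝓘(ℝ, E4) x, ric x u v = l * inner ℝ u v := by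
      intro x
      obtain ⟨i, hx⟩ := S.cover x
      exact ((S.frameOn i).ric_eq_smul_iff hx).2 (h i x hx)
    exact ⟨fun x => (this x).choose, fun x => (this x).choose_spec⟩

theorem weylMinusVanishes_iff :
    WeylMinusVanishes o ↔ ∀ i, ∀ x ∈ S.dom i, IsScalarBlock (asdBlock (riemAt (S.frame i) x)) := by
  constructor
  · intro h i x hx
    exact ((S.frameOn i).weylMinus_eq_zero_iff hx (S.frame_oriented i x hx)).1 (h x)
  · intro h x
    obtain ⟨i, hx⟩ := S.cover x
    exact ((S.frameOn i).weylMinus_eq_zero_iff hx (S.frame_oriented i x hx)).2 (h i x hx)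

theorem commutatorVanishes_iff {k n : ℕ} (hk : 1 ≤ k) (hn : 1 ≤ n) :
    S.CommutatorVanishes k n ↔ WeylMinusVanishes o ∧ IsEinstein M := by
  rw [S.weylMinusVanishes_iff, S.isEinstein_iff]
  refine ⟨fun h => ?_, fun h => commutatorVanishes_of_blocks (fun _ => h.2) fun _ => h.1⟩
  have key : ∀ i, ∀ x ∈ S.dom i, _ := fun i x hx =>
    ((S.frameOn i).algCurv hx).blocks_of_curvOp_pow_mul_pow hk hn (h.curvOp_eq_zero hx)
  exact ⟨fun i x hx => (key i x hx).2, fun i x hx => (key i x hx).1⟩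

theorem commutatorVanishes_zero_right_iff {k : ℕ} (hk : 1 ≤ k) :
    S.CommutatorVanishes k 0 ↔ IsEinstein M := by
  rw [S.isEinstein_iff]
  refine ⟨fun h i x hx => ?_, fun h => commutatorVanishes_of_blocks (fun _ => h) (by simp)⟩
  refine ((S.frameOn i).algCurv hx).mixedBlock_eq_zero_of_curvOp_pow hk fun α => ?_
  have h0 := h.curvOp_eq_zero hx α 0
  rwa [pow_zero, mul_one] at h0

theorem commutatorVanishes_zero_left_iff {n : ℕ} (hn : 1 ≤ n) :
    S.CommutatorVanishes 0 n ↔ WeylMinusVanishes o := by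
  rw [S.weylMinusVanishes_iff]
  refine ⟨fun h i x hx => ?_, fun h => commutatorVanishes_of_blocks (by simp) (fun _ => h)⟩
  refine ((S.frameOn i).algCurv hx).isScalarBlock_of_curvOp_pow hn fun β => ?_
  have h0 := h.curvOp_eq_zero hx 0 β
  rwa [pow_zero, one_mul] at h0

theorem deltaStarDVanishes_iff (n : ℕ) : S.DeltaStarDVanishes n ↔ S.CommutatorVanishes 0 n :=
  forall_congr' fun _ => imp_congr_right fun _ => forall_congr' fun _ => forall_congr' fun _ =>
    imp_congr_right fun _ => neg_eq_zero.symm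

end SpinStructure

end Sections

end SpinorDiagram

end

theorem proposition2 {M : Type*} [TopologicalSpace M] [T2Space M] [ChartedSpace SpinorDiagram.E4 M]
    [IsManifold 𝓘(ℝ, SpinorDiagram.E4) ∞ M]
    [RiemannianBundle (fun x : M => TangentSpace 𝓘(ℝ, SpinorDiagram.E4) x)]
    [IsContMDiffRiemannianBundle 𝓘(ℝ, SpinorDiagram.E4) ∞ SpinorDiagram.E4
      (fun x : M => TangentSpace 𝓘(ℝ, SpinorDiagram.E4) x)]
    (o : (x : M) → Orientation ℝ (TangentSpace 𝓘(ℝ, SpinorDiagram.E4) x) (Fin 4))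
    {ι : Type*} (S : SpinorDiagram.SpinStructure M o ι) :
    ((∀ k n, S.CommutatorVanishes k n) ↔
      SpinorDiagram.WeylMinusVanishes o ∧ SpinorDiagram.IsEinstein M) ∧
    (∀ k n, 1 ≤ k → 1 ≤ n → (S.CommutatorVanishes k n ↔
      SpinorDiagram.WeylMinusVanishes o ∧ SpinorDiagram.IsEinstein M)) ∧
    (∀ n, 1 ≤ n → (S.DeltaStarDVanishes n ↔ SpinorDiagram.WeylMinusVanishes o)) ∧
    (∀ k, 1 ≤ k → (S.CommutatorVanishes k 0 ↔ SpinorDiagram.IsEinstein M)) := by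
  refine ⟨⟨fun h => (S.commutatorVanishes_iff le_rfl le_rfl).1 (h 1 1), fun h k n => ?_⟩,
    fun k n hk hn => S.commutatorVanishes_iff hk hn,
    fun n hn => (S.deltaStarDVanishes_iff n).trans (S.commutatorVanishes_zero_left_iff hn),
    fun k hk => S.commutatorVanishes_zero_right_iff hk⟩
  exact SpinorDiagram.SpinStructure.commutatorVanishes_of_blocks
    (fun _ => S.isEinstein_iff.1 h.2) (fun _ => S.weylMinusVanishes_iff.1 h.1)
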